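/- **Setting.** Let $\Gamma$ be a finite group, $R(\Gamma)$ its space of complex class functions, $R_{\mathbb Z}(\Gamma)\subset R(\Gamma)$ the lattice of virtual characters, and let $\xi\in R_{\mathbb Z}(\Gamma)$ satisfy $\xi(x^{-1})=\xi(x)$. Put $\langle f,g\rangle_\xi=\frac1{|\Gamma|}\sum_{x\in\Gamma}\xi(x)f(x)g(x^{-1})$; this is an integer for $f,g\in R_{\mathbb Z}(\Gamma)$. *Groups.* Let $\widetilde S_n$ be the group generated by $z,t_1,\dots,t_{n-1}$ with relations $z^2=1$, $t_i^2=(t_it_{i+1})^3=z$, $t_it_j=zt_jt_i$ $(i>j+1)$, $zt_i=t_iz$. It maps to $S_n$ by $t_i\mapsto(i,i+1)$, $z\mapsto 1$, and $\widetilde\Gamma_n=\Gamma^n\rtimes\widetilde S_n$, with parity lifted from $S_n$. Let $R^-(\widetilde\Gamma_n)$ be the space of class functions $f$ on $\widetilde\Gamma_n$ with $f(zx)=-f(x)$ that vanish on odd elements, and $R^-_\Gamma=\bigoplus_{n\ge0}R^-(\widetilde\Gamma_n)$. Let $\widetilde\Gamma_n\hat\times\widetilde\Gamma_m\subset\widetilde\Gamma_{n+m}$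 be the subgroup of products of elements of $\widetilde\Gamma_n$ (first $n$ positions, $t_i\mapsto t_i$) and of $\widetilde\Gamma_m$ (last $m$ positions, $t_j\mapsto t_{n+j}$). The product map $(f\otimes g)(ab)=f(a)g(b)$ identifies $R^-(\widetilde\Gamma_n)\otimes R^-(\widetilde\Gamma_m)$ with the spin class functions on this subgroup that vanish on odd elements. *Characters.* For $\gamma\in R(\Gamma)$ let $\eta_n(\gamma)(g,t)=\prod\gamma(\text{cycle product})$, over the cycles of the permutation underlying $t$ (for the character of a module $V$ this is the character of $V^{\otimes n}$), and $\chi_n(\gamma)(g,t)=\eta_n(\gamma)(g,t)\,\chi_n(t)$, where $\chi_n$ is the character of the basic spin representation of $\widetilde S_n$ on $(\mathbb C^2)^{\otimes\lfloor n/2\rfloor}$: $z$ acts as $-1$ and $t_j$ as $\sqrt{\tfrac{j+1}{2j}}\,e_j-\sqrt{\tfrac{j-1}{2j}}\,e_{j-1}$, with the Clifford generators $e_{2j-1}=\sqrt{-1}\,\sigma_3^{\otimes(j-1)}\otimes\sigma_1\otimes1\otimes\cdots\otimes 1$, $e_{2j}=\sqrt{-1}\,\sigma_3^{\otimes(j-1)}\otimes\sigma_2\otimes1\otimes\cdots\otimes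 1$ ($\sigma_i$ the Pauli matrices). On $R^-(\widetilde\Gamma_n)$ put $\langle u,v\rangle_\xi=|\widetilde\Gamma_n|^{-1}\sum_{x\ \mathrm{even}}\eta_n(\xi)(x)u(x)v(x^{-1})$. *Operators.* Let $\bar n\in\{0,1\}$ be the parity of $n$. For $n\ge0$ let $H_{-n}(\gamma)$ send $f\in R^-(\widetilde\Gamma_m)$ to $\mathrm{Ind}\,(2^{\bar n/2}\chi_n(\gamma)\otimes f)\in R^-(\widetilde\Gamma_{n+m})$, and let $H_n(\gamma)$ send $f\in R^-(\widetilde\Gamma_m)$ to the pairing $\langle 2^{\bar n/2}\chi_n(\gamma),\cdot\rangle_\xi$ with the first tensor factor of $\mathrm{Res}\,f\in R^-(\widetilde\Gamma_n)\otimes R^-(\widetilde\Gamma_{m-n})$ (and to $0$ if $m<n$). Put $H_+(\gamma,z)=\sum_{n\ge0}H_{-n}(\gamma)z^n$ and $H_-(\gamma,z)=\sum_{n\ge0}H_n(\gamma)z^{-n}$. *Lattice part.* Let $c_1(\alpha,\beta)=\langle\alpha,\beta\rangle_\xi+\langle\alpha,\alpha\rangle_\xi\langle\beta,\beta\rangle_\xi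 \bmod 2$ on $R_{\mathbb Z}(\Gamma)$, and let $\Phi\subset R_{\mathbb Z}(\Gamma)$ be a subgroup maximal among those on which $c_1$ vanishes. Let $\hat R$ be a central extension of $R_{\mathbb Z}(\Gamma)/2R_{\mathbb Z}(\Gamma)$ by $\{\pm1\}$ with commutators $aba^{-1}b^{-1}=(-1)^{c_1(\bar a,\bar b)}$. Fix an irreducible $\hat R$-module structure on $\mathbb C[R_{\mathbb Z}(\Gamma)/\Phi]=\bigoplus\mathbb C e^{[\beta]}$ in which $-1\in\hat R$ acts as $-1$ and a lift $e_{\bar\alpha}\in\hat R$ of each $\bar\alpha$ acts by $e_{\bar\alpha}e^{[\beta]}=\epsilon(\alpha,\beta)e^{[\alpha+\beta]}$ with $\epsilon(\alpha,\beta)\in\{\pm1\}$; of the two lifts, $e_{\bar\alpha}$ is the one with $e_{\bar\alpha}e^{[0]}=e^{[\alpha]}$. For $\alpha,\beta\in R_{\mathbb Z}(\Gamma)$ define on $R^-_\Gamma\otimes\mathbb C[R_{\mathbb Z}(\Gamma)/\Phi]$ $$X(\alpha,z)=H_+(\alpha,z)H_-(\alpha,-z)\,e_{\bar\alpha},\qquad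 :X(\alpha,z)X(\beta,w):\;=H_+(\alpha,z)H_+(\beta,w)H_-(\alpha,-z)H_-(\beta,-w)\,e_{\bar\alpha+\bar\beta}.$$ **Theorem.** Below, $\left(\frac{z-w}{z+w}\right)^{a}$ is expanded as a power series in $w/z$, and the identities hold coefficientwise in $z$ and $w$ on every vector, each coefficient on the right being a sum with finitely many non-zero terms. (i) For all $\alpha,\beta\in R(\Gamma)$, as operators on $R^-_\Gamma$, $$H_+(\alpha,z)H_-(\alpha,-z)\,H_+(\beta,w)H_-(\beta,-w)=H_+(\alpha,z)H_+(\beta,w)H_-(\alpha,-z)H_-(\beta,-w)\left(\frac{z-w}{z+w}\right)^{\langle\alpha,\beta\rangle_\xi}.$$ (ii) For all $\alpha,\beta\in R_{\mathbb Z}(\Gamma)$, $$X(\alpha,z)X(\beta,w)=\epsilon(\alpha,\beta)\;:X(\alpha,z)X(\beta,w):\;\left(\frac{z-w}{z+w}\right)^{\langle\alpha,\beta\rangle_\xi}.$$ -/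

import Mathlib

open scoped BigOperators DirectSum TensorProduct

namespace TwistedVertex
noncomputable section

/-! ### The spin group -/

/-- The generators of the spin group `S̃_n`; `t i` stands for `t_{i + 1}`. -/
inductive SpinGen (n : ℕ) : Type
  | z : SpinGen n
  | t (i : Fin (n - 1)) : SpinGen n

/-- The relations `z² = 1`, `t_i² = (t_i t_{i+1})³ = z`, `t_i t_j = z t_j t_i` for `i > j + 1` and
`z t_i = t_i z`. -/
def spinRels (n : ℕ) : Set (FreeGroup (SpinGen n)) :=
  let z : FreeGroup (SpinGen n) := FreeGroup.of SpinGen.z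
  let t : Fin (n - 1) → FreeGroup (SpinGen n) := fun i => FreeGroup.of (SpinGen.t i)
  {r | r = z ^ 2 ∨
    (∃ i, r = t i ^ 2 * z⁻¹) ∨
    (∃ i j : Fin (n - 1), (j : ℕ) = i + 1 ∧ r = (t i * t j) ^ 3 * z⁻¹) ∨
    (∃ i j : Fin (n - 1), (j : ℕ) + 1 < i ∧ r = t i * t j * (z * t j * t i)⁻¹) ∨
    (∃ i, r = z * t i * (t i * z)⁻¹)}

/-- The spin group `S̃_n`, given by generators and relations. -/
abbrev SpinSym (n : ℕ) : Type := PresentedGroup (spinRels n)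

namespace SpinSym

def z (n : ℕ) : SpinSym n := PresentedGroup.of SpinGen.z

def t {n : ℕ} (i : Fin (n - 1)) : SpinSym n := PresentedGroup.of (SpinGen.t i)

/-- The defining relations of the spin group, for elements `z` and `t i` of an arbitrary group. -/
structure Relations {G : Type*} [Group G] (n : ℕ) (z : G) (t : Fin (n - 1) → G) : Prop where
  z_sq : z ^ 2 = 1
  t_sq : ∀ i, t i ^ 2 = z
  braid : ∀ i j : Fin (n - 1), (j : ℕ) = i + 1 → (t i * t j) ^ 3 = z
  far : ∀ i j : Fin (n - 1), (j : ℕ) + 1 < i → t i * t j = z * t j * t i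
  central : ∀ i, z * t i = t i * z

theorem relations (n : ℕ) : Relations n (z n) (t (n := n)) where
  z_sq := PresentedGroup.one_of_mem (rels := spinRels n) (Or.inl rfl)
  t_sq i := mul_inv_eq_one.1
    (PresentedGroup.one_of_mem (rels := spinRels n) (Or.inr (Or.inl ⟨i, rfl⟩)))
  braid i j h := mul_inv_eq_one.1
    (PresentedGroup.one_of_mem (rels := spinRels n) (Or.inr (Or.inr (Or.inl ⟨i, j, h, rfl⟩))))
  far i j h := mul_inv_eq_one.1 (PresentedGroup.one_of_mem (rels := spinRels n)
    (Or.inr (Or.inr (Or.inr (Or.inl ⟨i, j, h, rfl⟩)))))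
  central i := mul_inv_eq_one.1 (PresentedGroup.one_of_mem (rels := spinRels n)
    (Or.inr (Or.inr (Or.inr (Or.inr ⟨i, rfl⟩)))))

def genMap {G : Type*} {n : ℕ} (z : G) (t : Fin (n - 1) → G) : SpinGen n → G
  | SpinGen.z => z
  | SpinGen.t i => t i

/-- The homomorphism out of the spin group determined by elements satisfying its relations. -/
def lift {G : Type*} [Group G] {n : ℕ} {z : G} {t : Fin (n - 1) → G} (h : Relations n z t) :
    SpinSym n →* G :=
  PresentedGroup.toGroup (f := genMap z t) (by
    rintro r (rfl | ⟨i, rfl⟩ | ⟨i, j, hij, rfl⟩ | ⟨i, j, hij, rfl⟩ | ⟨i, rfl⟩)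
    · simpa [genMap] using h.z_sq
    · simpa [genMap, mul_inv_eq_one] using h.t_sq i
    · simpa [genMap, mul_inv_eq_one] using h.braid i j hij
    · simp only [map_mul, map_inv, FreeGroup.lift_apply_of, genMap]
      rw [mul_inv_eq_one]; exact h.far i j hij
    · simp only [map_mul, map_inv, FreeGroup.lift_apply_of, genMap]
      rw [mul_inv_eq_one]; exact h.central i)

theorem lift_z {G : Type*} [Group G] {n : ℕ} {z' : G} {t' : Fin (n - 1) → G}
    (h : Relations n z' t') : lift h (z n) = z' := PresentedGroup.toGroup.of _

theorem lift_t {G : Type*} [Group G] {n : ℕ} {z' : G} {t' : Fin (n - 1) → G}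
    (h : Relations n z' t') (i : Fin (n - 1)) : lift h (t i) = t' i := PresentedGroup.toGroup.of _

theorem hom_ext {G : Type*} [Group G] {n : ℕ} {φ ψ : SpinSym n →* G} (hz : φ (z n) = ψ (z n))
    (ht : ∀ i, φ (t i) = ψ (t i)) : φ = ψ := by
  refine PresentedGroup.ext fun x => ?_
  cases x with
  | z => exact hz
  | t i => exact ht i

theorem closure_induction {n : ℕ} (H : Subgroup (SpinSym n)) (hz : z n ∈ H)
    (ht : ∀ i, t i ∈ H) (x : SpinSym n) : x ∈ H := by
  refine PresentedGroup.generated_by _ H (fun j => ?_) x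
  cases j with
  | z => exact hz
  | t i => exact ht i

theorem z_mul_z (n : ℕ) : z n * z n = 1 := by rw [← sq]; exact (relations n).z_sq

theorem z_comm {n : ℕ} (x : SpinSym n) : z n * x = x * z n := by
  have := closure_induction (Subgroup.centralizer {z n}) (by simp [Subgroup.mem_centralizer_iff])
    (fun i => by simpa [Subgroup.mem_centralizer_iff] using (relations n).central i) x
  simpa [Subgroup.mem_centralizer_iff] using this

/-- The adjacent transposition of positions `i` and `i + 1`. -/
def adjSwap {n : ℕ} (i : Fin (n - 1)) : Equiv.Perm (Fin n) :=
  Equiv.swap ⟨i, by omega⟩ ⟨i + 1, by omega⟩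

theorem adjSwap_relations (n : ℕ) : Relations n (1 : Equiv.Perm (Fin n)) adjSwap where
  z_sq := one_pow 2
  t_sq i := by simp [adjSwap, sq]
  braid i j h := by
    have h3 : (adjSwap i * adjSwap j : Equiv.Perm (Fin n)).IsThreeCycle := by
      have e : (⟨(j : ℕ), by omega⟩ : Fin n) = ⟨i + 1, by omega⟩ := by simp [h]
      rw [adjSwap, adjSwap, e, Equiv.swap_comm]
      apply Equiv.Perm.isThreeCycle_swap_mul_swap_same <;>
        simp [Fin.ext_iff, h] <;> omega
    rw [← h3.orderOf, pow_orderOf_eq_one]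
  far i j h := by
    rw [one_mul]
    refine (Equiv.Perm.disjoint_swap_swap ?_).commute.eq
    simp [Fin.ext_iff]
    omega
  central i := by simp

/-- The projection of the spin group onto the symmetric group. -/
def toPerm (n : ℕ) : SpinSym n →* Equiv.Perm (Fin n) := lift (adjSwap_relations n)

theorem toPerm_z (n : ℕ) : toPerm n (z n) = 1 := lift_z _

theorem toPerm_t {n : ℕ} (i : Fin (n - 1)) : toPerm n (t i) = adjSwap i := lift_t _ i

theorem sign_adjSwap {n : ℕ} (i : Fin (n - 1)) : Equiv.Perm.sign (adjSwap i) = -1 := by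
  rw [adjSwap, Equiv.Perm.sign_swap]
  simp [Fin.ext_iff]

/-- A group generated by `N` elements satisfying the Coxeter relations of type `A` is finite. -/
theorem finite_of_coxeter {Q : Type*} [Group Q] (N : ℕ) (s : ℕ → Q)
    (hsq : ∀ i < N, s i * s i = 1)
    (hbr : ∀ i, i + 1 < N → s (i + 1) * s i * s (i + 1) = s i * s (i + 1) * s i)
    (hfar : ∀ i < N, ∀ j, j + 1 < i → s j * s i = s i * s j)
    (hgen : ∀ H : Subgroup Q, (∀ i < N, s i ∈ H) → H = ⊤) : Finite Q := by
  obtain ⟨w, w0, w1⟩ : ∃ w : ℕ → ℕ → Q, (∀ k, w k 0 = 1) ∧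
      ∀ k l, w k (l + 1) = w k l * s (k - l) :=
    ⟨fun k l => Nat.rec 1 (fun l x => x * s (k - l)) l, fun _ => rfl, fun _ _ => rfl⟩
  have slide1 : ∀ k < N, ∀ l i, i + l < k → w k l * s i = s i * w k l := by
    intro k hk l
    induction l with
    | zero => intro i _; simp [w0]
    | succ l ih =>
      intro i hi
      rw [w1, mul_assoc, ← hfar (k - l) (by omega) i (by omega), ← mul_assoc, ih i (by omega),
        mul_assoc]
  have slide2 : ∀ k < N, ∀ l, l + 1 ≤ k → ∀ i, k - l ≤ i → i ≤ k →
      w k (l + 2) * s i = s (i - 1) * w k (l + 2) := by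
    intro k hk l
    induction l with
    | zero =>
      intro hl i h1 h2
      obtain rfl : i = k := by omega
      obtain ⟨i, rfl⟩ : ∃ j, i = j + 1 := ⟨i - 1, by omega⟩
      simp only [w1, w0, one_mul, Nat.sub_zero, zero_add, Nat.add_sub_cancel]
      rw [hbr i hk, mul_assoc]
    | succ l ih =>
      intro hl i h1 h2
      rcases Nat.eq_or_lt_of_le h1 with h | h
      · obtain ⟨j, rfl⟩ : ∃ j, i = j + 1 := ⟨i - 1, by omega⟩
        have e1 : k - (l + 1) = j + 1 := h
        have e2 : k - (l + 1 + 1) = j := by omega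
        rw [show l + 1 + 2 = (l + 1) + 1 + 1 from rfl, w1, w1, e1, e2, Nat.add_sub_cancel]
        rw [mul_assoc, mul_assoc, ← mul_assoc (s (j + 1)), hbr j (by omega), ← mul_assoc,
          ← mul_assoc, slide1 k hk (l + 1) j (by omega), mul_assoc, mul_assoc, mul_assoc]
      · rw [show l + 1 + 2 = (l + 2) + 1 from rfl, w1, mul_assoc,
          hfar i (by omega) (k - (l + 2)) (by omega), ← mul_assoc,
          ih (by omega) i (by omega) h2, mul_assoc]
  have key : ∀ k ≤ N, ∃ F : Set Q, F.Finite ∧ 1 ∈ F ∧ ∀ i < k, ∀ x ∈ F, x * s i ∈ F := by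
    intro k
    induction k with
    | zero => exact fun _ => ⟨{1}, Set.finite_singleton _, rfl, fun i hi => by omega⟩
    | succ k ih =>
      intro hk
      obtain ⟨F, hF, h1, hm⟩ := ih (by omega)
      refine ⟨Set.image2 (fun u l => u * w k l) F (Set.Iic (k + 1)),
        hF.image2 _ (Set.finite_Iic _), ⟨1, h1, 0, by simp, by simp [w0]⟩, ?_⟩
      rintro i hi _ ⟨u, hu, l, hl, rfl⟩
      simp only [Set.mem_Iic] at hl
      rcases lt_trichotomy (i + l) k with h | h | h
      · exact ⟨u * s i, hm i (by omega) u hu, l, hl, by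
          simp only [mul_assoc, slide1 k (by omega) l i h]⟩
      · refine ⟨u, hu, l + 1, by simp only [Set.mem_Iic]; omega, ?_⟩
        simp only [w1, mul_assoc]
        rw [show k - l = i by omega]
      · rcases Nat.eq_or_lt_of_le (Nat.succ_le_of_lt h) with h' | h'
        · obtain ⟨m, rfl⟩ : ∃ m, l = m + 1 := ⟨l - 1, by omega⟩
          refine ⟨u, hu, m, by simp only [Set.mem_Iic]; omega, ?_⟩
          simp only [w1, mul_assoc]
          rw [show k - m = i by omega, hsq i (by omega), mul_one]
        · obtain ⟨m, rfl⟩ : ∃ m, l = m + 2 := ⟨l - 2, by omega⟩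
          refine ⟨u * s (i - 1), hm _ (by omega) u hu, m + 2, hl, ?_⟩
          simp only [mul_assoc]
          rw [slide2 k (by omega) m (by omega) i (by omega) (by omega)]
  obtain ⟨F, hF, h1, hm⟩ := key N le_rfl
  have hall : ∀ x : Q, x ∈ F := by
    intro x
    have hx : x ∈ Subgroup.closure (s '' Set.Iio N) := by
      rw [hgen (Subgroup.closure (s '' Set.Iio N))
        fun i hi => Subgroup.subset_closure (Set.mem_image_of_mem s hi)]
      trivial
    induction hx using Subgroup.closure_induction_right with
    | one => exact h1
    | mul_right x _ y hy ih => obtain ⟨i, hi, rfl⟩ := hy; exact hm i hi _ ih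
    | mul_inv_cancel x _ y hy ih =>
      obtain ⟨i, hi, rfl⟩ := hy
      rw [inv_eq_of_mul_eq_one_left (hsq i hi)]
      exact hm i hi _ ih
  exact Set.finite_univ_iff.1 (hF.subset fun x _ => hall x)

/-- The spin group is finite. -/
instance finite (n : ℕ) : Finite (SpinSym n) := by
  have hnorm : (Subgroup.zpowers (z n)).Normal := by
    refine ⟨fun x hx g => ?_⟩
    obtain ⟨k, rfl⟩ := Subgroup.mem_zpowers_iff.1 hx
    have : Commute g (z n ^ k) := (show Commute g (z n) from (z_comm g).symm).zpow_right k
    rw [this.eq, mul_inv_cancel_right]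
    exact hx
  have hz : ((z n : SpinSym n) : SpinSym n ⧸ Subgroup.zpowers (z n)) = 1 :=
    (QuotientGroup.eq_one_iff _).2 (Subgroup.mem_zpowers _)
  let π := QuotientGroup.mk' (Subgroup.zpowers (z n))
  have hπz : π (z n) = 1 := hz
  let s : ℕ → SpinSym n ⧸ Subgroup.zpowers (z n) :=
    fun i => if h : i < n - 1 then π (t ⟨i, h⟩) else 1
  have hs : ∀ i (h : i < n - 1), s i = π (t ⟨i, h⟩) := fun i h => dif_pos h
  have hR := relations n
  have hsq : ∀ i < n - 1, s i * s i = 1 := by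
    intro i hi
    rw [hs i hi, ← map_mul, ← sq, hR.t_sq, hπz]
  have hfin : Finite (SpinSym n ⧸ Subgroup.zpowers (z n)) := by
    refine finite_of_coxeter (n - 1) s hsq ?_ ?_ ?_
    · intro i hi
      have h1 : (s i * s (i + 1)) ^ 3 = 1 := by
        rw [hs i (by omega), hs (i + 1) hi, ← map_mul, ← map_pow, hR.braid _ _ rfl, hπz]
      have ha := inv_eq_of_mul_eq_one_left (hsq i (by omega))
      have hb := inv_eq_of_mul_eq_one_left (hsq (i + 1) hi)
      have h2 : s i * s (i + 1) * s i * (s (i + 1) * s i * s (i + 1)) = 1 := by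
        rw [← h1]; simp only [pow_succ, pow_zero, one_mul, mul_assoc]
      have h3 := eq_inv_of_mul_eq_one_left h2
      rw [h3]
      simp [mul_assoc, ha, hb]
    · intro i hi j hj
      rw [hs i hi, hs j (by omega), ← map_mul, ← map_mul,
        hR.far ⟨i, hi⟩ ⟨j, by omega⟩ hj, mul_assoc, map_mul π (z n), hπz,
        one_mul, map_mul]
    · intro H hH
      refine eq_top_iff.2 fun x _ => ?_
      obtain ⟨y, rfl⟩ := QuotientGroup.mk'_surjective _ x
      refine closure_induction (H.comap π) ?_ ?_ y
      · rw [Subgroup.mem_comap, hπz]; exact H.one_mem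
      · intro i
        rw [Subgroup.mem_comap, ← hs i i.2]; exact hH i i.2
  have hz2 : Finite (Subgroup.zpowers (z n)) := by
    rw [← SetLike.coe_sort_coe, Set.finite_coe_iff, finite_zpowers]
    exact isOfFinOrder_iff_pow_eq_one.2 ⟨2, by norm_num, hR.z_sq⟩
  exact Finite.of_equiv _ (Subgroup.groupEquivQuotientProdSubgroup
    (s := Subgroup.zpowers (z n))).symm


/-- The embedding of `{0, …, k - 1}` into `{0, …, m - 1}` as the block `{o, …, o + k - 1}`. -/
def block {k m : ℕ} (o : ℕ) (h : o + k ≤ m) : Fin k ↪ Fin m where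
  toFun i := ⟨o + i, by omega⟩
  inj' i j hij := by simpa [Fin.ext_iff] using hij

theorem block_val {k m : ℕ} (o : ℕ) (h : o + k ≤ m) (i : Fin k) :
    (block o h i : ℕ) = o + i := rfl

theorem block_relations {k m : ℕ} (o : ℕ) (h : o + k ≤ m) :
    Relations k (z m) (fun i => (t ⟨o + i, by omega⟩ : SpinSym m)) where
  z_sq := (relations m).z_sq
  t_sq i := (relations m).t_sq _
  braid i j hij := (relations m).braid _ _ (by simp [hij, add_assoc])
  far i j hij := (relations m).far _ _ (by simp only; omega)
  central i := (relations m).central _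

/-- The homomorphism `t_i ↦ t_{o + i}`, `z ↦ z`. -/
def blockHom {k m : ℕ} (o : ℕ) (h : o + k ≤ m) : SpinSym k →* SpinSym m :=
  lift (block_relations o h)

theorem blockHom_z {k m : ℕ} (o : ℕ) (h : o + k ≤ m) : blockHom o h (z k) = z m := lift_z _

theorem blockHom_t {k m : ℕ} (o : ℕ) (h : o + k ≤ m) (i : Fin (k - 1)) :
    blockHom o h (t i) = t ⟨o + i, by omega⟩ := lift_t _ i

theorem toPerm_blockHom {k m : ℕ} (o : ℕ) (h : o + k ≤ m) (x : SpinSym k) :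
    toPerm m (blockHom o h x) = (toPerm k x).viaEmbedding (block o h) := by
  have : (toPerm m).comp (blockHom o h) =
      (Equiv.Perm.viaEmbeddingHom (block o h)).comp (toPerm k) := by
    refine hom_ext ?_ fun i => ?_
    · simp [blockHom_z, toPerm_z]
    · simp only [MonoidHom.comp_apply, blockHom_t, toPerm_t, Equiv.Perm.viaEmbeddingHom_apply]
      ext j
      by_cases hj : j ∈ Set.range (block o h)
      · obtain ⟨j, rfl⟩ := hj
        rw [Equiv.Perm.viaEmbedding_apply]
        simp only [adjSwap, Equiv.swap_apply_def, Fin.ext_iff, block_val, apply_ite Fin.val,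
          apply_ite (block o h)]
        split_ifs <;> omega
      · rw [Equiv.Perm.viaEmbedding_apply_of_notMem _ _ _ hj, adjSwap,
          Equiv.swap_apply_of_ne_of_ne]
        · rintro rfl; exact hj ⟨⟨i, by omega⟩, rfl⟩
        · rintro rfl; exact hj ⟨⟨i + 1, by omega⟩, rfl⟩
  exact DFunLike.congr_fun this x

/-- The parity homomorphism, with values `1` (even) and `-1` (odd). -/
def parity (n : ℕ) : SpinSym n →* ℤˣ := Equiv.Perm.sign.comp (toPerm n)

theorem parity_z (n : ℕ) : parity n (z n) = 1 := by simp [parity, toPerm_z]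

theorem parity_t {n : ℕ} (i : Fin (n - 1)) : parity n (t i) = -1 := by
  rw [parity, MonoidHom.comp_apply, toPerm_t, sign_adjSwap]

theorem parity_blockHom {k m : ℕ} (o : ℕ) (h : o + k ≤ m) (x : SpinSym k) :
    parity m (blockHom o h x) = parity k x := by
  have : (parity m).comp (blockHom o h) = parity k := by
    refine hom_ext ?_ fun i => ?_
    · simp [blockHom_z, parity_z]
    · rw [MonoidHom.comp_apply, blockHom_t, parity_t, parity_t]
  exact DFunLike.congr_fun this x

/-- Even elements of a block commute with all elements of a later disjoint block. -/
theorem blockHom_comm {k l m o p : ℕ} (h : o + k ≤ m) (h' : p + l ≤ m) (hop : o + k ≤ p)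
    (x : SpinSym k) (hx : parity k x = 1) (y : SpinSym l) :
    blockHom o h x * blockHom p h' y = blockHom p h' y * blockHom o h x := by
  let ζ : ℤˣ → SpinSym m := fun u => if u = 1 then 1 else z m
  have hζ : ∀ u v, ζ (u * v) = ζ u * ζ v := by
    intro u v
    rcases Int.units_eq_one_or u with rfl | rfl <;> rcases Int.units_eq_one_or v with rfl | rfl <;>
      simp [ζ, z_mul_z]
  have hζc : ∀ u (g : SpinSym m), ζ u * g = g * ζ u := by
    intro u g
    rcases Int.units_eq_one_or u with rfl | rfl
    · simp [ζ]
    · simpa [ζ] using z_comm g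
  let Z : ℤˣ →* SpinSym m := ⟨⟨ζ, by simp [ζ]⟩, hζ⟩
  have key : ∀ j : Fin (l - 1), Commute (blockHom p h' (t j)) (blockHom o h x) := by
    intro j
    let φ : SpinSym k →* SpinSym m :=
      (MulAut.conj (blockHom p h' (t j))).toMonoidHom.comp (blockHom o h)
    let ψ : SpinSym k →* SpinSym m :=
      ⟨⟨fun x => blockHom o h x * ζ (parity k x), by simp [ζ]⟩, fun a b => by
        simp only [map_mul, hζ, mul_assoc]
        congr 1
        rw [← mul_assoc, ← mul_assoc, hζc]⟩
    have e : φ = ψ := by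
      refine hom_ext ?_ fun i => ?_
      · simp only [φ, ψ, MonoidHom.comp_apply, MonoidHom.coe_mk, OneHom.coe_mk, blockHom_z,
          parity_z, MulEquiv.toMonoidHom_eq_coe, MonoidHom.coe_coe, MulAut.conj_apply]
        rw [← z_comm, mul_inv_cancel_right]; simp [ζ]
      · simp only [φ, ψ, MonoidHom.comp_apply, MonoidHom.coe_mk, OneHom.coe_mk, blockHom_t,
          parity_t, MulEquiv.toMonoidHom_eq_coe, MonoidHom.coe_coe, MulAut.conj_apply]
        rw [mul_inv_eq_iff_eq_mul, (relations m).far _ _ (by simp only; omega), mul_assoc,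
          z_comm, mul_assoc, mul_assoc]
        congr 1
        have : ζ (-1) = z m := by simp [ζ]
        rw [this, z_comm]
    have e' := DFunLike.congr_fun e x
    simp only [φ, ψ, MonoidHom.comp_apply, MonoidHom.coe_mk, OneHom.coe_mk, hx,
      MulEquiv.toMonoidHom_eq_coe, MonoidHom.coe_coe, MulAut.conj_apply] at e'
    rw [mul_inv_eq_iff_eq_mul] at e'
    simpa [ζ, Commute, SemiconjBy] using e'
  have := closure_induction
    ((Subgroup.centralizer {blockHom o h x}).comap (blockHom p h')) ?_ ?_ y
  · simpa [Subgroup.mem_centralizer_iff] using this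
  · simp only [Subgroup.mem_comap, Subgroup.mem_centralizer_iff, Set.mem_singleton_iff,
      forall_eq, blockHom_z]
    exact (z_comm _).symm
  · intro j
    simp only [Subgroup.mem_comap, Subgroup.mem_centralizer_iff, Set.mem_singleton_iff, forall_eq]
    exact (key j).symm.eq

end SpinSym

/-! ### The basic spin representation -/

section Clifford

open Matrix

/-- The Pauli spin matrix `σ₁`. -/
def pauli1 : Matrix (Fin 2) (Fin 2) ℂ := !![0, 1; 1, 0]

/-- The Pauli spin matrix `σ₂`. -/
def pauli2 : Matrix (Fin 2) (Fin 2) ℂ := !![0, -Complex.I; Complex.I, 0]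

/-- The Pauli spin matrix `σ₃`. -/
def pauli3 : Matrix (Fin 2) (Fin 2) ℂ := !![1, 0; 0, -1]

/-- The tensor product `f 0 ⊗ f 1 ⊗ ⋯ ⊗ f (k - 1)` of `2 × 2` matrices, acting on the `k`-fold tensor
power of `ℂ²`, whose standard basis is indexed by `Fin k → Fin 2`. -/
def kron {k : ℕ} (f : Fin k → Matrix (Fin 2) (Fin 2) ℂ) :
    Matrix (Fin k → Fin 2) (Fin k → Fin 2) ℂ :=
  Matrix.of fun x y => ∏ i, f i (x i) (y i)

theorem kron_mul {k : ℕ} (f g : Fin k → Matrix (Fin 2) (Fin 2) ℂ) :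
    kron f * kron g = kron fun i => f i * g i := by
  ext x y
  simp only [kron, Matrix.mul_apply, Matrix.of_apply, ← Finset.prod_mul_distrib,
    Finset.prod_univ_sum, Fintype.piFinset_univ]

theorem kron_one (k : ℕ) : kron (fun _ : Fin k => 1) = 1 := by
  ext x y
  simp only [kron, Matrix.of_apply, Matrix.one_apply]
  by_cases h : x = y
  · simp [h]
  · rw [if_neg h]
    obtain ⟨i, hi⟩ := Function.ne_iff.1 h
    exact Finset.prod_eq_zero (Finset.mem_univ i) (if_neg hi)

theorem kron_anticomm {k : ℕ} (f g : Fin k → Matrix (Fin 2) (Fin 2) ℂ) (a : Fin k)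
    (ha : f a * g a = -(g a * f a)) (h : ∀ i, i ≠ a → f i * g i = g i * f i) :
    kron f * kron g = -(kron g * kron f) := by
  rw [kron_mul, kron_mul]
  ext x y
  simp only [kron, Matrix.of_apply, Matrix.neg_apply]
  rw [← Finset.mul_prod_erase _ _ (Finset.mem_univ a),
    ← Finset.mul_prod_erase _ _ (Finset.mem_univ a), ha, Matrix.neg_apply, neg_mul]
  congr 2
  exact Finset.prod_congr rfl fun i hi => by rw [h i (Finset.ne_of_mem_erase hi)]

/-- The tensor factors of the Clifford generators: the generator with (zero-based) index `a` is
`i σ₃ ⊗ ⋯ ⊗ σ₃ ⊗ σ ⊗ 1 ⊗ ⋯ ⊗ 1` with `σ` in position `⌊a / 2⌋`, where `σ = σ₁` if `a` is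
even and `σ = σ₂` if `a` is odd. -/
def cliffordFactor (k a : ℕ) (i : Fin k) : Matrix (Fin 2) (Fin 2) ℂ :=
  if (i : ℕ) < a / 2 then pauli3
  else if (i : ℕ) = a / 2 then (if a % 2 = 0 then pauli1 else pauli2)
  else 1

/-- The Clifford generator `e_{a + 1}`, acting on the `k`-fold tensor power of `ℂ²`. -/
def cliffordGen (k a : ℕ) : Matrix (Fin k → Fin 2) (Fin k → Fin 2) ℂ :=
  Complex.I • kron (cliffordFactor k a)

theorem pauli_sq : pauli1 * pauli1 = 1 ∧ pauli2 * pauli2 = 1 ∧ pauli3 * pauli3 = 1 := by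
  refine ⟨?_, ?_, ?_⟩ <;> ext i j <;> fin_cases i <;> fin_cases j <;>
    simp [pauli1, pauli2, pauli3, Matrix.mul_apply, Fin.sum_univ_two]

theorem pauli_anticomm : pauli1 * pauli2 = -(pauli2 * pauli1) ∧
    pauli3 * pauli1 = -(pauli1 * pauli3) ∧ pauli3 * pauli2 = -(pauli2 * pauli3) := by
  refine ⟨?_, ?_, ?_⟩ <;> ext i j <;> fin_cases i <;> fin_cases j <;>
    simp [pauli1, pauli2, pauli3, Matrix.mul_apply, Fin.sum_univ_two]

theorem cliffordGen_sq (k a : ℕ) : cliffordGen k a * cliffordGen k a = -1 := by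
  rw [cliffordGen, smul_mul_smul_comm, Complex.I_mul_I, kron_mul]
  have : (fun i => cliffordFactor k a i * cliffordFactor k a i) = fun _ => 1 := by
    funext i
    unfold cliffordFactor
    split_ifs <;> simp [pauli_sq]
  rw [this, kron_one, neg_one_smul]

theorem cliffordGen_anticomm {k a b : ℕ} (hab : a < b) (ha : a / 2 < k) :
    cliffordGen k a * cliffordGen k b = -(cliffordGen k b * cliffordGen k a) := by
  rw [cliffordGen, cliffordGen, smul_mul_smul_comm, smul_mul_smul_comm,
    kron_anticomm _ _ ⟨a / 2, ha⟩, smul_neg]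
  · have fa : cliffordFactor k a ⟨a / 2, ha⟩ = if a % 2 = 0 then pauli1 else pauli2 := by
      simp [cliffordFactor]
    rcases Nat.eq_or_lt_of_le (Nat.div_le_div_right (c := 2) hab.le) with h | h
    · have fb : cliffordFactor k b ⟨a / 2, ha⟩ = if b % 2 = 0 then pauli1 else pauli2 := by
        simp [cliffordFactor, h]
      rw [fa, fb, if_pos (by omega), if_neg (by omega)]
      exact pauli_anticomm.1
    · have fb : cliffordFactor k b ⟨a / 2, ha⟩ = pauli3 := by
        simp [cliffordFactor, h]
      rw [fa, fb]
      split_ifs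
      · rw [pauli_anticomm.2.1, neg_neg]
      · rw [pauli_anticomm.2.2, neg_neg]
  · intro i hi
    have hi' : (i : ℕ) ≠ a / 2 := fun h => hi (Fin.ext h)
    unfold cliffordFactor
    rcases lt_or_ge (i : ℕ) (a / 2) with h | h
    · rw [if_pos h, if_pos (by omega)]
    · rw [if_neg (by omega), if_neg hi']
      simp

/-- The Clifford relations `e_a e_b + e_b e_a = -2 δ_{ab}`. -/
theorem clifford_relation {k a b : ℕ} (ha : a / 2 < k) (hb : b / 2 < k) :
    cliffordGen k a * cliffordGen k b + cliffordGen k b * cliffordGen k a =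
      (if a = b then (-2 : ℂ) else 0) • 1 := by
  rcases lt_trichotomy a b with h | rfl | h
  · rw [cliffordGen_anticomm h ha, if_neg h.ne]; simp
  · rw [cliffordGen_sq, if_pos rfl, neg_smul, two_smul]; abel
  · rw [cliffordGen_anticomm h hb, if_neg h.ne']; simp

/-- The operator by which `t_{i + 1}` acts in the basic spin representation,
`√((j + 1) / 2j) e_j - √((j - 1) / 2j) e_{j - 1}` with `j = i + 1`; for `j = 1` the second
coefficient vanishes. -/
def basicGen (k i : ℕ) : Matrix (Fin k → Fin 2) (Fin k → Fin 2) ℂ :=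
  (Real.sqrt ((i + 2) / (2 * (i + 1))) : ℂ) • cliffordGen k i -
    (Real.sqrt (i / (2 * (i + 1))) : ℂ) • cliffordGen k (i - 1)

theorem basicGen_anticomm {k i j : ℕ} (hi : i / 2 < k) (hj : j / 2 < k) :
    basicGen k i * basicGen k j + basicGen k j * basicGen k i =
      ((Real.sqrt ((i + 2) / (2 * (i + 1))) * Real.sqrt ((j + 2) / (2 * (j + 1))) : ℂ) *
          (if i = j then -2 else 0) -
        (Real.sqrt ((i + 2) / (2 * (i + 1))) * Real.sqrt (j / (2 * (j + 1))) : ℂ) *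
          (if i = j - 1 then -2 else 0) -
        (Real.sqrt (i / (2 * (i + 1))) * Real.sqrt ((j + 2) / (2 * (j + 1))) : ℂ) *
          (if i - 1 = j then -2 else 0) +
        (Real.sqrt (i / (2 * (i + 1))) * Real.sqrt (j / (2 * (j + 1))) : ℂ) *
          (if i - 1 = j - 1 then -2 else 0)) • 1 := by
  have h1 := clifford_relation hi hj
  have h2 := clifford_relation hi (show (j - 1) / 2 < k by omega)
  have h3 := clifford_relation (show (i - 1) / 2 < k by omega) hj
  have h4 := clifford_relation (show (i - 1) / 2 < k by omega) (show (j - 1) / 2 < k by omega)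
  unfold basicGen
  generalize (Real.sqrt ((i + 2) / (2 * (i + 1))) : ℂ) = p
  generalize (Real.sqrt ((j + 2) / (2 * (j + 1))) : ℂ) = p'
  generalize (Real.sqrt (i / (2 * (i + 1))) : ℂ) = q
  generalize (Real.sqrt (j / (2 * (j + 1))) : ℂ) = q'
  rw [add_smul, sub_smul, sub_smul, mul_smul (p * p'), mul_smul (p * q'), mul_smul (q * p'),
    mul_smul (q * q'), ← h1, ← h2, ← h3, ← h4]
  simp only [sub_mul, mul_sub, smul_mul_smul_comm]
  module

theorem basicGen_sq {k i : ℕ} (hi : i / 2 < k) : basicGen k i * basicGen k i = -1 := by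
  have h := basicGen_anticomm hi hi
  have p : (Real.sqrt ((i + 2) / (2 * (i + 1))) * Real.sqrt ((i + 2) / (2 * (i + 1))) : ℂ) =
      (i + 2) / (2 * (i + 1)) := by
    rw [← Complex.ofReal_mul, Real.mul_self_sqrt (by positivity)]; push_cast; rfl
  have q : (Real.sqrt (i / (2 * (i + 1))) * Real.sqrt (i / (2 * (i + 1))) : ℂ) =
      i / (2 * (i + 1)) := by
    rw [← Complex.ofReal_mul, Real.mul_self_sqrt (by positivity)]; push_cast; rfl
  have hc : (i : ℂ) + 1 ≠ 0 := by exact_mod_cast Nat.succ_ne_zero i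
  have e : ((i : ℂ) + 2) / (2 * (i + 1)) * -2 + i / (2 * (i + 1)) * -2 = -2 := by
    field_simp; ring
  have h' : (2 : ℂ) • (basicGen k i * basicGen k i) = (-2 : ℂ) • 1 := by
    rw [two_smul, h, p, q, if_pos rfl, if_pos rfl]
    rcases Nat.eq_zero_or_pos i with rfl | hpos
    · simp
    · rw [if_neg (by omega), if_neg (by omega), mul_zero, mul_zero, sub_zero, sub_zero, e]
  have h2 : (2 : ℂ) ≠ 0 := two_ne_zero
  apply smul_right_injective _ h2
  simp only [h', neg_smul, smul_neg]

theorem basicGen_braid {k i : ℕ} (hi : (i + 1) / 2 < k) :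
    (basicGen k i * basicGen k (i + 1)) ^ 3 = -1 := by
  have h := basicGen_anticomm (show i / 2 < k by omega) hi
  have c : (Real.sqrt ((i + 2) / (2 * (i + 1))) *
      Real.sqrt ((i + 1 : ℕ) / (2 * ((i + 1 : ℕ) + 1))) : ℂ) = 1 / 2 := by
    rw [← Complex.ofReal_mul, ← Real.sqrt_mul (by positivity),
      show ((i : ℝ) + 2) / (2 * (i + 1)) * (((i + 1 : ℕ) : ℝ) / (2 * ((i + 1 : ℕ) + 1))) =
        (1 / 2) ^ 2 by push_cast; field_simp; ring,
      Real.sqrt_sq (by norm_num)]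
    norm_num
  rw [if_neg (by omega), if_pos (by omega), if_neg (by omega), c] at h
  have h1 : basicGen k i * basicGen k (i + 1) + basicGen k (i + 1) * basicGen k i = 1 := by
    rw [h]
    rcases Nat.eq_zero_or_pos i with rfl | hpos
    · simp
    · rw [if_neg (by omega)]; simp
  set x := basicGen k i * basicGen k (i + 1) with hx
  have hy : basicGen k (i + 1) * basicGen k i = 1 - x := eq_sub_of_add_eq' h1
  have hxy : x * (1 - x) = 1 := by
    rw [← hy, hx, mul_assoc, ← mul_assoc (basicGen k (i + 1)), basicGen_sq hi, neg_one_mul, mul_neg,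
      basicGen_sq (by omega), neg_neg]
  have h2 : x * x = x - 1 := by
    rw [mul_sub, mul_one] at hxy
    rw [← hxy]; abel
  rw [pow_succ, sq, h2, sub_mul, one_mul, h2]; abel

theorem basicGen_far {k i j : ℕ} (hi : i / 2 < k) (hij : j + 1 < i) :
    basicGen k i * basicGen k j = -(basicGen k j * basicGen k i) := by
  have h := basicGen_anticomm hi (show j / 2 < k by omega)
  rw [if_neg (by omega), if_neg (by omega), if_neg (by omega), if_neg (by omega)] at h
  rw [← add_eq_zero_iff_eq_neg, h]
  simp

def basicUnit (n : ℕ) (i : Fin (n - 1)) :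
    (Matrix (Fin (n / 2) → Fin 2) (Fin (n / 2) → Fin 2) ℂ)ˣ where
  val := basicGen (n / 2) i
  inv := -basicGen (n / 2) i
  val_inv := by rw [mul_neg, basicGen_sq (by omega), neg_neg]
  inv_val := by rw [neg_mul, basicGen_sq (by omega), neg_neg]

theorem basicUnit_relations (n : ℕ) : SpinSym.Relations n (-1) (basicUnit n) where
  z_sq := by simp
  t_sq i := by
    ext1
    simpa [sq, basicUnit] using basicGen_sq (show (i : ℕ) / 2 < n / 2 by omega)
  braid i j hij := by
    ext1
    simpa [basicUnit, hij] using basicGen_braid (show ((i : ℕ) + 1) / 2 < n / 2 by omega)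
  far i j hij := by
    ext1
    simpa [basicUnit] using basicGen_far (show (i : ℕ) / 2 < n / 2 by omega) hij
  central i := by ext1; simp

/-- The basic spin representation of the spin group on the `⌊n / 2⌋`-fold tensor power of `ℂ²`;
the central element `z` acts as `-1`. -/
def basicSpin (n : ℕ) : SpinSym n →* (Matrix (Fin (n / 2) → Fin 2) (Fin (n / 2) → Fin 2) ℂ)ˣ :=
  SpinSym.lift (basicUnit_relations n)

/-- The character of the basic spin representation. -/
def basicChar (n : ℕ) (x : SpinSym n) : ℂ := (basicSpin n x).val.trace

theorem grading_anticomm {k a : ℕ} (ha : a / 2 < k) :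
    kron (fun _ : Fin k => pauli3) * cliffordGen k a =
      -(cliffordGen k a * kron (fun _ : Fin k => pauli3)) := by
  rw [cliffordGen, mul_smul_comm, smul_mul_assoc, kron_anticomm _ _ ⟨a / 2, ha⟩, smul_neg]
  · unfold cliffordFactor
    rw [if_neg (by simp), if_pos rfl]
    split_ifs
    exacts [pauli_anticomm.2.1, pauli_anticomm.2.2]
  · intro i hi
    have hi' : (i : ℕ) ≠ a / 2 := fun h => hi (Fin.ext h)
    unfold cliffordFactor
    rw [if_neg hi']
    split_ifs <;> simp

/-- The character of the basic spin representation vanishes on odd elements. -/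
theorem basicChar_odd {n : ℕ} {x : SpinSym n} (hx : SpinSym.parity n x = -1) :
    basicChar n x = 0 := by
  set P := kron (fun _ : Fin (n / 2) => pauli3) with hP
  have hPP : P * P = 1 := by rw [hP, kron_mul]; simp [pauli_sq, kron_one]
  let U : (Matrix (Fin (n / 2) → Fin 2) (Fin (n / 2) → Fin 2) ℂ)ˣ := ⟨P, P, hPP, hPP⟩
  let ε : ℤˣ →* (Matrix (Fin (n / 2) → Fin 2) (Fin (n / 2) → Fin 2) ℂ)ˣ :=
    Units.map (Int.castRingHom _).toMonoidHom
  have hε : ∀ u M, ε u * M = M * ε u := by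
    intro u M
    rcases Int.units_eq_one_or u with rfl | rfl
    · simp
    · ext1; simp [ε]
  let ψ : SpinSym n →* (Matrix (Fin (n / 2) → Fin 2) (Fin (n / 2) → Fin 2) ℂ)ˣ :=
    ⟨⟨fun x => ε (SpinSym.parity n x) * basicSpin n x, by simp⟩, fun a b => by
      simp only [map_mul, mul_assoc]
      congr 1
      rw [← mul_assoc, ← mul_assoc, hε]⟩
  have e : (MulAut.conj U).toMonoidHom.comp (basicSpin n) = ψ := by
    refine SpinSym.hom_ext ?_ fun i => ?_
    · have hz : basicSpin n (SpinSym.z n) = -1 := SpinSym.lift_z _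
      simp [ψ, hz, SpinSym.parity_z]
    · have ht : basicSpin n (SpinSym.t i) = basicUnit n i := SpinSym.lift_t _ i
      simp only [ψ, MonoidHom.comp_apply, MonoidHom.coe_mk, OneHom.coe_mk, ht, SpinSym.parity_t,
        MulEquiv.toMonoidHom_eq_coe, MonoidHom.coe_coe, MulAut.conj_apply]
      rw [mul_inv_eq_iff_eq_mul]
      ext1
      have hc : P * basicGen (n / 2) i = -(basicGen (n / 2) i * P) := by
        unfold basicGen
        rw [mul_sub, sub_mul, mul_smul_comm, mul_smul_comm, grading_anticomm (by omega),
          grading_anticomm (by omega), smul_mul_assoc, smul_mul_assoc, smul_neg, smul_neg]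
        abel
      simpa [U, ε, basicUnit] using hc
  have e' := congrArg Units.val (DFunLike.congr_fun e x)
  simp only [ψ, MonoidHom.comp_apply, MonoidHom.coe_mk, OneHom.coe_mk, hx,
    MulEquiv.toMonoidHom_eq_coe, MonoidHom.coe_coe, MulAut.conj_apply, Units.val_mul] at e'
  have e2 : (P * (basicSpin n x).val * P).trace = -(basicSpin n x).val.trace := by
    have : (P * (basicSpin n x).val * P) = -(basicSpin n x).val := by
      simpa [U, ε] using e'
    rw [this, Matrix.trace_neg]
  rw [Matrix.trace_mul_comm, ← mul_assoc, hPP, one_mul] at e2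
  unfold basicChar
  linear_combination e2 / 2

end Clifford


/-! ### Spin wreath products -/

section Wreath

variable (Γ : Type*) [Group Γ]

/-- The action of the symmetric group on `Γⁿ`, `(s g)_i = g_{s⁻¹ i}`. -/
def permAct (n : ℕ) : Equiv.Perm (Fin n) →* MulAut (Fin n → Γ) where
  toFun s :=
    { toFun := fun g i => g (s⁻¹ i)
      invFun := fun g i => g (s i)
      left_inv := fun g => by funext i; simp
      right_inv := fun g => by funext i; simp
      map_mul' := fun _ _ => rfl }
  map_one' := rfl
  map_mul' _ _ := rfl

/-- The spin wreath product `Γⁿ ⋊ S̃_n`, the spin group acting through the symmetric group. -/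
abbrev SpinWreath (n : ℕ) : Type _ :=
  (Fin n → Γ) ⋊[(permAct Γ n).comp (SpinSym.toPerm n)] SpinSym n

variable {Γ}

namespace SpinWreath

instance finite [Finite Γ] (n : ℕ) : Finite (SpinWreath Γ n) :=
  Finite.of_equiv _ SemidirectProduct.equivProd.symm

instance fintype [Finite Γ] (n : ℕ) : Fintype (SpinWreath Γ n) := Fintype.ofFinite _

/-- The central involution. -/
def z (n : ℕ) : SpinWreath Γ n := SemidirectProduct.inr (SpinSym.z n)

/-- The parity homomorphism, with values `1` (even) and `-1` (odd). -/
def parity (n : ℕ) : SpinWreath Γ n →* ℤˣ := (SpinSym.parity n).comp SemidirectProduct.rightHom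

theorem z_comm {n : ℕ} (x : SpinWreath Γ n) : z n * x = x * z n := by
  ext1
  · simp [z, SpinSym.toPerm_z]
  · simpa [z] using SpinSym.z_comm x.right

theorem z_mul_z (n : ℕ) : (z n * z n : SpinWreath Γ n) = 1 := by
  rw [z, ← map_mul, SpinSym.z_mul_z, map_one]

theorem parity_z (n : ℕ) : parity n (z n : SpinWreath Γ n) = 1 := by
  simp [parity, z, SpinSym.parity_z]

/-- Extension of a tuple by `1` outside of a block. -/
def extendHom {k m : ℕ} (o : ℕ) (h : o + k ≤ m) : (Fin k → Γ) →* (Fin m → Γ) where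
  toFun g := Function.extend (SpinSym.block o h) g 1
  map_one' := by
    funext i
    by_cases hi : i ∈ Set.range (SpinSym.block o h)
    · obtain ⟨i, rfl⟩ := hi
      rw [(SpinSym.block o h).injective.extend_apply]; rfl
    · rw [Function.extend_apply' _ _ _ hi]
  map_mul' g g' := by
    funext i
    by_cases hi : i ∈ Set.range (SpinSym.block o h)
    · obtain ⟨i, rfl⟩ := hi
      simp [(SpinSym.block o h).injective.extend_apply]
    · simp [Function.extend_apply' _ _ _ hi]

theorem extendHom_block {k m : ℕ} (o : ℕ) (h : o + k ≤ m) (g : Fin k → Γ) (i : Fin k) :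
    extendHom o h g (SpinSym.block o h i) = g i :=
  (SpinSym.block o h).injective.extend_apply _ _ _

theorem extendHom_of_notMem {k m : ℕ} (o : ℕ) (h : o + k ≤ m) (g : Fin k → Γ) {i : Fin m}
    (hi : i ∉ Set.range (SpinSym.block o h)) : extendHom o h g i = 1 :=
  Function.extend_apply' _ _ _ hi

/-- The embedding of a spin wreath product into a larger one on the block of positions
`o, …, o + k - 1`, given by `t_i ↦ t_{o + i}` and `z ↦ z`. -/
def blockHom {k m : ℕ} (o : ℕ) (h : o + k ≤ m) : SpinWreath Γ k →* SpinWreath Γ m :=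
  SemidirectProduct.map (extendHom o h) (SpinSym.blockHom o h) (by
    intro t
    refine MonoidHom.ext fun g => ?_
    funext i
    change extendHom o h (permAct Γ k (SpinSym.toPerm k t) g) i =
      extendHom o h g ((SpinSym.toPerm m (SpinSym.blockHom o h t))⁻¹ i)
    rw [SpinSym.toPerm_blockHom, ← Equiv.Perm.viaEmbeddingHom_apply, ← map_inv,
      Equiv.Perm.viaEmbeddingHom_apply]
    by_cases hi : i ∈ Set.range (SpinSym.block o h)
    · obtain ⟨i, rfl⟩ := hi
      rw [Equiv.Perm.viaEmbedding_apply, extendHom_block, extendHom_block]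
      rfl
    · rw [Equiv.Perm.viaEmbedding_apply_of_notMem _ _ _ hi, extendHom_of_notMem _ _ _ hi,
        extendHom_of_notMem _ _ _ hi])

theorem blockHom_z {k m : ℕ} (o : ℕ) (h : o + k ≤ m) : blockHom o h (z k : SpinWreath Γ k) = z m := by
  rw [blockHom, z, SemidirectProduct.map_inr, SpinSym.blockHom_z, z]

theorem parity_blockHom {k m : ℕ} (o : ℕ) (h : o + k ≤ m) (x : SpinWreath Γ k) :
    parity m (blockHom o h x) = parity k x := by
  simp [parity, blockHom, SpinSym.parity_blockHom]

theorem act_extendHom {k l m o p : ℕ} (h : o + k ≤ m) (h' : p + l ≤ m)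
    (hop : o + k ≤ p ∨ p + l ≤ o) (t : SpinSym k) (g : Fin l → Γ) :
    permAct Γ m (SpinSym.toPerm m (SpinSym.blockHom o h t)) (extendHom p h' g) =
      extendHom p h' g := by
  funext i
  change extendHom p h' g ((SpinSym.toPerm m (SpinSym.blockHom o h t))⁻¹ i) = _
  rw [SpinSym.toPerm_blockHom, ← Equiv.Perm.viaEmbeddingHom_apply, ← map_inv,
    Equiv.Perm.viaEmbeddingHom_apply]
  have hd : ∀ j : Fin k, SpinSym.block o h j ∉ Set.range (SpinSym.block p h') := by
    rintro j ⟨j', hj⟩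
    have := congrArg Fin.val hj
    simp only [SpinSym.block_val] at this
    omega
  by_cases hi : i ∈ Set.range (SpinSym.block o h)
  · obtain ⟨i, rfl⟩ := hi
    rw [Equiv.Perm.viaEmbedding_apply, extendHom_of_notMem _ _ _ (hd _),
      extendHom_of_notMem _ _ _ (hd _)]
  · rw [Equiv.Perm.viaEmbedding_apply_of_notMem _ _ _ hi]

/-- Even elements of a block commute with all elements of a later disjoint block. -/
theorem blockHom_comm {k l m o p : ℕ} (h : o + k ≤ m) (h' : p + l ≤ m) (hop : o + k ≤ p)
    (x : SpinWreath Γ k) (hx : parity k x = 1) (y : SpinWreath Γ l) :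
    blockHom o h x * blockHom p h' y = blockHom p h' y * blockHom o h x := by
  ext1
  · change extendHom o h x.left * permAct Γ m (SpinSym.toPerm m (SpinSym.blockHom o h x.right))
        (extendHom p h' y.left) =
      extendHom p h' y.left * permAct Γ m (SpinSym.toPerm m (SpinSym.blockHom p h' y.right))
        (extendHom o h x.left)
    rw [act_extendHom _ _ (Or.inl hop), act_extendHom _ _ (Or.inr hop)]
    funext i
    rw [Pi.mul_apply, Pi.mul_apply]
    by_cases hi : i ∈ Set.range (SpinSym.block o h)
    · rw [extendHom_of_notMem (i := i) p h']
      · simp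
      · rintro ⟨j', hj⟩
        obtain ⟨j, rfl⟩ := hi
        have := congrArg Fin.val hj
        simp only [SpinSym.block_val] at this
        omega
    · rw [extendHom_of_notMem _ _ _ hi]; simp
  · exact SpinSym.blockHom_comm h h' hop x.right hx y.right

end SpinWreath

/-! ### Class functions on spin wreath products -/

/-- The space of spin super class functions: class functions `f` with `f (z x) = - f x` that vanish
on odd elements. -/
def superClass (Γ : Type*) [Group Γ] (n : ℕ) : Submodule ℂ (SpinWreath Γ n → ℂ) where
  carrier := {f | (∀ x y, f (y * x * y⁻¹) = f x) ∧ (∀ x, f (SpinWreath.z n * x) = -f x) ∧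
    ∀ x, SpinWreath.parity n x = -1 → f x = 0}
  zero_mem' := by simp
  add_mem' := by
    rintro f g ⟨h1, h2, h3⟩ ⟨k1, k2, k3⟩
    refine ⟨fun x y => by simp [h1, k1], fun x => by simp [h2, k2]; ring, fun x hx => ?_⟩
    simp [h3 x hx, k3 x hx]
  smul_mem' := by
    rintro c f ⟨h1, h2, h3⟩
    exact ⟨fun x y => by simp [h1], fun x => by simp [h2], fun x hx => by simp [h3 x hx]⟩

/-- The product `g_{s^{m-1} i} ⋯ g_{s i} g_i` along the cycle of length `m` of `s` through `i`. -/
def cycleProd {n : ℕ} (g : Fin n → Γ) (s : Equiv.Perm (Fin n)) (i : Fin n) : Γ :=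
  ((List.range (Function.minimalPeriod s i)).reverse.map fun k => g ((s ^ k) i)).prod

open Classical in
/-- The class function `η_n(γ)`, with value `∏ γ(cycle product)` over all cycles of the underlying
permutation, each cycle being represented by its least element. If `γ` is the character of a
`Γ`-module `V` this is the character of `V^{⊗ n}`. -/
def wreathChar (γ : Γ → ℂ) {n : ℕ} (x : SpinWreath Γ n) : ℂ :=
  let s := SpinSym.toPerm n x.right
  ∏ i ∈ Finset.univ.filter (fun i : Fin n => ∀ k : ℕ, i ≤ (s ^ k) i), γ (cycleProd x.left s i)

/-- The spin super character `χ_n(γ)`; if `γ` is the character of a `Γ`-module `V` this is the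
character of `V^{⊗ n}` tensored with the basic spin representation. -/
def spinChar (γ : Γ → ℂ) (n : ℕ) (x : SpinWreath Γ n) : ℂ :=
  wreathChar γ x * basicChar n x.right

/-- The normalized character `2^{n̄ / 2} χ_n(γ)`, where `n̄ ∈ {0, 1}` is the parity of `n`. -/
def normSpinChar (γ : Γ → ℂ) (n : ℕ) (x : SpinWreath Γ n) : ℂ :=
  (Real.sqrt 2 : ℂ) ^ (n % 2) * spinChar γ n x

theorem normSpinChar_odd (γ : Γ → ℂ) (n : ℕ) {x : SpinWreath Γ n}
    (hx : SpinWreath.parity n x = -1) : normSpinChar γ n x = 0 := by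
  rw [normSpinChar, spinChar, basicChar_odd hx, mul_zero, mul_zero]

variable [Finite Γ]

open Classical in
/-- The weighted bilinear form `⟨u, v⟩_ξ = |G|⁻¹ ∑ η_n(ξ)(x) u(x) v(x⁻¹)` on spin super class
functions of `G = Γⁿ ⋊ S̃_n`, the sum being over the even elements. -/
def weightedForm (ξ : Γ → ℂ) {n : ℕ} (u v : SpinWreath Γ n → ℂ) : ℂ :=
  (Nat.card (SpinWreath Γ n) : ℂ)⁻¹ *
    ∑ x ∈ Finset.univ.filter (fun x => SpinWreath.parity n x = 1), wreathChar ξ x * u x * v x⁻¹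

/-- The product map of the spin product (the twisted product of two spin wreath products) into the
larger spin wreath product. Its fibres are the pairs `{(a, b), (z a, z b)}`, and its image is the
subgroup with which the spin product is identified. -/
def blockMul {n k m : ℕ} (h : n + k = m) (p : SpinWreath Γ n × SpinWreath Γ k) : SpinWreath Γ m :=
  SpinWreath.blockHom 0 (by omega) p.1 * SpinWreath.blockHom n h.le p.2

open Classical in
/-- The outer tensor product of `u` and `f`, a function on the image of `blockMul` extended by zero
to the whole group. Its value `u a * f b` at the product of `a` and `b` does not depend on the
choice of `(a, b)` if `u` and `f` are spin; it is written as an average over all choices. -/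
def outer {n k m : ℕ} (h : n + k = m) (u : SpinWreath Γ n → ℂ) (f : SpinWreath Γ k → ℂ)
    (x : SpinWreath Γ m) : ℂ :=
  ((Finset.univ.filter fun p => blockMul h p = x).card : ℂ)⁻¹ *
    ∑ p ∈ Finset.univ.filter (fun p => blockMul h p = x), u p.1 * f p.2

/-- Induction of the outer tensor product from the subgroup `H = range blockMul` to the whole
group, `x ↦ |H|⁻¹ ∑ φ(y⁻¹ x y)`. -/
def inducedProd {n k m : ℕ} (h : n + k = m) (u : SpinWreath Γ n → ℂ) (f : SpinWreath Γ k → ℂ)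
    (x : SpinWreath Γ m) : ℂ :=
  (Nat.card (Set.range (blockMul (Γ := Γ) h)) : ℂ)⁻¹ * ∑ y, outer h u f (y⁻¹ * x * y)

theorem outer_spin {n k m : ℕ} (h : n + k = m) (u : SpinWreath Γ n → ℂ) {f : SpinWreath Γ k → ℂ}
    (hf : ∀ x, f (SpinWreath.z k * x) = -f x) (x : SpinWreath Γ m) :
    outer h u f (SpinWreath.z m * x) = -outer h u f x := by
  classical
  let e : SpinWreath Γ n × SpinWreath Γ k ≃ SpinWreath Γ n × SpinWreath Γ k :=
    (Equiv.refl _).prodCongr (Equiv.mulLeft (SpinWreath.z k))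
  have he : ∀ p, blockMul h (e p) = SpinWreath.z m * blockMul h p := by
    intro p
    simp only [blockMul, e, Equiv.prodCongr_apply, Prod.map, Equiv.refl_apply,
      Equiv.coe_mulLeft, map_mul, SpinWreath.blockHom_z]
    rw [← mul_assoc, ← SpinWreath.z_comm, mul_assoc]
  have hs : (Finset.univ.filter fun p => blockMul h p = SpinWreath.z m * x) =
      (Finset.univ.filter fun p => blockMul h p = x).map e.toEmbedding := by
    ext p
    simp only [Finset.mem_filter, Finset.mem_univ, true_and, Finset.mem_map_equiv]
    rw [← e.apply_symm_apply p, he, e.symm_apply_apply, mul_right_inj]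
  rw [outer, outer, hs, Finset.card_map, Finset.sum_map, ← mul_neg, ← Finset.sum_neg_distrib]
  congr 1
  refine Finset.sum_congr rfl fun p _ => ?_
  simp [e, hf]

theorem outer_odd {n k m : ℕ} (h : n + k = m) {u : SpinWreath Γ n → ℂ} {f : SpinWreath Γ k → ℂ}
    (hu : ∀ x, SpinWreath.parity n x = -1 → u x = 0)
    (hf : ∀ x, SpinWreath.parity k x = -1 → f x = 0) {x : SpinWreath Γ m}
    (hx : SpinWreath.parity m x = -1) : outer h u f x = 0 := by
  classical
  rw [outer, Finset.sum_eq_zero, mul_zero]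
  intro p hp
  rw [Finset.mem_filter] at hp
  rw [← hp.2, blockMul, map_mul, SpinWreath.parity_blockHom, SpinWreath.parity_blockHom] at hx
  rcases Int.units_eq_one_or (SpinWreath.parity n p.1) with h1 | h1
  · rw [hf _ (by rwa [h1, one_mul] at hx), mul_zero]
  · rw [hu _ h1, zero_mul]

theorem inducedProd_mem {n k m : ℕ} (h : n + k = m) {u : SpinWreath Γ n → ℂ}
    {f : SpinWreath Γ k → ℂ} (hu : ∀ x, SpinWreath.parity n x = -1 → u x = 0)
    (hf : f ∈ superClass Γ k) : inducedProd h u f ∈ superClass Γ m := by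
  refine ⟨fun x g => ?_, fun x => ?_, fun x hx => ?_⟩
  · unfold inducedProd
    congr 1
    rw [← Equiv.sum_comp (Equiv.mulLeft g)]
    refine Finset.sum_congr rfl fun y _ => ?_
    congr 1
    simp [mul_assoc]
  · unfold inducedProd
    rw [← mul_neg, ← Finset.sum_neg_distrib]
    congr 1
    refine Finset.sum_congr rfl fun y _ => ?_
    rw [← outer_spin h u hf.2.1, ← mul_assoc, ← SpinWreath.z_comm, mul_assoc, mul_assoc, mul_assoc]
  · unfold inducedProd
    rw [Finset.sum_eq_zero, mul_zero]
    intro y _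
    refine outer_odd h hu hf.2.2 ?_
    rw [map_mul, map_mul, map_inv, hx, mul_comm, ← mul_assoc, mul_inv_cancel, one_mul]

/-- The map `f ↦ Ind (2^{n̄ / 2} χ_n(γ) ⊗ f)`. -/
def creationMap (γ : Γ → ℂ) {n k m : ℕ} (h : n + k = m) : superClass Γ k →ₗ[ℂ] superClass Γ m where
  toFun f := ⟨inducedProd h (normSpinChar γ n) f,
    inducedProd_mem h (fun _ hx => normSpinChar_odd γ n hx) f.2⟩
  map_add' f g := by
    ext x
    simp only [inducedProd, outer, Submodule.coe_add, Pi.add_apply, mul_add, Finset.sum_add_distrib]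
  map_smul' c f := by
    ext x
    simp only [inducedProd, outer, Submodule.coe_smul, Pi.smul_apply, smul_eq_mul, Finset.mul_sum,
      RingHom.id_apply]
    refine Finset.sum_congr rfl fun y _ => Finset.sum_congr rfl fun p _ => ?_
    ring

theorem contract_mem (ξ γ : Γ → ℂ) {n k m : ℕ} (h : n + k = m) {f : SpinWreath Γ m → ℂ}
    (hf : f ∈ superClass Γ m) :
    (fun y => weightedForm ξ (normSpinChar γ n) fun x => f (blockMul h (x, y))) ∈
      superClass Γ k := by
  refine ⟨fun y g => ?_, fun y => ?_, fun y hy => ?_⟩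
  · simp only [weightedForm]
    congr 1
    refine Finset.sum_congr rfl fun x hx => ?_
    congr 1
    rw [Finset.mem_filter] at hx
    have hc : ∀ g : SpinWreath Γ k, SpinWreath.blockHom 0 (by omega) x⁻¹ *
        SpinWreath.blockHom n h.le g = SpinWreath.blockHom n h.le g *
          SpinWreath.blockHom 0 (by omega) x⁻¹ :=
      fun g => SpinWreath.blockHom_comm _ _ (by omega) _ (by rw [map_inv, hx.2, inv_one]) g
    rw [← hf.1 (blockMul h (x⁻¹, y)) (SpinWreath.blockHom n h.le g)]
    simp only [blockMul, map_mul, map_inv]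
    rw [← mul_assoc, ← mul_assoc, ← map_inv (SpinWreath.blockHom 0 _) x, hc g]
    simp only [mul_assoc]
  · simp only [weightedForm]
    rw [← mul_neg, ← Finset.sum_neg_distrib]
    congr 1
    refine Finset.sum_congr rfl fun x _ => ?_
    rw [← mul_neg, ← hf.2.1]
    simp only [blockMul, map_mul, SpinWreath.blockHom_z]
    rw [← mul_assoc, ← SpinWreath.z_comm, mul_assoc (SpinWreath.z m)]
  · simp only [weightedForm]
    rw [Finset.sum_eq_zero, mul_zero]
    intro x hx
    rw [Finset.mem_filter] at hx
    rw [hf.2.2, mul_zero]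
    rw [blockMul, map_mul, SpinWreath.parity_blockHom, SpinWreath.parity_blockHom, map_inv, hx.2,
      inv_one, one_mul, hy]

/-- The map sending `f` to the pairing of `2^{n̄ / 2} χ_n(γ)` with the first tensor factor of the
restriction of `f`. -/
def annihilationMap (ξ γ : Γ → ℂ) {n k m : ℕ} (h : n + k = m) :
    superClass Γ m →ₗ[ℂ] superClass Γ k where
  toFun f := ⟨fun y => weightedForm ξ (normSpinChar γ n) fun x => (f : SpinWreath Γ m → ℂ) (blockMul h (x, y)),
    contract_mem ξ γ h f.2⟩
  map_add' f g := by
    ext y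
    simp only [weightedForm, Submodule.coe_add, Pi.add_apply, mul_add, Finset.sum_add_distrib]
  map_smul' c f := by
    ext y
    simp only [weightedForm, Submodule.coe_smul, Pi.smul_apply, smul_eq_mul, Finset.mul_sum,
      RingHom.id_apply]
    refine Finset.sum_congr rfl fun x _ => ?_
    ring

variable (Γ) in
/-- The space `⊕ₙ R⁻(Γ̃ₙ)` of all spin super class functions. -/
abbrev SpinSpace : Type _ := ⨁ n, superClass Γ n

/-- The operator `H_{-n}(γ)`. -/
def creation (γ : Γ → ℂ) (n : ℕ) : SpinSpace Γ →ₗ[ℂ] SpinSpace Γ :=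
  DirectSum.toModule ℂ ℕ _ fun k =>
    DirectSum.lof ℂ ℕ (fun n => superClass Γ n) (n + k) ∘ₗ creationMap γ rfl

/-- The operator `H_n(γ)`; it vanishes on the components of degree less than `n`. -/
def annihilation (ξ γ : Γ → ℂ) (n : ℕ) : SpinSpace Γ →ₗ[ℂ] SpinSpace Γ :=
  DirectSum.toModule ℂ ℕ _ fun m =>
    if h : n ≤ m then
      DirectSum.lof ℂ ℕ (fun n => superClass Γ n) (m - n) ∘ₗ
        annihilationMap ξ γ (Nat.add_sub_cancel' h)
    else 0

end Wreath

/-! ### Class functions and virtual characters of the finite group -/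

section Lattice

variable (Γ : Type*) [Group Γ]

/-- The space `R(Γ)` of complex class functions. -/
def classFun : Submodule ℂ (Γ → ℂ) where
  carrier := {f | ∀ x y, f (y * x * y⁻¹) = f x}
  zero_mem' := by simp
  add_mem' := fun hf hg x y => by simp [hf x y, hg x y]
  smul_mem' := fun c f hf x y => by simp [hf x y]

/-- The lattice `R_ℤ(Γ)` of virtual characters, spanned over `ℤ` by the irreducible characters. -/
def virtualChar : AddSubgroup (Γ → ℂ) :=
  AddSubgroup.closure {f | ∃ (d : ℕ) (ρ : Representation ℂ Γ (Fin d → ℂ)),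
    ρ.IsIrreducible ∧ f = ρ.character}

variable {Γ} [Fintype Γ]

/-- The weighted bilinear form `⟨f, g⟩_ξ = |Γ|⁻¹ ∑ ξ(x) f(x) g(x⁻¹)`. -/
def form (ξ f g : Γ → ℂ) : ℂ := (Nat.card Γ : ℂ)⁻¹ * ∑ x, ξ x * f x * g x⁻¹

/-- The weighted form of virtual characters with virtual weight is integral. -/
theorem form_integral (ξ α β : virtualChar Γ) : ∃ k : ℤ, form (ξ : Γ → ℂ) α β = k := by
  let Z : AddSubgroup ℂ := (Int.castAddHom ℂ).range
  suffices h : ∀ ξ ∈ virtualChar Γ, ∀ α ∈ virtualChar Γ, ∀ β ∈ virtualChar Γ, form ξ α β ∈ Z by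
    obtain ⟨k, hk⟩ := h ξ ξ.2 α α.2 β β.2
    exact ⟨k, hk.symm⟩
  intro ξ hξ
  induction hξ using AddSubgroup.closure_induction with
  | zero => intro α _ β _; simp [form, Z.zero_mem]
  | add f g _ _ hf hg =>
    intro α hα β hβ
    have : form (f + g) α β = form f α β + form g α β := by
      simp [form, add_mul, mul_add, Finset.sum_add_distrib]
    rw [this]; exact Z.add_mem (hf α hα β hβ) (hg α hα β hβ)
  | neg f _ hf =>
    intro α hα β hβ
    have : form (-f) α β = -form f α β := by simp [form]
    rw [this]; exact Z.neg_mem (hf α hα β hβ)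
  | mem ξ hξ =>
  intro α hα
  induction hα using AddSubgroup.closure_induction with
  | zero => intro β _; simp [form, Z.zero_mem]
  | add f g _ _ hf hg =>
    intro β hβ
    have : form ξ (f + g) β = form ξ f β + form ξ g β := by
      simp [form, add_mul, mul_add, Finset.sum_add_distrib]
    rw [this]; exact Z.add_mem (hf β hβ) (hg β hβ)
  | neg f _ hf =>
    intro β hβ
    have : form ξ (-f) β = -form ξ f β := by simp [form]
    rw [this]; exact Z.neg_mem (hf β hβ)
  | mem α hα =>
  intro β hβ
  induction hβ using AddSubgroup.closure_induction with
  | zero => simp [form, Z.zero_mem]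
  | add f g _ _ hf hg =>
    have : form ξ α (f + g) = form ξ α f + form ξ α g := by
      simp [form, mul_add, Finset.sum_add_distrib]
    rw [this]; exact Z.add_mem hf hg
  | neg f _ hf =>
    have : form ξ α (-f) = -form ξ α f := by simp [form]
    rw [this]; exact Z.neg_mem hf
  | mem β hβ =>
  obtain ⟨d₁, ρ₁, -, rfl⟩ := hξ
  obtain ⟨d₂, ρ₂, -, rfl⟩ := hα
  obtain ⟨d₃, ρ₃, -, rfl⟩ := hβ
  have hne : (Nat.card Γ : ℂ) ≠ 0 := by exact_mod_cast Nat.card_pos.ne'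
  have : Invertible (Nat.card Γ : ℂ) := invertibleOfNonzero hne
  have h := Representation.card_inv_mul_sum_char_mul_char_eq_finrank ρ₃ (ρ₁.tprod ρ₂)
  rw [Representation.char_tensor] at h
  refine ⟨Module.finrank ℂ (Representation.IntertwiningMap ρ₃ (ρ₁.tprod ρ₂)), ?_⟩
  simpa [form] using h.symm

/-- The integer `⟨α, β⟩_ξ`. -/
def latticeForm (ξ α β : virtualChar Γ) : ℤ := (form_integral ξ α β).choose

theorem latticeForm_spec (ξ α β : virtualChar Γ) :
    form (ξ : Γ → ℂ) α β = (latticeForm ξ α β : ℂ) := (form_integral ξ α β).choose_spec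

/-- The alternating form `c₁(α, β) = ⟨α, β⟩_ξ + ⟨α, α⟩_ξ ⟨β, β⟩_ξ` modulo `2`. -/
def altForm (ξ α β : virtualChar Γ) : ZMod 2 :=
  ((latticeForm ξ α β + latticeForm ξ α α * latticeForm ξ β β : ℤ) : ZMod 2)

/-- An extension of `R_ℤ(Γ) / 2 R_ℤ(Γ)` by `{±1}` that is central and has commutator map `c₁`. -/
structure IsSpinExtension (ξ : virtualChar Γ) {E : Type*} [Group E]
    (S : GroupExtension ℤˣ E (Multiplicative (ModN (virtualChar Γ) 2))) : Prop where
  central : ∀ u, S.inl u ∈ Subgroup.center E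
  commutator : ∀ (a b : E) (α β : virtualChar Γ),
    S.rightHom a = Multiplicative.ofAdd (ModN.mkQ 2 α) →
    S.rightHom b = Multiplicative.ofAdd (ModN.mkQ 2 β) →
    a * b * a⁻¹ * b⁻¹ = S.inl ((-1) ^ (altForm ξ α β).val)

/-- An irreducible module structure `ρ` on the group algebra `ℂ[R_ℤ(Γ) / Φ]`, with basis `e^{[β]}`,
over an extension as above, such that `-1` acts as `-1` and `e_ᾱ e^{[β]} = ε(α, β) e^{[α + β]}` with
signs `ε(α, β)`. Here `e_ᾱ` is the one of the two lifts of `ᾱ` for which `e_ᾱ e^{[0]} = e^{[α]}`. -/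
structure IsTwistedModule (Φ : AddSubgroup (virtualChar Γ)) {E : Type*} [Group E]
    (S : GroupExtension ℤˣ E (Multiplicative (ModN (virtualChar Γ) 2)))
    (e : ModN (virtualChar Γ) 2 → E)
    (ρ : Representation ℂ E (AddMonoidAlgebra ℂ (virtualChar Γ ⧸ Φ)))
    (ε : virtualChar Γ → virtualChar Γ → ℤˣ) : Prop where
  irreducible : ρ.IsIrreducible
  neg_one : ρ (S.inl (-1)) = -1
  lift : ∀ a, S.rightHom (e a) = Multiplicative.ofAdd a
  action : ∀ α β : virtualChar Γ,
    ρ (e (ModN.mkQ 2 α)) (AddMonoidAlgebra.single (β : virtualChar Γ ⧸ Φ) 1) =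
      ((ε α β : ℤ) : ℂ) • AddMonoidAlgebra.single ((α + β : virtualChar Γ) : virtualChar Γ ⧸ Φ) 1
  normalized : ∀ α, ε α 0 = 1

/-! ### Twisted vertex operators -/

/-- The coefficient of `z^{-p}` in `H_+(γ, z) H_-(γ, -z)`, where `H_+(γ, z) = ∑_{k ≥ 0} H_{-k}(γ) z^k`
and `H_-(γ, z) = ∑_{l ≥ 0} H_l(γ) z^{-l}`. On the component of degree `m` only the terms with
`l ≤ m` are non-zero. -/
def vertexPart (ξ γ : Γ → ℂ) (p : ℤ) : SpinSpace Γ →ₗ[ℂ] SpinSpace Γ :=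
  DirectSum.toModule ℂ ℕ _ fun m =>
    ∑ l ∈ Finset.range (m + 1),
      if p ≤ l then
        (-1 : ℂ) ^ l • (creation γ (l - p).toNat ∘ₗ annihilation ξ γ l ∘ₗ
          DirectSum.lof ℂ ℕ (fun n => superClass Γ n) m)
      else 0

/-- The coefficient of `z^{-p} w^{-q}` in `H_+(α, z) H_+(β, w) H_-(α, -z) H_-(β, -w)`. On the
component of degree `m` only the terms with `l ≤ m` and `l' ≤ m` are non-zero. -/
def normalPart (ξ α β : Γ → ℂ) (p q : ℤ) : SpinSpace Γ →ₗ[ℂ] SpinSpace Γ :=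
  DirectSum.toModule ℂ ℕ _ fun m =>
    ∑ l ∈ Finset.range (m + 1), ∑ l' ∈ Finset.range (m + 1),
      if p ≤ l ∧ q ≤ l' then
        (-1 : ℂ) ^ (l + l') • (creation α (l - p).toNat ∘ₗ creation β (l' - q).toNat ∘ₗ
          annihilation ξ α l ∘ₗ annihilation ξ β l' ∘ₗ
          DirectSum.lof ℂ ℕ (fun n => superClass Γ n) m)
      else 0

/-- The operator `X_p(γ)`, the coefficient of `z^{-p}` in the twisted vertex operator
`X(γ, z) = H_+(γ, z) H_-(γ, -z) e_γ̄` on `R⁻_Γ ⊗ ℂ[R_ℤ(Γ) / Φ]`. -/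
def vertexOp (ξ : virtualChar Γ) {Φ : AddSubgroup (virtualChar Γ)} {E : Type*} [Group E]
    (e : ModN (virtualChar Γ) 2 → E)
    (ρ : Representation ℂ E (AddMonoidAlgebra ℂ (virtualChar Γ ⧸ Φ)))
    (γ : virtualChar Γ) (p : ℤ) :
    SpinSpace Γ ⊗[ℂ] AddMonoidAlgebra ℂ (virtualChar Γ ⧸ Φ) →ₗ[ℂ]
      SpinSpace Γ ⊗[ℂ] AddMonoidAlgebra ℂ (virtualChar Γ ⧸ Φ) :=
  TensorProduct.map (vertexPart ξ γ p) (ρ (e (ModN.mkQ 2 γ)))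

/-- The coefficient of `z^{-p} w^{-q}` in the normal ordered product `:X(α, z) X(β, w):`. -/
def normalOp (ξ : virtualChar Γ) {Φ : AddSubgroup (virtualChar Γ)} {E : Type*} [Group E]
    (e : ModN (virtualChar Γ) 2 → E)
    (ρ : Representation ℂ E (AddMonoidAlgebra ℂ (virtualChar Γ ⧸ Φ)))
    (α β : virtualChar Γ) (p q : ℤ) :
    SpinSpace Γ ⊗[ℂ] AddMonoidAlgebra ℂ (virtualChar Γ ⧸ Φ) →ₗ[ℂ]
      SpinSpace Γ ⊗[ℂ] AddMonoidAlgebra ℂ (virtualChar Γ ⧸ Φ) :=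
  TensorProduct.map (normalPart ξ α β p q) (ρ (e (ModN.mkQ 2 α + ModN.mkQ 2 β)))

/-- The expansion of `((z - w) / (z + w))^a = (1 - u)^a (1 + u)^{-a}` in powers of `u = w / z`. -/
def expansion (a : ℂ) : PowerSeries ℂ :=
  PowerSeries.rescale (-1 : ℂ) (PowerSeries.binomialSeries ℂ a) * PowerSeries.binomialSeries ℂ (-a)

end Lattice

end

end TwistedVertex

open TwistedVertex

/-! Write $a=\langle\alpha,\beta\rangle_\xi$ and $((1-u)/(1+u))^a=\sum_j c_ju^j$. Part (i) amounts
to moving $H_-(\alpha,-z)$ past $H_+(\beta,w)$, that is, to the relation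
$H_n(\alpha)H_{-k}(\beta)=\sum_j(-1)^jc_j\,H_{-(k-j)}(\beta)H_{n-j}(\alpha)$ of
`annihilation_creation`. The signs $(-1)^n$ in $H_-(\alpha,-z)$ absorb $(-1)^j$, and comparing
coefficients gives `vertexPart_vertexPart`.

To prove the relation, double covers and subgroups are removed first. The kernel of $\widetilde
S_n\to S_n$ is $\{1,z\}$ with $z\ne1$, so a permutation of odd order has exactly one lift of odd
order. If the underlying permutation has an even cycle, an even element is conjugate to a product
$ab$ of two odd elements of disjoint blocks; then $ab=z\,ba$, and a spin class function vanishes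
there. Hence a spin super class function is the same as a function on permutations labelled by
$\Gamma$ (`desc`), invariant under relabelling and gauge transformations, and it extends to
permutations of all finite sets (`spread`). In this language induction is a sum over decompositions
into two invariant subsets (`desc_inducedProd`), and restriction followed by pairing is a
contraction (`desc_annihilationMap`).

The normalized characters $2^{\bar n/2}\chi_n(\gamma)$ are multiplicative under disjoint union
(`multiplicative_spinFun`). For the basic spin character this holds because the normalized trace of
a word in the generators obeys a Pfaffian recursion, and generators from different blocks
anticommute. So, when a product is contracted over a set $Z$, the sum splits according to the subset
$S\subset Z$ that falls into the $\beta$-factor (`contr_conv`): $S$ contributes only a number, the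
pairing of the characters of degree $|S|$ belonging to $\xi\alpha$ and $\beta$, and the rest is
again a product with a contraction.

That number remains. The square of the normalized basic spin character at an odd order lift is
$2^{\ell}$, with $\ell$ the number of cycles; on all permutations, $2^\ell$ or $0$ equals
$\sum_S\mathrm{sgn}(\sigma|_S)$ over invariant subsets, since a cycle of length $r$ contributes
$1+(-1)^{r-1}$ (`normTrace_sq`). The pairing therefore becomes a convolution of signed and unsigned
cycle sums. Inserting one point at a time shows that these are $\binom aj$ and $(-1)^j\binom{-a}j$
times $j!\,|\Gamma|^j$ (`Wr.zsum_eq`), and the convolution is a coefficient of $(1+u)^a(1-u)^{-a}$,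
namely $(-1)^jc_j$.

For part (ii), $e_{\bar\alpha}e_{\bar\beta}$ and $e_{\bar\alpha+\bar\beta}$ lie over the same
element and differ by a sign, which is read off at $e^{[0]}$ (`twisted_mul`); this factor is
tensored with part (i). -/

namespace TwistedVertex
noncomputable section
-- The spin group as a double cover of the symmetric group
namespace SpinSym

/-- A group generated by `N` elements satisfying the Coxeter relations of type `A` has at most
`(N + 1)!` elements. -/
theorem card_le_of_coxeter {Q : Type*} [Group Q] (N : ℕ) (s : ℕ → Q)
    (hsq : ∀ i < N, s i * s i = 1)
    (hbr : ∀ i, i + 1 < N → s (i + 1) * s i * s (i + 1) = s i * s (i + 1) * s i)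
    (hfar : ∀ i < N, ∀ j, j + 1 < i → s j * s i = s i * s j)
    (hgen : ∀ H : Subgroup Q, (∀ i < N, s i ∈ H) → H = ⊤) :
    Finite Q ∧ Nat.card Q ≤ (N + 1).factorial := by
  classical
  -- `w k l` is the descending word $s_ks_{k-1}\cdots s_{k-l+1}$. Allowing $0\le l\le k+1$ as a
  -- right factor enlarges a set closed under $s_0,\dots,s_{k-1}$ to one closed under $s_k$ as well,
  -- at the cost of a factor $k+2$.
  obtain ⟨w, w0, w1⟩ : ∃ w : ℕ → ℕ → Q, (∀ k, w k 0 = 1) ∧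
      ∀ k l, w k (l + 1) = w k l * s (k - l) :=
    ⟨fun k l => Nat.rec 1 (fun l x => x * s (k - l)) l, fun _ => rfl, fun _ _ => rfl⟩
  have slide1 : ∀ k < N, ∀ l i, i + l < k → w k l * s i = s i * w k l := by
    intro k hk l
    induction l with
    | zero => intro i _; simp [w0]
    | succ l ih =>
      intro i hi
      rw [w1, mul_assoc, ← hfar (k - l) (by omega) i (by omega), ← mul_assoc, ih i (by omega),
        mul_assoc]
  have slide2 : ∀ k < N, ∀ l, l + 1 ≤ k → ∀ i, k - l ≤ i → i ≤ k →
      w k (l + 2) * s i = s (i - 1) * w k (l + 2) := by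
    intro k hk l
    induction l with
    | zero =>
      intro hl i h1 h2
      obtain rfl : i = k := by omega
      obtain ⟨i, rfl⟩ : ∃ j, i = j + 1 := ⟨i - 1, by omega⟩
      simp only [w1, w0, one_mul, Nat.sub_zero, zero_add, Nat.add_sub_cancel]
      rw [hbr i hk, mul_assoc]
    | succ l ih =>
      intro hl i h1 h2
      rcases Nat.eq_or_lt_of_le h1 with h | h
      · obtain ⟨j, rfl⟩ : ∃ j, i = j + 1 := ⟨i - 1, by omega⟩
        have e1 : k - (l + 1) = j + 1 := h
        have e2 : k - (l + 1 + 1) = j := by omega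
        rw [show l + 1 + 2 = (l + 1) + 1 + 1 from rfl, w1, w1, e1, e2, Nat.add_sub_cancel]
        rw [mul_assoc, mul_assoc, ← mul_assoc (s (j + 1)), hbr j (by omega), ← mul_assoc,
          ← mul_assoc, slide1 k hk (l + 1) j (by omega), mul_assoc, mul_assoc, mul_assoc]
      · rw [show l + 1 + 2 = (l + 2) + 1 from rfl, w1, mul_assoc,
          hfar i (by omega) (k - (l + 2)) (by omega), ← mul_assoc,
          ih (by omega) i (by omega) h2, mul_assoc]
  have key : ∀ k ≤ N, ∃ F : Finset Q, F.card ≤ (k + 1).factorial ∧ 1 ∈ F ∧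
      ∀ i < k, ∀ x ∈ F, x * s i ∈ F := by
    intro k
    induction k with
    | zero => exact fun _ => ⟨{1}, by simp, by simp, fun i hi => by omega⟩
    | succ k ih =>
      intro hk
      obtain ⟨F, hF, h1, hm⟩ := ih (by omega)
      refine ⟨Finset.image₂ (fun u l => u * w k l) F (Finset.range (k + 2)), ?_,
        Finset.mem_image₂.2 ⟨1, h1, 0, by simp, by simp [w0]⟩, ?_⟩
      · refine (Finset.card_image₂_le _ _ _).trans ?_
        rw [Finset.card_range, Nat.factorial_succ (k + 1), mul_comm]
        exact Nat.mul_le_mul_left _ hF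
      intro i hi x hx
      obtain ⟨u, hu, l, hl, rfl⟩ := Finset.mem_image₂.1 hx
      rw [Finset.mem_image₂]
      simp only [Finset.mem_range] at hl ⊢
      -- Multiplying $w_{k,l}$ by $s_i$ on the right: $s_i$ slides through unchanged if $i<k-l$,
      -- lengthens the word if $i=k-l$, cancels its last letter if $i=k-l+1$, and otherwise slides
      -- through as $s_{i-1}$ by the braid relation.
      rcases lt_trichotomy (i + l) k with h | h | h
      · exact ⟨u * s i, hm i (by omega) u hu, l, hl, by
          simp only [mul_assoc, slide1 k (by omega) l i h]⟩
      · refine ⟨u, hu, l + 1, by omega, ?_⟩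
        simp only [w1, mul_assoc]
        rw [show k - l = i by omega]
      · rcases Nat.eq_or_lt_of_le (Nat.succ_le_of_lt h) with h' | h'
        · obtain ⟨m, rfl⟩ : ∃ m, l = m + 1 := ⟨l - 1, by omega⟩
          refine ⟨u, hu, m, by omega, ?_⟩
          simp only [w1, mul_assoc]
          rw [show k - m = i by omega, hsq i (by omega), mul_one]
        · obtain ⟨m, rfl⟩ : ∃ m, l = m + 2 := ⟨l - 2, by omega⟩
          refine ⟨u * s (i - 1), hm _ (by omega) u hu, m + 2, hl, ?_⟩
          simp only [mul_assoc]
          rw [slide2 k (by omega) m (by omega) i (by omega) (by omega)]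
  obtain ⟨F, hF, h1, hm⟩ := key N le_rfl
  have hall : ∀ x : Q, x ∈ F := by
    intro x
    have hx : x ∈ Subgroup.closure (s '' Set.Iio N) := by
      rw [hgen (Subgroup.closure (s '' Set.Iio N))
        fun i hi => Subgroup.subset_closure (Set.mem_image_of_mem s hi)]
      trivial
    induction hx using Subgroup.closure_induction_right with
    | one => exact h1
    | mul_right x _ y hy ih => obtain ⟨i, hi, rfl⟩ := hy; exact hm i hi _ ih
    | mul_inv_cancel x _ y hy ih =>
      obtain ⟨i, hi, rfl⟩ := hy
      rw [inv_eq_of_mul_eq_one_left (hsq i hi)]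
      exact hm i hi _ ih
  let _ : Fintype Q := ⟨F, hall⟩
  refine ⟨inferInstance, ?_⟩
  rw [Nat.card_eq_fintype_card]
  exact hF

theorem toPerm_surjective (n : ℕ) : Function.Surjective (toPerm n) := by
  rw [← MonoidHom.range_eq_top, eq_top_iff]
  intro s _
  cases n with
  | zero => rw [Subsingleton.elim s 1]; exact one_mem _
  | succ n =>
    have hs : s ∈ Submonoid.closure
        (Set.range fun i : Fin n => Equiv.swap i.castSucc i.succ) := by
      rw [Equiv.Perm.mclosure_swap_castSucc_succ]; trivial
    induction hs using Submonoid.closure_induction with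
    | mem x hx => obtain ⟨i, rfl⟩ := hx; exact ⟨t ⟨i, by simp⟩, by rw [toPerm_t]; rfl⟩
    | one => exact one_mem _
    | mul x y _ _ hx hy => exact mul_mem (hx trivial) (hy trivial)

theorem z_zpowers {n : ℕ} {x : SpinSym n} (hx : x ∈ Subgroup.zpowers (z n)) : x = 1 ∨ x = z n := by
  obtain ⟨k, rfl⟩ := Subgroup.mem_zpowers_iff.1 hx
  have h2 : (z n) ^ (2 : ℤ) = 1 := by rw [zpow_ofNat]; exact (relations n).z_sq
  rcases Int.even_or_odd' k with ⟨m, rfl | rfl⟩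
  · left; rw [zpow_mul, h2, one_zpow]
  · right; rw [zpow_add, zpow_mul, h2, one_zpow, one_mul, zpow_one]

/-- The kernel of the projection onto the symmetric group is `{1, z}`. -/
theorem toPerm_eq_one {n : ℕ} {x : SpinSym n} (hx : toPerm n x = 1) : x = 1 ∨ x = z n := by
  have hnorm : (Subgroup.zpowers (z n)).Normal := by
    refine ⟨fun x hx g => ?_⟩
    obtain ⟨k, rfl⟩ := Subgroup.mem_zpowers_iff.1 hx
    have : Commute g (z n ^ k) := (show Commute g (z n) from (z_comm g).symm).zpow_right k
    rw [this.eq, mul_inv_cancel_right]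
    exact hx
  let π := QuotientGroup.mk' (Subgroup.zpowers (z n))
  have hπz : π (z n) = 1 := (QuotientGroup.eq_one_iff _).2 (Subgroup.mem_zpowers _)
  let s : ℕ → SpinSym n ⧸ Subgroup.zpowers (z n) :=
    fun i => if h : i < n - 1 then π (t ⟨i, h⟩) else 1
  have hs : ∀ i (h : i < n - 1), s i = π (t ⟨i, h⟩) := fun i h => dif_pos h
  have hR := relations n
  have hsq : ∀ i < n - 1, s i * s i = 1 := by
    intro i hi
    rw [hs i hi, ← map_mul, ← sq, hR.t_sq, hπz]
  obtain ⟨hfin, hcard⟩ := card_le_of_coxeter (n - 1) s hsq (by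
      intro i hi
      have h1 : (s i * s (i + 1)) ^ 3 = 1 := by
        rw [hs i (by omega), hs (i + 1) hi, ← map_mul, ← map_pow, hR.braid _ _ rfl, hπz]
      have ha := inv_eq_of_mul_eq_one_left (hsq i (by omega))
      have hb := inv_eq_of_mul_eq_one_left (hsq (i + 1) hi)
      have h2 : s i * s (i + 1) * s i * (s (i + 1) * s i * s (i + 1)) = 1 := by
        rw [← h1]; simp only [pow_succ, pow_zero, one_mul, mul_assoc]
      have h3 := eq_inv_of_mul_eq_one_left h2
      rw [h3]
      simp [mul_assoc, ha, hb]) (by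
      intro i hi j hj
      rw [hs i hi, hs j (by omega), ← map_mul, ← map_mul,
        hR.far ⟨i, hi⟩ ⟨j, by omega⟩ hj, mul_assoc, map_mul π (z n), hπz,
        one_mul, map_mul]) (by
      intro H hH
      refine eq_top_iff.2 fun x _ => ?_
      obtain ⟨y, rfl⟩ := QuotientGroup.mk'_surjective _ x
      refine closure_induction (H.comap π) ?_ ?_ y
      · rw [Subgroup.mem_comap, hπz]; exact H.one_mem
      · intro i
        rw [Subgroup.mem_comap, ← hs i i.2]; exact hH i i.2)
  let φ : SpinSym n ⧸ Subgroup.zpowers (z n) →* Equiv.Perm (Fin n) :=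
    QuotientGroup.lift _ (toPerm n) (by
      intro y hy
      rcases z_zpowers hy with rfl | rfl
      · exact map_one _
      · exact toPerm_z n)
  -- The quotient by $\langle z\rangle$ maps onto $S_n$ and has at most $n!$ elements, so it is
  -- $S_n$.
  have hφ : Function.Bijective φ := by
    refine Function.Surjective.bijective_of_nat_card_le ?_ ?_
    · intro σ
      obtain ⟨y, rfl⟩ := toPerm_surjective n σ
      exact ⟨π y, rfl⟩
    · refine hcard.trans ?_
      rw [Nat.card_perm, Nat.card_fin]
      -- For $n=0$ the truncated $n-1$ is $0$, and the bound $1!$ still equals $0!$.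
      cases n <;> simp
  refine z_zpowers ((QuotientGroup.eq_one_iff x).1 (hφ.1 ?_))
  rw [map_one]
  exact hx

/-- The relations alone could collapse $z$. The basic spin representation shows that they do not: it
sends $z$ to $-1$ on a nonzero space. -/
theorem z_ne_one (n : ℕ) : z n ≠ 1 := by
  intro h
  have h1 : basicSpin n (z n) = -1 := lift_z _
  rw [h, map_one] at h1
  have h2 := congrArg (fun u => (Units.val u).trace) h1
  simp only [Units.val_one, Units.val_neg, Matrix.trace_neg, Matrix.trace_one] at h2
  have h3 : (Fintype.card (Fin (n / 2) → Fin 2) : ℂ) ≠ 0 := by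
    exact_mod_cast Fintype.card_ne_zero
  exact h3 (by linear_combination h2 / 2)

theorem eq_or_of_toPerm_eq {n : ℕ} {x y : SpinSym n} (h : toPerm n x = toPerm n y) :
    x = y ∨ x = z n * y := by
  rcases toPerm_eq_one (x := x * y⁻¹) (by rw [map_mul, map_inv, h, mul_inv_cancel]) with h | h
  · left; exact mul_inv_eq_one.1 h
  · right; exact mul_inv_eq_iff_eq_mul.1 h

end SpinSym

/-! ### Elements of odd order and their canonical lifts -/

/-- The element has finite odd order. -/
def OddOrder {G : Type*} [Monoid G] (x : G) : Prop := ∃ n, Odd n ∧ x ^ n = 1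

namespace OddOrder

theorem map {G H : Type*} [Monoid G] [Monoid H] (φ : G →* H) {x : G} (hx : OddOrder x) :
    OddOrder (φ x) := by
  obtain ⟨n, hn, h⟩ := hx
  exact ⟨n, hn, by rw [← map_pow, h, map_one]⟩

theorem mul {G : Type*} [Monoid G] {x y : G} (hx : OddOrder x) (hy : OddOrder y)
    (h : Commute x y) : OddOrder (x * y) := by
  obtain ⟨n, hn, hxn⟩ := hx
  obtain ⟨m, hm, hym⟩ := hy
  refine ⟨n * m, hn.mul hm, ?_⟩
  rw [h.mul_pow, pow_mul, hxn, one_pow, mul_comm n m, pow_mul, hym, one_pow, one_mul]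

theorem inv {G : Type*} [Group G] {x : G} (hx : OddOrder x) : OddOrder x⁻¹ := by
  obtain ⟨n, hn, h⟩ := hx
  exact ⟨n, hn, by rw [inv_pow, h, inv_one]⟩

theorem conj {G : Type*} [Group G] {x : G} (hx : OddOrder x) (g : G) : OddOrder (g * x * g⁻¹) :=
  hx.map (MulAut.conj g).toMonoidHom

theorem eq_one {x : ℤˣ} (hx : OddOrder x) : x = 1 := by
  obtain ⟨n, hn, h⟩ := hx
  rcases Int.units_eq_one_or x with rfl | rfl
  · rfl
  · rw [hn.neg_one_pow] at h
    exact absurd h (by decide)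

end OddOrder

namespace SpinSym

theorem z_pow_odd {n k : ℕ} (hk : Odd k) : z n ^ k = z n := by
  obtain ⟨m, rfl⟩ := hk
  rw [pow_succ, pow_mul, (relations n).z_sq, one_pow, one_mul]

/-- Two lifts differ at most by the central $z$. If $x=zy$ and both have odd order, a common odd
exponent gives $1=z$. -/
theorem oddOrder_unique {n : ℕ} {x y : SpinSym n} (hx : OddOrder x) (hy : OddOrder y)
    (h : toPerm n x = toPerm n y) : x = y := by
  rcases eq_or_of_toPerm_eq h with h | h
  · exact h
  · exfalso
    obtain ⟨a, ha, hxa⟩ := hx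
    obtain ⟨b, hb, hyb⟩ := hy
    have h1 : x ^ (a * b) = 1 := by rw [pow_mul, hxa, one_pow]
    rw [h, (show Commute (z n) y from z_comm y).mul_pow, z_pow_odd (ha.mul hb), mul_comm a b,
      pow_mul, hyb, one_pow, mul_one] at h1
    exact z_ne_one n h1

/-- If $\sigma^a=1$ with $a$ odd, then a lift $x$ has $x^a\in\{1,z\}$. In the second case
$(zx)^a=z\cdot z=1$. -/
theorem exists_oddOrder {n : ℕ} {σ : Equiv.Perm (Fin n)} (hσ : OddOrder σ) :
    ∃ x : SpinSym n, toPerm n x = σ ∧ OddOrder x := by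
  obtain ⟨x, rfl⟩ := toPerm_surjective n σ
  obtain ⟨a, ha, h⟩ := hσ
  rw [← map_pow] at h
  rcases toPerm_eq_one h with h | h
  · exact ⟨x, rfl, a, ha, h⟩
  · refine ⟨z n * x, by rw [map_mul, toPerm_z, one_mul], a, ha, ?_⟩
    rw [(show Commute (z n) x from z_comm x).mul_pow, z_pow_odd ha, h, z_mul_z]

open Classical in
/-- The lift of odd order of a permutation of odd order. -/
def can {n : ℕ} (σ : Equiv.Perm (Fin n)) : SpinSym n :=
  if h : OddOrder σ then (exists_oddOrder h).choose else 1

theorem toPerm_can {n : ℕ} {σ : Equiv.Perm (Fin n)} (h : OddOrder σ) : toPerm n (can σ) = σ := by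
  rw [can, dif_pos h]; exact (exists_oddOrder h).choose_spec.1

theorem oddOrder_can {n : ℕ} {σ : Equiv.Perm (Fin n)} (h : OddOrder σ) : OddOrder (can σ) := by
  rw [can, dif_pos h]; exact (exists_oddOrder h).choose_spec.2

/-- Identities between elements of odd order can thus be checked on permutations. Compatibility of
`can` with inverses, conjugation and blocks follows each time from the fact that the operation
preserves odd order. -/
theorem eq_can {n : ℕ} {x : SpinSym n} (hx : OddOrder x) : x = can (toPerm n x) :=
  oddOrder_unique hx (oddOrder_can (hx.map _)) (toPerm_can (hx.map _)).symm

theorem can_inv {n : ℕ} {σ : Equiv.Perm (Fin n)} (h : OddOrder σ) : (can σ)⁻¹ = can σ⁻¹ := by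
  rw [eq_can (oddOrder_can h).inv, map_inv, toPerm_can h]

theorem can_conj {n : ℕ} {σ : Equiv.Perm (Fin n)} (h : OddOrder σ) (y : SpinSym n) :
    y * can σ * y⁻¹ = can (toPerm n y * σ * (toPerm n y)⁻¹) := by
  rw [eq_can ((oddOrder_can h).conj y), map_mul, map_mul, map_inv, toPerm_can h]

theorem parity_can {n : ℕ} {σ : Equiv.Perm (Fin n)} (h : OddOrder σ) : parity n (can σ) = 1 :=
  ((oddOrder_can h).map (parity n)).eq_one

/-- The identification of a sum of two blocks with the whole interval. -/
def blockEquiv {n k m : ℕ} (h : n + k = m) : Fin n ⊕ Fin k ≃ Fin m :=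
  finSumFinEquiv.trans (finCongr h)

theorem blockEquiv_inl {n k m : ℕ} (h : n + k = m) (i : Fin n) :
    blockEquiv h (Sum.inl i) = block 0 (by omega) i := by
  ext; simp [blockEquiv, block_val]

theorem blockEquiv_inr {n k m : ℕ} (h : n + k = m) (i : Fin k) :
    blockEquiv h (Sum.inr i) = block n h.le i := by
  ext; simp [blockEquiv, block_val]

theorem toPerm_block_mul {n k m : ℕ} (h : n + k = m) (a : SpinSym n) (b : SpinSym k) :
    toPerm m (blockHom 0 (by omega) a * blockHom n h.le b) =
      (blockEquiv h).permCongr (Equiv.sumCongr (toPerm n a) (toPerm k b)) := by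
  rw [map_mul, toPerm_blockHom, toPerm_blockHom]
  ext1 i
  obtain ⟨j, rfl⟩ := (blockEquiv h).surjective i
  rw [Equiv.permCongr_apply, Equiv.symm_apply_apply, Equiv.Perm.mul_apply]
  cases j with
  | inl j =>
    rw [blockEquiv_inl, Equiv.Perm.viaEmbedding_apply_of_notMem (toPerm k b),
      Equiv.Perm.viaEmbedding_apply, Equiv.sumCongr_apply, Sum.map_inl, blockEquiv_inl]
    rintro ⟨i, hi⟩
    have := congrArg Fin.val hi
    simp only [block_val] at this
    omega
  | inr j =>
    rw [blockEquiv_inr, Equiv.Perm.viaEmbedding_apply, Equiv.Perm.viaEmbedding_apply_of_notMem,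
      Equiv.sumCongr_apply, Sum.map_inr, blockEquiv_inr]
    rintro ⟨i, hi⟩
    have := congrArg Fin.val hi
    simp only [block_val] at this
    omega

theorem oddOrder_sumCongr {X Y : Type*} {σ : Equiv.Perm X} {τ : Equiv.Perm Y} :
    OddOrder (Equiv.sumCongr σ τ : Equiv.Perm (X ⊕ Y)) ↔ OddOrder σ ∧ OddOrder τ := by
  have hinj := Equiv.Perm.sumCongrHom_injective (α := X) (β := Y)
  have e : (Equiv.sumCongr σ τ : Equiv.Perm (X ⊕ Y)) = Equiv.Perm.sumCongrHom X Y (σ, τ) := rfl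
  have hpow : ∀ n, (Equiv.sumCongr σ τ : Equiv.Perm (X ⊕ Y)) ^ n = 1 ↔ σ ^ n = 1 ∧ τ ^ n = 1 := by
    intro n
    rw [e, ← map_pow, ← map_one (Equiv.Perm.sumCongrHom X Y), hinj.eq_iff, Prod.pow_mk,
      Prod.mk_eq_one]
  constructor
  · rintro ⟨n, hn, h⟩
    exact ⟨⟨n, hn, ((hpow n).1 h).1⟩, ⟨n, hn, ((hpow n).1 h).2⟩⟩
  · rintro ⟨⟨n, hn, h⟩, ⟨m, hm, h'⟩⟩
    refine ⟨n * m, hn.mul hm, (hpow _).2 ⟨?_, ?_⟩⟩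
    · rw [pow_mul, h, one_pow]
    · rw [mul_comm, pow_mul, h', one_pow]

theorem oddOrder_permCongr {X Y : Type*} (e : X ≃ Y) {σ : Equiv.Perm X} :
    OddOrder (e.permCongr σ) ↔ OddOrder σ := by
  have hpow : ∀ n, (e.permCongr σ) ^ n = 1 ↔ σ ^ n = 1 := by
    intro n
    have := map_pow e.permCongrHom σ n
    rw [show e.permCongr σ = e.permCongrHom σ from rfl, ← this, map_eq_one_iff _
      e.permCongrHom.injective]
  simp only [OddOrder, hpow]

/-- Elements of odd order are even, and even elements commute with the other block. So the product
of the two lifts again has odd order, and uniqueness applies. -/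
theorem can_block {n k m : ℕ} (h : n + k = m) {σ : Equiv.Perm (Fin n)} {τ : Equiv.Perm (Fin k)}
    (hσ : OddOrder σ) (hτ : OddOrder τ) :
    blockHom 0 (by omega) (can σ) * blockHom n h.le (can τ) =
      can ((blockEquiv h).permCongr (Equiv.sumCongr σ τ)) := by
  rw [eq_can (x := blockHom 0 _ (can σ) * blockHom n h.le (can τ)), toPerm_block_mul,
    toPerm_can hσ, toPerm_can hτ]
  exact ((oddOrder_can hσ).map _).mul ((oddOrder_can hτ).map _)
    (blockHom_comm _ _ (by omega) _ (parity_can hσ) _)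

end SpinSym

/-! ### Labelled permutations -/

/-- The wreath product of `Γ` with the symmetric group on `X`, as a set. -/
abbrev Wr (Γ X : Type*) : Type _ := (X → Γ) × Equiv.Perm X

namespace Wr

variable {Γ : Type*} {X Y Z T : Type*}

/-- Transport along a bijection. -/
def map (e : X ≃ Y) (w : Wr Γ X) : Wr Γ Y := (fun i => w.1 (e.symm i), e.permCongr w.2)

theorem map_map (e : X ≃ Y) (f : Y ≃ Z) (w : Wr Γ X) : map f (map e w) = map (e.trans f) w := rfl

theorem map_refl (w : Wr Γ X) : map (Equiv.refl X) w = w := rfl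

/-- Transport as a bijection. -/
def mapEquiv (e : X ≃ Y) : Wr Γ X ≃ Wr Γ Y where
  toFun := map e
  invFun := map e.symm
  left_inv w := by rw [map_map, e.self_trans_symm, map_refl]
  right_inv w := by rw [map_map, e.symm_trans_self, map_refl]

/-- The disjoint union of two labelled permutations. -/
def sum (a : Wr Γ X) (b : Wr Γ Y) : Wr Γ (X ⊕ Y) := (Sum.elim a.1 b.1, Equiv.sumCongr a.2 b.2)

theorem map_sum (e : X ≃ Y) (f : Z ≃ T) (a : Wr Γ X) (b : Wr Γ Z) :
    sum (map e a) (map f b) = map (Equiv.sumCongr e f) (sum a b) := by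
  refine Prod.ext ?_ ?_
  · funext i; cases i <;> rfl
  · ext i; cases i <;> rfl

theorem sum_injective {a a' : Wr Γ X} {b b' : Wr Γ Y} (h : sum a b = sum a' b') :
    a = a' ∧ b = b' := by
  have h1 := congrArg Prod.fst h
  have h2 := Equiv.Perm.sumCongrHom_injective (a₁ := (a.2, b.2)) (a₂ := (a'.2, b'.2))
    (congrArg Prod.snd h)
  rw [Prod.mk.injEq] at h2
  refine ⟨Prod.ext ?_ h2.1, Prod.ext ?_ h2.2⟩
  · funext i; exact congrFun h1 (Sum.inl i)
  · funext i; exact congrFun h1 (Sum.inr i)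

variable [Group Γ]

/-- Conjugation by a tuple of elements of `Γ`. -/
def gauge (h : X → Γ) (w : Wr Γ X) : Wr Γ X := (fun i => h i * w.1 i * (h (w.2⁻¹ i))⁻¹, w.2)

/-- The inverse in the wreath product. -/
def inv (w : Wr Γ X) : Wr Γ X := (fun i => (w.1 (w.2 i))⁻¹, w.2⁻¹)

theorem inv_map (e : X ≃ Y) (w : Wr Γ X) : inv (map e w) = map e (inv w) := by
  refine Prod.ext ?_ ?_
  · funext i; simp [inv, map]
  · ext i; rfl

theorem gauge_one (w : Wr Γ X) : gauge 1 w = w := by simp [gauge]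

theorem map_gauge (e : X ≃ Y) (h : X → Γ) (w : Wr Γ X) :
    map e (gauge h w) = gauge (fun i => h (e.symm i)) (map e w) := by
  refine Prod.ext ?_ rfl
  funext i
  simp only [map, gauge, Equiv.permCongr_def, Equiv.Perm.inv_def]
  simp

end Wr

/-! ### Spin wreath products and labelled permutations -/

namespace SpinWreath
variable {Γ : Type*} [Group Γ]

/-- The underlying labelled permutation. -/
def proj {n : ℕ} (x : SpinWreath Γ n) : Wr Γ (Fin n) := (x.left, SpinSym.toPerm n x.right)

/-- The lift of odd order of a labelled permutation of odd order. -/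
def can {n : ℕ} (w : Wr Γ (Fin n)) : SpinWreath Γ n := ⟨w.1, SpinSym.can w.2⟩

theorem proj_can {n : ℕ} {w : Wr Γ (Fin n)} (h : OddOrder w.2) : proj (can w) = w :=
  Prod.ext rfl (SpinSym.toPerm_can h)

theorem proj_z_mul {n : ℕ} (x : SpinWreath Γ n) : proj (z n * x) = proj x := by
  refine Prod.ext ?_ ?_
  · simp [proj, z, SpinSym.toPerm_z]
  · simp [proj, z, SpinSym.toPerm_z]

theorem z_ne_one (n : ℕ) : (z n : SpinWreath Γ n) ≠ 1 := by
  intro h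
  exact SpinSym.z_ne_one n (congrArg SemidirectProduct.right h)

theorem z_mul_ne {n : ℕ} (x : SpinWreath Γ n) : z n * x ≠ x := by
  intro h
  exact z_ne_one n (mul_eq_right.1 h)

theorem eq_or_of_proj_eq {n : ℕ} {x y : SpinWreath Γ n} (h : proj x = proj y) :
    x = y ∨ x = z n * y := by
  have h1 : x.left = y.left := congrArg Prod.fst h
  rcases SpinSym.eq_or_of_toPerm_eq (congrArg Prod.snd h) with h2 | h2
  · left; exact SemidirectProduct.ext h1 h2
  · right
    refine SemidirectProduct.ext ?_ ?_
    · simp [z, SpinSym.toPerm_z, h1]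
    · simpa [z] using h2

theorem proj_surjective {n : ℕ} : Function.Surjective (proj (Γ := Γ) (n := n)) := by
  rintro ⟨g, σ⟩
  obtain ⟨x, rfl⟩ := SpinSym.toPerm_surjective n σ
  exact ⟨⟨g, x⟩, rfl⟩

/-- Conjugation is a relabelling of the points followed by a gauge transformation, so invariance of
a class function breaks up into these two invariances. -/
theorem proj_conj {n : ℕ} (x y : SpinWreath Γ n) :
    proj (y * x * y⁻¹) = Wr.gauge y.left (Wr.map (SpinSym.toPerm n y.right) (proj x)) := by
  refine Prod.ext ?_ ?_
  · funext i
    simp only [proj, Wr.gauge, Wr.map, SemidirectProduct.mul_left, SemidirectProduct.mul_right,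
      SemidirectProduct.inv_left, MonoidHom.comp_apply, map_mul, MulAut.mul_apply, Pi.mul_apply]
    simp [permAct, Equiv.Perm.inv_def, Equiv.Perm.mul_def]
  · simp [proj, Wr.gauge, Wr.map, Equiv.permCongr_eq_mul]

theorem can_conj {n : ℕ} {w : Wr Γ (Fin n)} (hw : OddOrder w.2) (y : SpinWreath Γ n) :
    y * can w * y⁻¹ = can (Wr.gauge y.left (Wr.map (SpinSym.toPerm n y.right) w)) := by
  refine SemidirectProduct.ext ?_ ?_
  · have := congrArg Prod.fst (proj_conj (can w) y)
    rw [proj_can hw] at this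
    exact this
  · have := SpinSym.can_conj hw y.right
    simpa [can, Wr.gauge, Wr.map, Equiv.permCongr_eq_mul] using this

theorem can_inv {n : ℕ} {w : Wr Γ (Fin n)} (hw : OddOrder w.2) : (can w)⁻¹ = can (Wr.inv w) := by
  refine SemidirectProduct.ext ?_ ?_
  · funext i
    rw [SemidirectProduct.inv_left]
    change ((can w).left (((SpinSym.toPerm n (SpinSym.can w.2)⁻¹))⁻¹ i))⁻¹ = _
    rw [map_inv, _root_.inv_inv, SpinSym.toPerm_can hw]
    rfl
  · simpa [can, Wr.inv] using SpinSym.can_inv hw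

theorem blockMul_left {n k m : ℕ} (h : n + k = m) (a : SpinWreath Γ n) (b : SpinWreath Γ k) :
    (blockMul h (a, b)).left = extendHom 0 (by omega) a.left * extendHom n h.le b.left := by
  change extendHom 0 _ a.left * permAct Γ m (SpinSym.toPerm m (SpinSym.blockHom 0 _ a.right))
        (extendHom n h.le b.left) = _
  rw [act_extendHom _ _ (Or.inl (by omega))]

theorem extend_mul_extend {n k m : ℕ} (h : n + k = m) (a : Fin n → Γ) (b : Fin k → Γ) :
    extendHom 0 (by omega : 0 + n ≤ m) a * extendHom n h.le b =
      fun i => Sum.elim a b ((SpinSym.blockEquiv h).symm i) := by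
  funext i
  obtain ⟨j, rfl⟩ := (SpinSym.blockEquiv h).surjective i
  rw [Equiv.symm_apply_apply, Pi.mul_apply]
  cases j with
  | inl j =>
    rw [SpinSym.blockEquiv_inl, extendHom_block, extendHom_of_notMem, mul_one, Sum.elim_inl]
    rintro ⟨i, hi⟩
    have := congrArg Fin.val hi
    simp only [SpinSym.block_val] at this
    omega
  | inr j =>
    rw [SpinSym.blockEquiv_inr, extendHom_block, extendHom_of_notMem, one_mul, Sum.elim_inr]
    rintro ⟨i, hi⟩
    have := congrArg Fin.val hi
    simp only [SpinSym.block_val] at this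
    omega

theorem proj_blockMul {n k m : ℕ} (h : n + k = m) (a : SpinWreath Γ n) (b : SpinWreath Γ k) :
    proj (blockMul h (a, b)) = Wr.map (SpinSym.blockEquiv h) (Wr.sum (proj a) (proj b)) := by
  refine Prod.ext ?_ ?_
  · change (blockMul h (a, b)).left = _
    rw [blockMul_left, extend_mul_extend]
    rfl
  · exact SpinSym.toPerm_block_mul h a.right b.right

theorem blockMul_can {n k m : ℕ} (h : n + k = m) {a : Wr Γ (Fin n)} {b : Wr Γ (Fin k)}
    (ha : OddOrder a.2) (hb : OddOrder b.2) :
    blockMul h (can a, can b) = can (Wr.map (SpinSym.blockEquiv h) (Wr.sum a b)) := by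
  refine SemidirectProduct.ext ?_ ?_
  · rw [blockMul_left, extend_mul_extend]
    rfl
  · exact SpinSym.can_block h ha hb

theorem blockMul_z_left {n k m : ℕ} (h : n + k = m) (a : SpinWreath Γ n) (b : SpinWreath Γ k) :
    blockMul h (z n * a, b) = z m * blockMul h (a, b) := by
  simp only [blockMul, map_mul, blockHom_z, mul_assoc]

theorem blockMul_z_right {n k m : ℕ} (h : n + k = m) (a : SpinWreath Γ n) (b : SpinWreath Γ k) :
    blockMul h (a, z k * b) = z m * blockMul h (a, b) := by
  simp only [blockMul, map_mul, blockHom_z]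
  rw [← mul_assoc, ← z_comm, mul_assoc]

/-- The fibres of the product map. -/
theorem blockMul_eq_iff {n k m : ℕ} (h : n + k = m) (a a' : SpinWreath Γ n)
    (b b' : SpinWreath Γ k) :
    blockMul h (a', b') = blockMul h (a, b) ↔
      (a' = a ∧ b' = b) ∨ (a' = z n * a ∧ b' = z k * b) := by
  constructor
  · intro hab
    have h1 := congrArg proj hab
    rw [proj_blockMul, proj_blockMul] at h1
    obtain ⟨ha, hb⟩ := Wr.sum_injective ((Wr.mapEquiv (SpinSym.blockEquiv h)).injective h1)
    rcases eq_or_of_proj_eq ha with rfl | rfl <;> rcases eq_or_of_proj_eq hb with rfl | rfl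
    · exact Or.inl ⟨rfl, rfl⟩
    · rw [blockMul_z_right] at hab
      exact absurd hab (z_mul_ne _)
    · rw [blockMul_z_left] at hab
      exact absurd hab (z_mul_ne _)
    · exact Or.inr ⟨rfl, rfl⟩
  · rintro (⟨rfl, rfl⟩ | ⟨rfl, rfl⟩)
    · rfl
    · rw [blockMul_z_left, blockMul_z_right, ← mul_assoc, z_mul_z, one_mul]

end SpinWreath

namespace Wr

variable {Γ : Type*} {X Y Z T : Type*}

/-! ### Restriction to invariant subsets -/

/-- The subset `p` is invariant under the underlying permutation. -/
def Pres (p : X → Prop) (w : Wr Γ X) : Prop := ∀ x, p (w.2 x) ↔ p x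

theorem pres_not {p : X → Prop} {w : Wr Γ X} : Pres (fun x => ¬p x) w ↔ Pres p w :=
  forall_congr' fun _ => not_iff_not

theorem pres_map {p : X → Prop} {q : Y → Prop} (e : X ≃ Y) (h : ∀ x, p x ↔ q (e x))
    {w : Wr Γ X} : Pres q (map e w) ↔ Pres p w := by
  unfold Pres
  rw [e.surjective.forall]
  simp [map, h]

theorem pres_sum {p : X ⊕ Y → Prop} {a : Wr Γ X} {b : Wr Γ Y} :
    Pres p (sum a b) ↔ Pres (fun x => p (Sum.inl x)) a ∧ Pres (fun y => p (Sum.inr y)) b := by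
  simp [Pres, sum, Sum.forall]

theorem pres_inv [Group Γ] {p : X → Prop} {w : Wr Γ X} : Pres p (inv w) ↔ Pres p w := by
  unfold Pres
  rw [w.2.surjective.forall]
  simp [inv, iff_comm]

theorem pres_gauge [Group Γ] {p : X → Prop} {w : Wr Γ X} (h : X → Γ) :
    Pres p (gauge h w) ↔ Pres p w := Iff.rfl

open Classical in
/-- The restriction of a labelled permutation to an invariant subset. -/
def res (p : X → Prop) (w : Wr Γ X) : Wr Γ {x // p x} :=
  -- The identity is a default for subsets that are not invariant; products of functions test `Pres`
  -- before using `res`.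
  (fun x => w.1 x, if h : Pres p w then w.2.subtypePerm h else 1)

theorem res_snd {p : X → Prop} {w : Wr Γ X} (h : Pres p w) : (res p w).2 = w.2.subtypePerm h :=
  dif_pos h

theorem res_snd_apply {p : X → Prop} {w : Wr Γ X} (h : Pres p w) (x : {x // p x}) :
    ((res p w).2 x : X) = w.2 x := by rw [res_snd h]; rfl

theorem res_map {p : X → Prop} {q : Y → Prop} (e : X ≃ Y) (h : ∀ x, p x ↔ q (e x)) (w : Wr Γ X)
    (hw : Pres p w) : res q (map e w) = map (e.subtypeEquiv h) (res p w) := by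
  refine Prod.ext rfl ?_
  ext x
  rw [res_snd_apply ((pres_map e h).2 hw)]
  simp [map, res_snd_apply hw]

theorem res_sum {p : X ⊕ Y → Prop} {a : Wr Γ X} {b : Wr Γ Y} (h : Pres p (sum a b)) :
    res p (sum a b) = map Equiv.subtypeSum.symm
      (sum (res (fun x => p (Sum.inl x)) a) (res (fun y => p (Sum.inr y)) b)) := by
  obtain ⟨ha, hb⟩ := pres_sum.1 h
  refine Prod.ext ?_ ?_
  · funext x
    obtain ⟨x | x, hx⟩ := x <;> rfl
  · ext x
    rw [res_snd_apply h]
    obtain ⟨x | x, hx⟩ := x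
    · have := res_snd_apply ha ⟨x, hx⟩
      simp [map, sum, Equiv.subtypeSum, this]
    · have := res_snd_apply hb ⟨x, hx⟩
      simp [map, sum, Equiv.subtypeSum, this]

theorem res_inv [Group Γ] {p : X → Prop} {w : Wr Γ X} (h : Pres p w) :
    res p (inv w) = inv (res p w) := by
  refine Prod.ext ?_ ?_
  · funext x
    simp only [inv, res_snd h]
    rfl
  · rw [res_snd (pres_inv.2 h)]
    simp only [inv, res_snd h]
    rfl

theorem res_gauge [Group Γ] {p : X → Prop} {w : Wr Γ X} (h : Pres p w) (g : X → Γ) :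
    res p (gauge g w) = gauge (fun x : {x // p x} => g x) (res p w) := by
  refine Prod.ext ?_ ?_
  · funext x
    simp only [gauge, res_snd h]
    rfl
  · rw [res_snd ((pres_gauge g).2 h)]
    simp only [gauge, res_snd h]

open Classical in
/-- The labelled permutation glued from its restrictions to a subset and the complement. -/
def join (p : X → Prop) (a : Wr Γ {x // p x}) (b : Wr Γ {x // ¬p x}) : Wr Γ X :=
  map (Equiv.sumCompl p) (sum a b)

theorem join_fst_pos {p : X → Prop} {a : Wr Γ {x // p x}} {b : Wr Γ {x // ¬p x}} {x : X}
    (h : p x) : (join p a b).1 x = a.1 ⟨x, h⟩ := by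
  classical
  simp [join, map, sum, Equiv.sumCompl_symm_apply_of_pos h]

theorem join_fst_neg {p : X → Prop} {a : Wr Γ {x // p x}} {b : Wr Γ {x // ¬p x}} {x : X}
    (h : ¬p x) : (join p a b).1 x = b.1 ⟨x, h⟩ := by
  classical
  simp [join, map, sum, Equiv.sumCompl_symm_apply_of_neg h]

theorem join_snd_pos {p : X → Prop} {a : Wr Γ {x // p x}} {b : Wr Γ {x // ¬p x}} {x : X}
    (h : p x) : (join p a b).2 x = a.2 ⟨x, h⟩ := by
  classical
  simp [join, map, sum, Equiv.sumCompl_symm_apply_of_pos h]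

theorem join_snd_neg {p : X → Prop} {a : Wr Γ {x // p x}} {b : Wr Γ {x // ¬p x}} {x : X}
    (h : ¬p x) : (join p a b).2 x = b.2 ⟨x, h⟩ := by
  classical
  simp [join, map, sum, Equiv.sumCompl_symm_apply_of_neg h]

theorem pres_join (p : X → Prop) (a : Wr Γ {x // p x}) (b : Wr Γ {x // ¬p x}) :
    Pres p (join p a b) := by
  intro x
  by_cases h : p x
  · rw [join_snd_pos h]; exact iff_of_true (a.2 _).2 h
  · rw [join_snd_neg h]; exact iff_of_false (b.2 _).2 h

theorem res_join (p : X → Prop) (a : Wr Γ {x // p x}) (b : Wr Γ {x // ¬p x}) :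
    res p (join p a b) = a := by
  refine Prod.ext ?_ ?_
  · funext x; exact join_fst_pos x.2
  · ext x; rw [res_snd_apply (pres_join p a b), join_snd_pos x.2]

theorem res_not_join (p : X → Prop) (a : Wr Γ {x // p x}) (b : Wr Γ {x // ¬p x}) :
    res (fun x => ¬p x) (join p a b) = b := by
  refine Prod.ext ?_ ?_
  · funext x; exact join_fst_neg x.2
  · ext x; rw [res_snd_apply (pres_not.2 (pres_join p a b)), join_snd_neg x.2]

theorem join_res {p : X → Prop} {w : Wr Γ X} (h : Pres p w) :
    join p (res p w) (res (fun x => ¬p x) w) = w := by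
  refine Prod.ext ?_ ?_
  · funext x
    by_cases hx : p x
    · rw [join_fst_pos hx]; rfl
    · rw [join_fst_neg hx]; rfl
  · ext x
    by_cases hx : p x
    · rw [join_snd_pos hx, res_snd_apply h]
    · rw [join_snd_neg hx, res_snd_apply (pres_not.2 h)]

/-- Labelled permutations with a given invariant subset are pairs of labelled permutations. -/
def joinEquiv (p : X → Prop) :
    Wr Γ {x // p x} × Wr Γ {x // ¬p x} ≃ {w : Wr Γ X // Pres p w} where
  toFun a := ⟨join p a.1 a.2, pres_join p a.1 a.2⟩
  invFun w := (res p w.1, res (fun x => ¬p x) w.1)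
  left_inv a := Prod.ext (res_join _ _ _) (res_not_join _ _ _)
  right_inv w := Subtype.ext (join_res w.2)

theorem sum_pres [Fintype Γ] [Fintype X] [DecidableEq X] (p : X → Prop) [DecidablePred p]
    {M : Type*} [AddCommMonoid M] [∀ w : Wr Γ X, Decidable (Pres p w)]
    (G : Wr Γ {x // p x} → Wr Γ {x // ¬p x} → M) :
    ∑ w : Wr Γ X, (if Pres p w then G (res p w) (res (fun x => ¬p x) w) else 0) =
      ∑ a : Wr Γ {x // p x}, ∑ b : Wr Γ {x // ¬p x}, G a b := by
  rw [← Finset.sum_filter, Finset.sum_subtype (Finset.univ.filter fun w : Wr Γ X => Pres p w)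
    (p := fun w => Pres p w) (by simp), ← Fintype.sum_prod_type']
  refine (Fintype.sum_equiv (joinEquiv p) _ _ fun a => ?_).symm
  simp [joinEquiv, res_join, res_not_join]

theorem oddOrder_map (e : X ≃ Y) {w : Wr Γ X} : OddOrder (map e w).2 ↔ OddOrder w.2 :=
  SpinSym.oddOrder_permCongr e

theorem oddOrder_sum {a : Wr Γ X} {b : Wr Γ Y} :
    OddOrder (sum a b).2 ↔ OddOrder a.2 ∧ OddOrder b.2 := SpinSym.oddOrder_sumCongr

theorem oddOrder_join {p : X → Prop} {a : Wr Γ {x // p x}} {b : Wr Γ {x // ¬p x}} :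
    OddOrder (join p a b).2 ↔ OddOrder a.2 ∧ OddOrder b.2 := by
  classical
  rw [join, oddOrder_map, oddOrder_sum]

theorem oddOrder_res {p : X → Prop} {w : Wr Γ X} (h : Pres p w) :
    OddOrder w.2 ↔ OddOrder (res p w).2 ∧ OddOrder (res (fun x => ¬p x) w).2 := by
  conv_lhs => rw [← join_res h]
  rw [oddOrder_join]

end Wr

/-! ### Functions on labelled permutations of all finite sets -/

section Species

variable {Γ : Type*}

/-- A function on labelled permutations of sets is natural if it is invariant under bijections. -/
def Natural (u : ∀ X : Type, Wr Γ X → ℂ) : Prop :=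
  ∀ (X Y : Type) (e : X ≃ Y) (w : Wr Γ X), u Y (Wr.map e w) = u X w

open Classical in
/-- The extension of a function on labelled permutations of `{0, …, n - 1}` to those of all sets,
by transport to all sets with `n` elements and by zero to all other sets. -/
def spread {n : ℕ} (F : Wr Γ (Fin n) → ℂ) (X : Type) (w : Wr Γ X) : ℂ :=
  if h : Nonempty (X ≃ Fin n) then F (Wr.map h.some w) else 0

/-- Invariance under permutations of `Fin n` makes the bijection chosen in `spread` immaterial. -/
theorem spread_eq {n : ℕ} {F : Wr Γ (Fin n) → ℂ} (hF : ∀ (τ : Equiv.Perm (Fin n)) w,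
    F (Wr.map τ w) = F w) {X : Type} (e : X ≃ Fin n) (w : Wr Γ X) :
    spread F X w = F (Wr.map e w) := by
  have h : Nonempty (X ≃ Fin n) := ⟨e⟩
  rw [spread, dif_pos h, ← hF (e.symm.trans h.some) (Wr.map e w), Wr.map_map,
    ← Equiv.trans_assoc, Equiv.self_trans_symm, Equiv.refl_trans]

theorem spread_self {n : ℕ} {F : Wr Γ (Fin n) → ℂ} (hF : ∀ (τ : Equiv.Perm (Fin n)) w,
    F (Wr.map τ w) = F w) (w : Wr Γ (Fin n)) : spread F (Fin n) w = F w :=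
  spread_eq hF (Equiv.refl _) w

theorem spread_of_card_ne {n : ℕ} (F : Wr Γ (Fin n) → ℂ) {X : Type} (w : Wr Γ X)
    (h : Nat.card X ≠ n) : spread F X w = 0 := by
  rw [spread, dif_neg]
  rintro ⟨e⟩
  exact h (by rw [Nat.card_congr e, Nat.card_fin])

theorem natural_spread {n : ℕ} {F : Wr Γ (Fin n) → ℂ} (hF : ∀ (τ : Equiv.Perm (Fin n)) w,
    F (Wr.map τ w) = F w) : Natural (spread F) := by
  intro X Y e w
  by_cases h : Nonempty (X ≃ Fin n)
  · obtain ⟨f⟩ := h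
    rw [spread_eq hF f, spread_eq hF (e.symm.trans f), Wr.map_map, ← Equiv.trans_assoc,
      Equiv.self_trans_symm, Equiv.refl_trans]
  · rw [spread, spread, dif_neg h, dif_neg]
    rintro ⟨f⟩
    exact h ⟨e.trans f⟩

open Classical in
/-- The summand of the product at a subset. -/
def convTerm (u f : ∀ X : Type, Wr Γ X → ℂ) {X : Type} (p : X → Prop) (w : Wr Γ X) : ℂ :=
  if Wr.Pres p w then u _ (Wr.res p w) * f _ (Wr.res (fun x => ¬p x) w) else 0

/-- The product of functions on labelled permutations: the sum over all decompositions into two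
invariant subsets. -/
def conv (u f : ∀ X : Type, Wr Γ X → ℂ) (X : Type) [Fintype X] (w : Wr Γ X) : ℂ :=
  ∑ S : Finset X, convTerm u f (· ∈ S) w

theorem convTerm_map {u f : ∀ X : Type, Wr Γ X → ℂ} (hu : Natural u) (hf : Natural f) {X Y : Type}
    (e : X ≃ Y) {p : X → Prop} {q : Y → Prop} (h : ∀ x, p x ↔ q (e x)) (w : Wr Γ X) :
    convTerm u f q (Wr.map e w) = convTerm u f p w := by
  unfold convTerm
  by_cases hp : Wr.Pres p w
  · rw [if_pos hp, if_pos ((Wr.pres_map e h).2 hp), Wr.res_map e h w hp,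
      Wr.res_map (p := fun x => ¬p x) (q := fun x => ¬q x) e (fun x => not_iff_not.2 (h x)) w
        (Wr.pres_not.2 hp), hu, hf]
  · rw [if_neg hp, if_neg]
    rwa [Wr.pres_map e h]

theorem conv_map {u f : ∀ X : Type, Wr Γ X → ℂ} (hu : Natural u) (hf : Natural f) {X Y : Type}
    [Fintype X] [Fintype Y] (e : X ≃ Y) (w : Wr Γ X) :
    conv u f Y (Wr.map e w) = conv u f X w := by
  unfold conv
  refine (Fintype.sum_equiv e.finsetCongr _ _ fun S => ?_).symm
  exact (convTerm_map hu hf e (fun x => by simp [Equiv.finsetCongr]) w).symm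

/-- Bijections from a sum with prescribed image of the first summand. -/
def sumEquivFiber {A B X : Type*} (p : X → Prop) :
    (A ≃ {x // p x}) × (B ≃ {x // ¬p x}) ≃ {e : A ⊕ B ≃ X // ∀ x, p x ↔ (e.symm x).isLeft} := by
  classical
  refine Equiv.ofBijective (fun a => ⟨(Equiv.sumCongr a.1 a.2).trans (Equiv.sumCompl p),
    fun x => ?_⟩) ⟨?_, ?_⟩
  · by_cases hx : p x
    · simp [Equiv.sumCompl_symm_apply_of_pos hx, hx]
    · simp [Equiv.sumCompl_symm_apply_of_neg hx, hx]
  · rintro ⟨a, b⟩ ⟨a', b'⟩ h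
    have h' := DFunLike.congr_fun (congrArg Subtype.val h)
    refine Prod.ext ?_ ?_
    · ext x; simpa using h' (Sum.inl x)
    · ext x; simpa using h' (Sum.inr x)
  · rintro ⟨e, he⟩
    have hl : ∀ i, p (e (Sum.inl i)) := fun i => by simp [he]
    have hr : ∀ i, ¬p (e (Sum.inr i)) := fun i => by simp [he]
    refine ⟨(Equiv.ofBijective (fun i => ⟨e (Sum.inl i), hl i⟩) ⟨?_, ?_⟩,
      Equiv.ofBijective (fun i => ⟨e (Sum.inr i), hr i⟩) ⟨?_, ?_⟩), ?_⟩
    · intro i j h; simpa using h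
    · rintro ⟨x, hx⟩
      obtain ⟨i | i, rfl⟩ := e.surjective x
      · exact ⟨i, rfl⟩
      · exact absurd hx (hr i)
    · intro i j h; simpa using h
    · rintro ⟨x, hx⟩
      obtain ⟨i | i, rfl⟩ := e.surjective x
      · exact absurd (hl i) hx
      · exact ⟨i, rfl⟩
    · refine Subtype.ext (Equiv.ext fun i => ?_)
      cases i <;> rfl

/-- A sum over decompositions, written as a sum over bijections. -/
theorem sum_equiv_eq {k l : ℕ} {X : Type} [Fintype X] [DecidableEq X] (hX : Fintype.card X = k + l)
    (Φ : Finset X → ℂ) (hΦ : ∀ S, S.card ≠ k → Φ S = 0) :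
    ∑ e : Fin k ⊕ Fin l ≃ X, Φ (Finset.univ.filter fun x => (e.symm x).isLeft) =
      (k.factorial * l.factorial : ℂ) * ∑ S, Φ S := by
  classical
  rw [← Finset.sum_fiberwise (s := Finset.univ)
    (g := fun e : Fin k ⊕ Fin l ≃ X => Finset.univ.filter fun x => (e.symm x).isLeft),
    Finset.mul_sum]
  refine Finset.sum_congr rfl fun S _ => ?_
  rw [Finset.sum_congr rfl (g := fun _ => Φ S) (fun e he => by rw [(Finset.mem_filter.1 he).2]),
    Finset.sum_const, nsmul_eq_mul]
  by_cases hS : S.card = k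
  · congr 1
    rw [← Nat.cast_mul]
    congr 1
    have e1 : Fin k ≃ {x // x ∈ S} := (Fintype.equivFinOfCardEq (by simp [hS])).symm
    have e2 : Fin l ≃ {x // ¬ x ∈ S} := (Fintype.equivFinOfCardEq (by
      rw [Fintype.card_subtype_compl, hX, Fintype.card_coe, hS]; omega)).symm
    -- A subset of size $k$ is the image of the first summand under exactly $k!\,l!$ bijections.
    have h1 := Fintype.card_congr (sumEquivFiber (A := Fin k) (B := Fin l) (· ∈ S))
    rw [Fintype.card_prod, Fintype.card_equiv e1, Fintype.card_equiv e2, Fintype.card_fin,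
      Fintype.card_fin] at h1
    rw [h1, Fintype.card_subtype]
    congr 1
    ext e
    simp [Finset.ext_iff, iff_comm]
  · rw [hΦ S hS, mul_zero, mul_zero]

end Species

/-! ### Anticommuting odd elements and the support of spin super class functions -/

namespace SpinSym

/-- Odd elements of disjoint blocks anticommute. -/
theorem blockHom_anticomm {k l m o p : ℕ} (h : o + k ≤ m) (h' : p + l ≤ m) (hop : o + k ≤ p)
    (x : SpinSym k) (hx : parity k x = -1) (y : SpinSym l) (hy : parity l y = -1) :
    blockHom o h x * blockHom p h' y = z m * (blockHom p h' y * blockHom o h x) := by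
  let ζ : ℤˣ → SpinSym m := fun u => if u = 1 then 1 else z m
  have hζ : ∀ u v, ζ (u * v) = ζ u * ζ v := by
    intro u v
    rcases Int.units_eq_one_or u with rfl | rfl <;> rcases Int.units_eq_one_or v with rfl | rfl <;>
      simp [ζ, z_mul_z]
  have hζc : ∀ u (g : SpinSym m), ζ u * g = g * ζ u := by
    intro u g
    rcases Int.units_eq_one_or u with rfl | rfl
    · simp [ζ]
    · simpa [ζ] using z_comm g
  have hζ1 : ζ (-1) = z m := by simp [ζ]
  -- For $k\le1$ every element is even, so an odd $x$ provides a generator $t_i$ of its block. Then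
  -- $x=t_i\cdot(t_i^{-1}x)$ with even second factor, which commutes with $y$; only $t_i$ has to be
  -- moved.
  obtain ⟨i⟩ : Nonempty (Fin (k - 1)) := by
    rcases Nat.eq_zero_or_pos (k - 1) with hk | hk
    swap
    · exact ⟨⟨0, hk⟩⟩
    exfalso
    have hs : Subsingleton (Fin k) := Fin.subsingleton_iff_le_one.2 (by omega)
    have : parity k x = 1 := by
      rw [parity, MonoidHom.comp_apply, Subsingleton.elim (toPerm k x) 1, map_one]
    rw [this] at hx
    exact absurd hx (by decide)
  -- Conjugation by $t_i$ and multiplication by $z$ on odd elements are both homomorphisms on the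
  -- second block; they agree on generators, hence everywhere.
  let φ : SpinSym l →* SpinSym m :=
    (MulAut.conj (blockHom o h (t i))).toMonoidHom.comp (blockHom p h')
  let ψ : SpinSym l →* SpinSym m :=
    ⟨⟨fun y => blockHom p h' y * ζ (parity l y), by simp [ζ]⟩, fun a b => by
      simp only [map_mul, hζ, mul_assoc]
      congr 1
      rw [← mul_assoc, ← mul_assoc, hζc]⟩
  have e : φ = ψ := by
    refine hom_ext ?_ fun j => ?_
    · simp only [φ, ψ, MonoidHom.comp_apply, MonoidHom.coe_mk, OneHom.coe_mk, blockHom_z,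
        parity_z, MulEquiv.toMonoidHom_eq_coe, MonoidHom.coe_coe, MulAut.conj_apply]
      rw [← z_comm, mul_inv_cancel_right]; simp [ζ]
    · simp only [φ, ψ, MonoidHom.comp_apply, MonoidHom.coe_mk, OneHom.coe_mk, blockHom_t,
        parity_t, MulEquiv.toMonoidHom_eq_coe, MonoidHom.coe_coe, MulAut.conj_apply, hζ1]
      have hfar := (relations m).far ⟨p + j, by omega⟩ ⟨o + i, by omega⟩ (by simp only; omega)
      rw [mul_inv_eq_iff_eq_mul, mul_assoc, z_comm, ← mul_assoc, hfar, ← z_comm, ← mul_assoc,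
        ← mul_assoc, z_mul_z, one_mul]
  have e' := DFunLike.congr_fun e y
  simp only [φ, ψ, MonoidHom.comp_apply, MonoidHom.coe_mk, OneHom.coe_mk, hy,
    MulEquiv.toMonoidHom_eq_coe, MonoidHom.coe_coe, MulAut.conj_apply, hζ1] at e'
  rw [mul_inv_eq_iff_eq_mul, ← z_comm, mul_assoc] at e'
  have hx' : parity k ((t i)⁻¹ * x) = 1 := by
    rw [map_mul, map_inv, parity_t, hx]; decide
  have e2 := blockHom_comm h h' hop ((t i)⁻¹ * x) hx' y
  have ex : blockHom o h x = blockHom o h (t i) * blockHom o h ((t i)⁻¹ * x) := by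
    rw [← map_mul, mul_inv_cancel_left]
  rw [ex, mul_assoc, e2, ← mul_assoc, e', mul_assoc, mul_assoc]

end SpinSym

namespace SpinWreath
variable {Γ : Type*} [Group Γ]

/-- Odd elements of disjoint blocks anticommute. -/
theorem blockHom_anticomm {k l m o p : ℕ} (h : o + k ≤ m) (h' : p + l ≤ m) (hop : o + k ≤ p)
    (x : SpinWreath Γ k) (hx : parity k x = -1) (y : SpinWreath Γ l) (hy : parity l y = -1) :
    blockHom o h x * blockHom p h' y = z m * (blockHom p h' y * blockHom o h x) := by
  ext1
  · simp only [z, SemidirectProduct.mul_left, SemidirectProduct.left_inr,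
      SemidirectProduct.right_inr, MonoidHom.comp_apply, SpinSym.toPerm_z, map_one, one_mul,
      MulAut.one_apply]
    change extendHom o h x.left * permAct Γ m (SpinSym.toPerm m (SpinSym.blockHom o h x.right))
        (extendHom p h' y.left) =
      extendHom p h' y.left * permAct Γ m (SpinSym.toPerm m (SpinSym.blockHom p h' y.right))
        (extendHom o h x.left)
    rw [act_extendHom _ _ (Or.inl hop), act_extendHom _ _ (Or.inr hop)]
    funext i
    rw [Pi.mul_apply, Pi.mul_apply]
    by_cases hi : i ∈ Set.range (SpinSym.block o h)
    · rw [extendHom_of_notMem (i := i) p h']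
      · simp
      · rintro ⟨j', hj⟩
        obtain ⟨j, rfl⟩ := hi
        have := congrArg Fin.val hj
        simp only [SpinSym.block_val] at this
        omega
    · rw [extendHom_of_notMem _ _ _ hi]; simp
  · exact SpinSym.blockHom_anticomm h h' hop x.right hx y.right hy

/-- An element with an invariant subset is conjugate to a product of elements of two blocks. -/
theorem exists_conj_blockMul {n : ℕ} (x : SpinWreath Γ n) (p : Fin n → Prop)
    (hp : Wr.Pres p (proj x)) :
    ∃ (k l : ℕ) (h : k + l = n) (e₁ : {i // p i} ≃ Fin k) (e₂ : {i // ¬p i} ≃ Fin l)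
      (y : SpinWreath Γ n) (a : SpinWreath Γ k) (b : SpinWreath Γ l),
      y * x * y⁻¹ = blockMul h (a, b) ∧ proj a = Wr.map e₁ (Wr.res p (proj x)) ∧
        proj b = Wr.map e₂ (Wr.res (fun i => ¬p i) (proj x)) := by
  classical
  have h : Fintype.card {i // p i} + Fintype.card {i // ¬p i} = n := by
    have := Fintype.card_congr (Equiv.sumCompl p)
    rwa [Fintype.card_sum, Fintype.card_fin] at this
  let e₁ := Fintype.equivFin {i // p i}
  let e₂ := Fintype.equivFin {i // ¬p i}
  -- `τ` moves the invariant subset to the initial positions and its complement to the final ones; a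
  -- lift of it is the conjugating element.
  let τ : Equiv.Perm (Fin n) := (Equiv.sumCompl p).symm.trans
    ((Equiv.sumCongr e₁ e₂).trans (SpinSym.blockEquiv h))
  obtain ⟨s, hs⟩ := SpinSym.toPerm_surjective n τ
  let y : SpinWreath Γ n := ⟨1, s⟩
  obtain ⟨a, ha⟩ := proj_surjective (Wr.map e₁ (Wr.res p (proj x)))
  obtain ⟨b, hb⟩ := proj_surjective (Wr.map e₂ (Wr.res (fun i => ¬p i) (proj x)))
  have hproj : proj (y * x * y⁻¹) = proj (blockMul h (a, b)) := by
    rw [proj_conj, proj_blockMul, ha, hb, Wr.map_sum, Wr.map_map]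
    change Wr.gauge 1 (Wr.map (SpinSym.toPerm n s) (proj x)) = _
    rw [Wr.gauge_one, hs]
    conv_lhs => rw [← Wr.join_res hp]
    rw [Wr.join, Wr.map_map]
    congr 1
    ext i
    simp only [τ, Equiv.trans_apply]
    congr 3
    convert Equiv.symm_apply_apply _ i
  -- The projections determine the conjugate only up to $z$, which is absorbed into the first
  -- factor.
  rcases eq_or_of_proj_eq hproj with h1 | h1
  · exact ⟨_, _, h, e₁, e₂, y, a, b, h1, ha, hb⟩
  · refine ⟨_, _, h, e₁, e₂, y, z _ * a, b, ?_, by rw [proj_z_mul, ha], hb⟩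
    rw [blockMul_z_left, h1]

theorem parity_eq_sign {n : ℕ} (x : SpinWreath Γ n) :
    parity n x = Equiv.Perm.sign (proj x).2 := rfl

end SpinWreath

/-- A permutation not of odd order has an invariant subset on which it is an odd permutation. -/
theorem exists_pres_sign {X : Type*} [Fintype X] [DecidableEq X] {σ : Equiv.Perm X}
    (hσ : ¬OddOrder σ) : ∃ (S : Finset X) (h : ∀ x, σ x ∈ S ↔ x ∈ S),
      Equiv.Perm.sign (σ.subtypePerm h) = -1 := by
  classical
  -- If all cycles had odd length, their least common multiple, the order of `σ`, would be odd. The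
  -- support of a cycle of even length is the required subset, since such a cycle is an odd
  -- permutation.
  obtain ⟨c, hc, heven⟩ : ∃ c ∈ σ.cycleFactorsFinset, Even c.support.card := by
    by_contra! hodd
    refine hσ ⟨orderOf σ, ?_, pow_orderOf_eq_one σ⟩
    rw [← Equiv.Perm.lcm_cycleType]
    refine Odd.of_dvd_nat (n := σ.cycleType.prod) ?_ (Multiset.lcm_dvd.2 fun b hb =>
      Multiset.dvd_prod hb)
    have : ∀ s : Multiset ℕ, (∀ b ∈ s, Odd b) → Odd s.prod := by
      intro s
      induction s using Multiset.induction with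
      | empty => simp
      | cons a s ih =>
        intro h
        rw [Multiset.prod_cons]
        exact (h a (by simp)).mul (ih fun b hb => h b (by simp [hb]))
    refine this _ fun b hb => ?_
    rw [Equiv.Perm.cycleType_def, Multiset.mem_map] at hb
    obtain ⟨c, hc, rfl⟩ := hb
    exact Nat.not_even_iff_odd.1 (hodd c hc)
  obtain ⟨hcyc, hcs⟩ := Equiv.Perm.mem_cycleFactorsFinset_iff.1 hc
  have hS : ∀ x, σ x ∈ c.support ↔ x ∈ c.support := by
    intro x
    have hcomm := Equiv.Perm.self_mem_cycle_factors_commute hc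
    have h2 : ∀ x, c (σ x) = σ (c x) := fun x => DFunLike.congr_fun hcomm.eq x
    rw [Equiv.Perm.mem_support, Equiv.Perm.mem_support, h2, Ne, Ne, σ.injective.eq_iff]
  refine ⟨c.support, hS, ?_⟩
  have hSc : ∀ x, c x ∈ c.support ↔ x ∈ c.support := fun x => Equiv.Perm.apply_mem_support
  have : σ.subtypePerm hS = c.subtypePerm hSc := by
    ext x
    simp [hcs x x.2]
  have h3 := Equiv.Perm.sign_subtypePerm c (p := (· ∈ c.support)) hSc
    (fun x hx => Equiv.Perm.mem_support.2 hx)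
  rw [hcyc.sign, heven.neg_one_pow] at h3
  rw [this, ← h3]
  congr!

section SuperClass
variable {Γ : Type*} [Group Γ]

/-- Spin super class functions are supported on the elements of odd order type. -/
theorem superClass_eq_zero {n : ℕ} {f : SpinWreath Γ n → ℂ} (hf : f ∈ superClass Γ n)
    {x : SpinWreath Γ n} (hx : ¬OddOrder (SpinWreath.proj x).2) : f x = 0 := by
  rcases Int.units_eq_one_or (SpinWreath.parity n x) with hp | hp
  swap
  · exact hf.2.2 x hp
  obtain ⟨S, hS, hsign⟩ := exists_pres_sign hx
  obtain ⟨k, l, h, e₁, e₂, y, a, b, hab, ha, hb⟩ :=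
    SpinWreath.exists_conj_blockMul x (· ∈ S) hS
  have hpa : SpinWreath.parity k a = -1 := by
    rw [SpinWreath.parity_eq_sign, ha, ← hsign, Wr.res, dif_pos (show Wr.Pres _ _ from hS)]
    exact Equiv.Perm.sign_permCongr _ _
  have hpab : SpinWreath.parity n (blockMul h (a, b)) = 1 := by
    rw [← hab, map_mul, map_mul, map_inv, hp, mul_one, mul_inv_cancel]
  have hpb : SpinWreath.parity l b = -1 := by
    rw [blockMul, map_mul, SpinWreath.parity_blockHom, SpinWreath.parity_blockHom, hpa] at hpab
    rcases Int.units_eq_one_or (SpinWreath.parity l b) with h | h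
    · rw [h] at hpab; exact absurd hpab (by decide)
    · exact h
  -- Here `a` and `b` are both odd, so $ab=z\,ba$. As $ba$ is conjugate to $ab$, this gives
  -- $f(ab)=-f(ba)=-f(ab)$.
  have h1 : f (blockMul h (a, b)) = -f (blockMul h (a, b)) := by
    conv_lhs => rw [blockMul, SpinWreath.blockHom_anticomm _ _ (by simp) _ hpa _ hpb, hf.2.1]
    rw [neg_inj, ← hf.1 (blockMul h (a, b)) (SpinWreath.blockHom k h.le b)]
    congr 1
    simp only [blockMul, mul_assoc, mul_inv_cancel, mul_one]
  rw [← hf.1 x y, hab]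
  linear_combination h1 / 2

open Classical in
/-- The function on labelled permutations corresponding to a function on the spin wreath product. -/
def desc {n : ℕ} (f : SpinWreath Γ n → ℂ) (w : Wr Γ (Fin n)) : ℂ :=
  if OddOrder w.2 then f (SpinWreath.can w) else 0

theorem desc_of_odd {n : ℕ} (f : SpinWreath Γ n → ℂ) {w : Wr Γ (Fin n)} (h : OddOrder w.2) :
    desc f w = f (SpinWreath.can w) := if_pos h

theorem desc_of_not {n : ℕ} (f : SpinWreath Γ n → ℂ) {w : Wr Γ (Fin n)} (h : ¬OddOrder w.2) :
    desc f w = 0 := if_neg h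

theorem desc_map {n : ℕ} {f : SpinWreath Γ n → ℂ} (hf : f ∈ superClass Γ n)
    (τ : Equiv.Perm (Fin n)) (w : Wr Γ (Fin n)) : desc f (Wr.map τ w) = desc f w := by
  by_cases h : OddOrder w.2
  · rw [desc_of_odd f h, desc_of_odd f ((Wr.oddOrder_map τ).2 h)]
    obtain ⟨s, hs⟩ := SpinSym.toPerm_surjective n τ
    rw [← hf.1 (SpinWreath.can w) ⟨1, s⟩, SpinWreath.can_conj h]
    change _ = f (SpinWreath.can (Wr.gauge 1 (Wr.map (SpinSym.toPerm n s) w)))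
    rw [Wr.gauge_one, hs]
  · rw [desc_of_not f h, desc_of_not f (fun h' => h ((Wr.oddOrder_map τ).1 h'))]

theorem desc_gauge {n : ℕ} {f : SpinWreath Γ n → ℂ} (hf : f ∈ superClass Γ n)
    (g : Fin n → Γ) (w : Wr Γ (Fin n)) : desc f (Wr.gauge g w) = desc f w := by
  by_cases h : OddOrder w.2
  · have h' : OddOrder (Wr.gauge g w).2 := h
    rw [desc_of_odd f h, desc_of_odd f h', ← hf.1 (SpinWreath.can w) ⟨g, 1⟩,
      SpinWreath.can_conj h]
    change _ = f (SpinWreath.can (Wr.gauge g (Wr.map (SpinSym.toPerm n 1) w)))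
    rw [map_one]
    rfl
  · have h' : ¬OddOrder (Wr.gauge g w).2 := h
    rw [desc_of_not f h, desc_of_not f h']

/-- A spin super class function is determined by its values on canonical lifts. -/
theorem desc_injective {n : ℕ} {f f' : SpinWreath Γ n → ℂ} (hf : f ∈ superClass Γ n)
    (hf' : f' ∈ superClass Γ n) (h : desc f = desc f') : f = f' := by
  funext x
  by_cases hx : OddOrder (SpinWreath.proj x).2
  · have h1 := congrFun h (SpinWreath.proj x)
    rw [desc_of_odd _ hx, desc_of_odd _ hx] at h1
    rcases SpinWreath.eq_or_of_proj_eq (SpinWreath.proj_can hx) with h2 | h2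
    · rwa [h2] at h1
    · rw [h2, hf.2.1, hf'.2.1] at h1
      exact neg_inj.1 h1
  · rw [superClass_eq_zero hf hx, superClass_eq_zero hf' hx]

theorem natural_spread_desc {n : ℕ} {f : SpinWreath Γ n → ℂ} (hf : f ∈ superClass Γ n) :
    Natural (spread (desc f)) := natural_spread (desc_map hf)

theorem spread_desc_gauge {n : ℕ} {f : SpinWreath Γ n → ℂ} (hf : f ∈ superClass Γ n) {X : Type}
    (g : X → Γ) (w : Wr Γ X) : spread (desc f) X (Wr.gauge g w) = spread (desc f) X w := by
  by_cases h : Nonempty (X ≃ Fin n)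
  · obtain ⟨e⟩ := h
    rw [spread_eq (desc_map hf) e, spread_eq (desc_map hf) e, Wr.map_gauge, desc_gauge hf]
  · rw [spread, spread, dif_neg h, dif_neg h]

theorem spread_desc_of_not {n : ℕ} (f : SpinWreath Γ n → ℂ) {X : Type} {w : Wr Γ X}
    (h : ¬OddOrder w.2) : spread (desc f) X w = 0 := by
  rw [spread]
  split_ifs
  · exact desc_of_not f fun h' => h ((Wr.oddOrder_map _).1 h')
  · rfl

end SuperClass

/-! ### Induction and contraction in terms of labelled permutations -/

section Species
variable {Γ : Type*}

theorem convTerm_sum {u f : ∀ X : Type, Wr Γ X → ℂ} (hu : Natural u) (hf : Natural f)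
    {X Y : Type} (a : Wr Γ X) (b : Wr Γ Y) :
    convTerm u f (fun x : X ⊕ Y => x.isLeft) (Wr.sum a b) = u X a * f Y b := by
  have hp : Wr.Pres (fun x : X ⊕ Y => x.isLeft = true) (Wr.sum a b) := by
    rintro (x | x) <;> simp [Wr.sum]
  let e₁ : X ≃ {x : X ⊕ Y // x.isLeft = true} :=
    { toFun := fun x => ⟨Sum.inl x, rfl⟩
      invFun := fun x => x.1.getLeft x.2
      left_inv := fun x => rfl
      right_inv := by rintro ⟨x | x, hx⟩ <;> simp at hx ⊢ }
  let e₂ : Y ≃ {x : X ⊕ Y // ¬x.isLeft = true} :=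
    { toFun := fun x => ⟨Sum.inr x, by simp⟩
      invFun := fun x => x.1.getRight (by simpa using x.2)
      left_inv := fun x => rfl
      right_inv := by rintro ⟨x | x, hx⟩ <;> simp at hx ⊢ }
  have h1 : Wr.res (fun x : X ⊕ Y => x.isLeft = true) (Wr.sum a b) = Wr.map e₁ a := by
    refine Prod.ext ?_ ?_
    · funext ⟨x, hx⟩
      cases x <;> first | rfl | simp at hx
    · ext ⟨x, hx⟩
      rw [Wr.res_snd_apply hp]
      cases x <;> first | rfl | simp at hx
  have h2 : Wr.res (fun x : X ⊕ Y => ¬x.isLeft = true) (Wr.sum a b) = Wr.map e₂ b := by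
    refine Prod.ext ?_ ?_
    · funext ⟨x, hx⟩
      cases x <;> first | rfl | simp at hx
    · ext ⟨x, hx⟩
      rw [Wr.res_snd_apply (Wr.pres_not.2 hp)]
      cases x <;> first | rfl | simp at hx
  rw [convTerm, if_pos hp, h1, h2, hu, hf]

theorem Wr.exists_sum_of_pres {X Y : Type*} [Finite X] [Finite Y] {w : Wr Γ (X ⊕ Y)}
    (h : Wr.Pres (fun x => x.isLeft = true) w) : ∃ a b, Wr.sum a b = w := by
  obtain ⟨⟨σ, τ⟩, h2⟩ := Equiv.Perm.mem_sumCongrHom_range_of_perm_mapsTo_inl (σ := w.2) (by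
    rintro _ ⟨x, rfl⟩
    obtain ⟨y, hy⟩ := Sum.isLeft_iff.1 ((h (Sum.inl x)).2 rfl)
    exact ⟨y, hy.symm⟩)
  refine ⟨(fun x => w.1 (Sum.inl x), σ), (fun x => w.1 (Sum.inr x), τ), Prod.ext ?_ h2⟩
  funext x
  cases x <;> rfl

theorem convTerm_gauge [Group Γ] {u f : ∀ X : Type, Wr Γ X → ℂ}
    (hu : ∀ (X : Type) (g : X → Γ) (w : Wr Γ X), u X (Wr.gauge g w) = u X w)
    (hf : ∀ (X : Type) (g : X → Γ) (w : Wr Γ X), f X (Wr.gauge g w) = f X w)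
    {X : Type} (p : X → Prop) (g : X → Γ) (w : Wr Γ X) :
    convTerm u f p (Wr.gauge g w) = convTerm u f p w := by
  unfold convTerm
  by_cases hp : Wr.Pres p w
  · rw [if_pos hp, if_pos ((Wr.pres_gauge g).2 hp), Wr.res_gauge hp,
      Wr.res_gauge (Wr.pres_not.2 hp), hu, hf]
  · rw [if_neg hp, if_neg fun h => hp ((Wr.pres_gauge g).1 h)]

end Species

section SuperClass
variable {Γ : Type*} [Group Γ]

namespace SpinWreath

open Classical in
/-- A section of the projection, equal to the canonical lift on labelled permutations of odd
order. -/
def sec {n : ℕ} (w : Wr Γ (Fin n)) : SpinWreath Γ n :=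
  if OddOrder w.2 then can w else (proj_surjective w).choose

theorem sec_of_odd {n : ℕ} {w : Wr Γ (Fin n)} (h : OddOrder w.2) : sec w = can w := if_pos h

theorem proj_sec {n : ℕ} (w : Wr Γ (Fin n)) : proj (sec w) = w := by
  by_cases h : OddOrder w.2
  · rw [sec_of_odd h, proj_can h]
  · rw [sec, if_neg h]; exact (proj_surjective w).choose_spec

/-- The spin wreath product is a double cover of the set of labelled permutations. -/
def secEquiv (n : ℕ) : Wr Γ (Fin n) ⊕ Wr Γ (Fin n) ≃ SpinWreath Γ n := by
  refine Equiv.ofBijective (Sum.elim sec fun w => z n * sec w) ⟨?_, fun x => ?_⟩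
  · rintro (w | w) (w' | w') h
    · rw [← proj_sec w, ← proj_sec w']
      exact congrArg (fun x => Sum.inl (proj x)) h
    · have h1 := congrArg proj h
      simp only [Sum.elim_inl, Sum.elim_inr, proj_z_mul, proj_sec] at h1
      subst h1
      exact absurd h.symm (z_mul_ne _)
    · have h1 := congrArg proj h
      simp only [Sum.elim_inl, Sum.elim_inr, proj_z_mul, proj_sec] at h1
      subst h1
      exact absurd h (z_mul_ne _)
    · have h1 := congrArg proj h
      simp only [Sum.elim_inr, proj_z_mul, proj_sec] at h1
      rw [h1]
  · rcases eq_or_of_proj_eq (proj_sec (proj x)) with h | h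
    · exact ⟨Sum.inl (proj x), h⟩
    · refine ⟨Sum.inr (proj x), ?_⟩
      rw [Sum.elim_inr, h, ← mul_assoc, z_mul_z, one_mul]

variable [Fintype Γ]

theorem sum_eq_sum_sec {n : ℕ} (Φ : SpinWreath Γ n → ℂ) :
    ∑ x, Φ x = ∑ w : Wr Γ (Fin n), (Φ (sec w) + Φ (z n * sec w)) := by
  rw [← Equiv.sum_comp (secEquiv n), Fintype.sum_sum_type, ← Finset.sum_add_distrib]
  rfl

theorem card_eq (n : ℕ) :
    (Nat.card (SpinWreath Γ n) : ℂ) = 2 * (n.factorial * (Nat.card Γ : ℂ) ^ n) := by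
  rw [← Nat.card_congr (secEquiv (Γ := Γ) n), Nat.card_sum, Nat.card_prod, Nat.card_perm,
    Nat.card_fun, Nat.card_fin]
  push_cast
  ring

end SpinWreath

variable [Fintype Γ]

open Classical in
theorem card_blockMul_fiber {n k m : ℕ} (h : n + k = m)
    (q : SpinWreath Γ n × SpinWreath Γ k) :
    (Finset.univ.filter fun p => blockMul h p = blockMul h q).card = 2 := by
  have : (Finset.univ.filter fun p => blockMul h p = blockMul h q) =
      {q, (SpinWreath.z n * q.1, SpinWreath.z k * q.2)} := by
    ext ⟨a, b⟩
    obtain ⟨c, d⟩ := q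
    simp [SpinWreath.blockMul_eq_iff]
  rw [this, Finset.card_pair]
  intro h'
  exact SpinWreath.z_mul_ne q.1 (congrArg Prod.fst h').symm

theorem card_range_blockMul {n k m : ℕ} (h : n + k = m) :
    (Nat.card (Set.range (blockMul (Γ := Γ) h)) : ℂ) * 2 =
      Nat.card (SpinWreath Γ n) * Nat.card (SpinWreath Γ k) := by
  classical
  rw [← Nat.cast_mul, ← Nat.card_prod, Nat.card_eq_fintype_card (α := _ × _), ← Finset.card_univ,
    Finset.card_eq_sum_card_image (blockMul h), Finset.sum_congr rfl (g := fun _ => 2)]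
  · rw [Finset.sum_const, smul_eq_mul]
    push_cast
    congr 2
    have : Set.range (blockMul (Γ := Γ) h) = ↑(Finset.univ.image (blockMul (Γ := Γ) h)) := by simp
    rw [Nat.card_coe_set_eq, this, Set.ncard_coe_finset]
  · intro x hx
    obtain ⟨q, -, rfl⟩ := Finset.mem_image.1 hx
    exact card_blockMul_fiber h q

-- Every nonempty fibre of the product map has two elements, so the average is half the sum; off the
-- range both sides are $0$.
open Classical in
theorem outer_eq {n k m : ℕ} (h : n + k = m) (u : SpinWreath Γ n → ℂ) (f : SpinWreath Γ k → ℂ)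
    (x : SpinWreath Γ m) :
    outer h u f x = 2⁻¹ * ∑ a, ∑ b, if blockMul h (a, b) = x then u a * f b else 0 := by
  rw [← Fintype.sum_prod_type', ← Finset.sum_filter, outer]
  by_cases hx : ∃ q, blockMul h q = x
  · obtain ⟨q, rfl⟩ := hx
    rw [card_blockMul_fiber]
    rfl
  · rw [Finset.sum_eq_zero, mul_zero, mul_zero]
    intro p hp
    exact absurd ⟨p, (Finset.mem_filter.1 hp).2⟩ hx

-- A pair of labelled permutations of odd order has four pairs of lifts. If it glues to `w`, exactly
-- two of them, exchanged by $(z,z)$, multiply to the canonical lift of `w`; the two signs cancel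
-- and the two terms cancel the factor $1/2$. Pairs not of odd order contribute $0$ on both sides.
open Classical in
theorem outer_can {n k m : ℕ} (h : n + k = m) {u : SpinWreath Γ n → ℂ} {f : SpinWreath Γ k → ℂ}
    (hu : u ∈ superClass Γ n) (hf : f ∈ superClass Γ k) {w : Wr Γ (Fin m)} (hw : OddOrder w.2) :
    outer h u f (SpinWreath.can w) = ∑ a : Wr Γ (Fin n), ∑ b : Wr Γ (Fin k),
      if Wr.map (SpinSym.blockEquiv h) (Wr.sum a b) = w then desc u a * desc f b else 0 := by
  rw [outer_eq, SpinWreath.sum_eq_sum_sec, Finset.mul_sum]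
  refine Finset.sum_congr rfl fun a _ => ?_
  rw [SpinWreath.sum_eq_sum_sec, SpinWreath.sum_eq_sum_sec, ← Finset.sum_add_distrib,
    Finset.mul_sum]
  refine Finset.sum_congr rfl fun b _ => ?_
  by_cases hab : OddOrder a.2 ∧ OddOrder b.2
  · obtain ⟨ha, hb⟩ := hab
    have hodd : OddOrder (Wr.map (SpinSym.blockEquiv h) (Wr.sum a b)).2 :=
      (Wr.oddOrder_map _).2 (Wr.oddOrder_sum.2 ⟨ha, hb⟩)
    rw [SpinWreath.sec_of_odd ha, SpinWreath.sec_of_odd hb, desc_of_odd u ha, desc_of_odd f hb]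
    simp only [SpinWreath.blockMul_z_left, SpinWreath.blockMul_z_right, hu.2.1, hf.2.1,
      SpinWreath.blockMul_can h ha hb]
    rw [← mul_assoc, SpinWreath.z_mul_z, one_mul]
    by_cases he : Wr.map (SpinSym.blockEquiv h) (Wr.sum a b) = w
    · simp only [he, SpinWreath.z_mul_ne, if_true, if_false]
      ring
    · have h1 : ¬SpinWreath.can (Wr.map (SpinSym.blockEquiv h) (Wr.sum a b)) =
          SpinWreath.can w := by
        intro h'
        have := congrArg SpinWreath.proj h'
        rw [SpinWreath.proj_can hodd, SpinWreath.proj_can hw] at this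
        exact he this
      have h2 : ¬SpinWreath.z m * SpinWreath.can (Wr.map (SpinSym.blockEquiv h) (Wr.sum a b)) =
          SpinWreath.can w := by
        intro h'
        have := congrArg SpinWreath.proj h'
        rw [SpinWreath.proj_z_mul, SpinWreath.proj_can hodd, SpinWreath.proj_can hw] at this
        exact he this
      simp only [he, h1, h2, if_false]
      ring
  · have h0 : u (SpinWreath.sec a) * f (SpinWreath.sec b) = 0 := by
      rw [not_and_or] at hab
      rcases hab with h' | h'
      · rw [superClass_eq_zero hu (by rwa [SpinWreath.proj_sec]), zero_mul]
      · rw [superClass_eq_zero hf (by rwa [SpinWreath.proj_sec]), mul_zero]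
    have h1 : desc u a * desc f b = 0 := by
      rw [not_and_or] at hab
      rcases hab with h' | h'
      · rw [desc_of_not u h', zero_mul]
      · rw [desc_of_not f h', mul_zero]
    simp only [hu.2.1, hf.2.1, h1, mul_neg, neg_mul, h0, neg_zero, ite_self, add_zero, mul_zero]

/-- At most one pair glues to `w`, namely its restrictions to the two blocks, and it exists exactly
when the first block is invariant. -/
theorem outer_can_eq_convTerm {n k m : ℕ} (h : n + k = m) {u : SpinWreath Γ n → ℂ}
    {f : SpinWreath Γ k → ℂ} (hu : u ∈ superClass Γ n) (hf : f ∈ superClass Γ k)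
    {w : Wr Γ (Fin m)} (hw : OddOrder w.2) :
    outer h u f (SpinWreath.can w) = convTerm (spread (desc u)) (spread (desc f))
      (fun i => ((SpinSym.blockEquiv h).symm i).isLeft = true) w := by
  classical
  rw [outer_can h hu hf hw]
  obtain ⟨w, rfl⟩ := (Wr.mapEquiv (SpinSym.blockEquiv h)).surjective w
  have hmap : ∀ w' : Wr Γ (Fin n ⊕ Fin k), Wr.mapEquiv (SpinSym.blockEquiv h) w' = Wr.map (SpinSym.blockEquiv h) w' :=
    fun w' => rfl
  rw [hmap, convTerm_map (p := fun x => x.isLeft = true) (natural_spread_desc hu)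
    (natural_spread_desc hf) _ (by simp)]
  simp only [← hmap, (Wr.mapEquiv (SpinSym.blockEquiv h)).injective.eq_iff]
  by_cases hp : Wr.Pres (fun x => x.isLeft = true) w
  · obtain ⟨a, b, rfl⟩ := Wr.exists_sum_of_pres hp
    rw [convTerm_sum (natural_spread_desc hu) (natural_spread_desc hf),
      spread_self (desc_map hu), spread_self (desc_map hf), Finset.sum_eq_single a,
      Finset.sum_eq_single b, if_pos rfl]
    · intro b' _ hb
      exact if_neg fun h' => hb (Wr.sum_injective h').2
    · simp
    · intro a' _ ha
      exact Finset.sum_eq_zero fun b' _ => if_neg fun h' => ha (Wr.sum_injective h').1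
    · simp
  · rw [convTerm, if_neg hp]
    refine Finset.sum_eq_zero fun a _ => Finset.sum_eq_zero fun b _ => if_neg ?_
    rintro rfl
    refine hp ?_
    rintro (x | x) <;> simp [Wr.sum]

/-- Induction of spin super class functions in terms of labelled permutations. -/
theorem desc_inducedProd {n k m : ℕ} (h : n + k = m) {u : SpinWreath Γ n → ℂ}
    {f : SpinWreath Γ k → ℂ} (hu : u ∈ superClass Γ n) (hf : f ∈ superClass Γ k)
    (w : Wr Γ (Fin m)) :
    desc (inducedProd h u f) w = conv (spread (desc u)) (spread (desc f)) (Fin m) w := by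
  classical
  -- A permutation not of odd order cannot have both restrictions of odd order, so every summand on
  -- the right vanishes, as the left side does.
  by_cases hw : OddOrder w.2
  swap
  · rw [desc_of_not _ hw, conv, Finset.sum_eq_zero]
    intro S _
    rw [convTerm]
    split_ifs with hp
    · rw [Wr.oddOrder_res hp, not_and_or] at hw
      rcases hw with hw | hw
      · rw [spread_desc_of_not u hw, zero_mul]
      · rw [spread_desc_of_not f hw, mul_zero]
    · rfl
  set Φ : Finset (Fin m) → ℂ :=
    fun S => convTerm (spread (desc u)) (spread (desc f)) (· ∈ S) w with hΦ
  -- After conjugation by `y`, the first block corresponds to the set of points which `y` carries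
  -- into it; gauge invariance makes the $\Gamma$-components of `y` irrelevant.
  have hterm : ∀ y : SpinWreath Γ m, outer h u f (y * SpinWreath.can w * y⁻¹) =
      Φ (Finset.univ.filter fun i =>
        ((SpinSym.blockEquiv h).symm (SpinSym.toPerm m y.right i)).isLeft) := by
    intro y
    rw [SpinWreath.can_conj hw, outer_can_eq_convTerm h hu hf (w := Wr.gauge _ (Wr.map _ w))
        ((Wr.oddOrder_map (SpinSym.toPerm m y.right)).2 hw),
      convTerm_gauge (fun _ => spread_desc_gauge hu) (fun _ => spread_desc_gauge hf)]
    exact convTerm_map (natural_spread_desc hu) (natural_spread_desc hf) _ (by simp) w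
  -- Each `S` of size $n$ arises from $2\,|\Gamma|^m\,n!\,k!$ elements `y`: two lifts, arbitrary
  -- labels, and $n!\,k!$ permutations carrying `S` to the first block. This number is also the
  -- order of the subgroup `range blockMul`, so the normalization of induction removes it.
  have hsum : ∑ y, outer h u f (y⁻¹ * SpinWreath.can w * y) =
      2 * ((Nat.card Γ : ℂ) ^ m * ((n.factorial * k.factorial : ℂ) * ∑ S, Φ S)) := by
    rw [← Equiv.sum_comp (Equiv.inv _)]
    simp only [Equiv.inv_apply, _root_.inv_inv, hterm]
    rw [SpinWreath.sum_eq_sum_sec]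
    have h1 : ∀ w' : Wr Γ (Fin m), SpinSym.toPerm m (SpinWreath.sec w').right = w'.2 :=
      fun w' => congrArg Prod.snd (SpinWreath.proj_sec w')
    have h2 : ∀ w' : Wr Γ (Fin m),
        SpinSym.toPerm m (SpinWreath.z m * SpinWreath.sec w').right = w'.2 := fun w' => by
      have := congrArg Prod.snd (SpinWreath.proj_z_mul (SpinWreath.sec w'))
      rw [SpinWreath.proj_sec] at this
      exact this
    simp only [h1, h2, ← two_mul]
    rw [← Finset.mul_sum, Fintype.sum_prod_type]
    rw [Finset.sum_congr rfl (g := fun _ => ∑ τ : Equiv.Perm (Fin m), Φ (Finset.univ.filter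
        fun i => ((SpinSym.blockEquiv h).symm (τ i)).isLeft)) (fun _ _ => rfl),
      Finset.sum_const, nsmul_eq_mul,
      ← sum_equiv_eq (by simp [h]) Φ, Finset.card_univ, Fintype.card_fun, Fintype.card_fin,
      Nat.card_eq_fintype_card]
    · push_cast
      congr 2
      refine Fintype.sum_equiv ((Equiv.inv (Equiv.Perm (Fin m))).trans
        (Equiv.equivCongr (SpinSym.blockEquiv h).symm (Equiv.refl _))) _ _ fun τ => ?_
      congr 2
    · intro S hS
      simp only [hΦ, convTerm]
      split_ifs
      · rw [spread_of_card_ne, zero_mul]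
        simpa using hS
      · rfl
  rw [desc_of_odd _ hw, inducedProd, hsum]
  have hc := card_range_blockMul (Γ := Γ) h
  rw [SpinWreath.card_eq, SpinWreath.card_eq] at hc
  have hΓ : (Nat.card Γ : ℂ) ≠ 0 := by exact_mod_cast Nat.card_pos.ne'
  have hn : (n.factorial : ℂ) ≠ 0 := by exact_mod_cast n.factorial_ne_zero
  have hk : (k.factorial : ℂ) ≠ 0 := by exact_mod_cast k.factorial_ne_zero
  have hc' : (Nat.card (Set.range (blockMul (Γ := Γ) h)) : ℂ) =
      2 * (n.factorial * k.factorial * (Nat.card Γ : ℂ) ^ m) := by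
    have hm : (Nat.card Γ : ℂ) ^ m = (Nat.card Γ : ℂ) ^ n * (Nat.card Γ : ℂ) ^ k := by
      rw [← pow_add, h]
    rw [hm]
    linear_combination hc / 2
  change _ = ∑ S, Φ S
  rw [hc']
  field_simp

/-- The unnormalized contraction of a function on labelled permutations. -/
def contr (u f : ∀ X : Type, Wr Γ X → ℂ) (Z : Type) [Fintype Z] [DecidableEq Z] (Y : Type)
    (w : Wr Γ Y) : ℂ :=
  ∑ v : Wr Γ Z, u Z v * f (Z ⊕ Y) (Wr.sum (Wr.inv v) w)

/-- Contraction of spin super class functions in terms of labelled permutations. -/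
theorem sum_mul_blockMul_can {n k m : ℕ} (h : n + k = m) {u : SpinWreath Γ n → ℂ}
    {f : SpinWreath Γ m → ℂ} (hu : u ∈ superClass Γ n) (hf : f ∈ superClass Γ m)
    {w : Wr Γ (Fin k)} (hw : OddOrder w.2) :
    ∑ x, u x * f (blockMul h (x⁻¹, SpinWreath.can w)) =
      2 * contr (spread (desc u)) (spread (desc f)) (Fin n) (Fin k) w := by
  rw [SpinWreath.sum_eq_sum_sec, contr, Finset.mul_sum]
  refine Finset.sum_congr rfl fun v _ => ?_
  rw [spread_self (desc_map hu), spread_eq (desc_map hf) (SpinSym.blockEquiv h)]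
  by_cases hv : OddOrder v.2
  · have hv' : OddOrder (Wr.inv v).2 := hv.inv
    have hz : (SpinWreath.z n : SpinWreath Γ n)⁻¹ = SpinWreath.z n :=
      inv_eq_of_mul_eq_one_left (SpinWreath.z_mul_z n)
    -- The lifts `x` and $zx$ contribute equally, because both factors of the summand change sign;
    -- hence the factor $2$.
    rw [SpinWreath.sec_of_odd hv, mul_inv_rev, hz, ← SpinWreath.z_comm,
      SpinWreath.blockMul_z_left, hu.2.1, hf.2.1, SpinWreath.can_inv hv,
      SpinWreath.blockMul_can h hv' hw, desc_of_odd u hv, desc_of_odd f]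
    · ring
    · exact (Wr.oddOrder_map _).2 (Wr.oddOrder_sum.2 ⟨hv', hw⟩)
  · rw [hu.2.1, superClass_eq_zero hu (by rwa [SpinWreath.proj_sec]), desc_of_not u hv]
    ring

theorem contr_eq_zero {n m : ℕ} (u : SpinWreath Γ n → ℂ) (f : SpinWreath Γ m → ℂ) {Y Z : Type}
    [Fintype Z] [DecidableEq Z] {w : Wr Γ Y} (hw : ¬OddOrder w.2) :
    contr (spread (desc u)) (spread (desc f)) Z Y w = 0 := by
  refine Finset.sum_eq_zero fun v _ => ?_
  rw [spread_desc_of_not f, mul_zero]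
  exact fun h => hw (Wr.oddOrder_sum.1 h).2

end SuperClass

/-! ### Cycle products and the multiplicative function `eta` -/

namespace Wr
variable {Γ : Type*} {X Y : Type*}

theorem pow_minimalPeriod (w : Wr Γ X) (i : X) : (w.2 ^ Function.minimalPeriod w.2 i) i = i := by
  have := Function.isPeriodicPt_minimalPeriod w.2 i
  rwa [Function.IsPeriodicPt, Function.IsFixedPt, ← Equiv.Perm.coe_pow] at this

theorem minimalPeriod_perm (σ : Equiv.Perm X) (i : X) :
    Function.minimalPeriod σ (σ i) = Function.minimalPeriod σ i := by
  have h : ∀ k, Function.IsPeriodicPt σ k (σ i) ↔ Function.IsPeriodicPt σ k i := by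
    intro k
    unfold Function.IsPeriodicPt Function.IsFixedPt
    rw [← Function.iterate_succ_apply, Function.iterate_succ_apply', σ.injective.eq_iff]
  refine Nat.dvd_antisymm ?_ ?_
  · exact Function.isPeriodicPt_iff_minimalPeriod_dvd.1
      ((h _).2 (Function.isPeriodicPt_minimalPeriod σ i))
  · exact Function.isPeriodicPt_iff_minimalPeriod_dvd.1
      ((h _).1 (Function.isPeriodicPt_minimalPeriod σ (σ i)))

theorem sameCycle_sum_inl {a : Wr Γ X} {b : Wr Γ Y} {i j : X} :
    (sum a b).2.SameCycle (Sum.inl i) (Sum.inl j) ↔ a.2.SameCycle i j := by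
  unfold Equiv.Perm.SameCycle
  refine exists_congr fun k => ?_
  have hk : (sum a b).2 ^ k = Equiv.sumCongr (a.2 ^ k) (b.2 ^ k) :=
    (map_zpow (Equiv.Perm.sumCongrHom X Y) (a.2, b.2) k).symm
  rw [hk]
  simp

theorem sameCycle_sum_inr {a : Wr Γ X} {b : Wr Γ Y} {i j : Y} :
    (sum a b).2.SameCycle (Sum.inr i) (Sum.inr j) ↔ b.2.SameCycle i j := by
  unfold Equiv.Perm.SameCycle
  refine exists_congr fun k => ?_
  have hk : (sum a b).2 ^ k = Equiv.sumCongr (a.2 ^ k) (b.2 ^ k) :=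
    (map_zpow (Equiv.Perm.sumCongrHom X Y) (a.2, b.2) k).symm
  rw [hk]
  simp

theorem not_sameCycle_sum {a : Wr Γ X} {b : Wr Γ Y} {i : X} {j : Y} :
    ¬(sum a b).2.SameCycle (Sum.inl i) (Sum.inr j) := by
  rintro ⟨k, hk⟩
  have hk' : (sum a b).2 ^ k = Equiv.sumCongr (a.2 ^ k) (b.2 ^ k) :=
    (map_zpow (Equiv.Perm.sumCongrHom X Y) (a.2, b.2) k).symm
  rw [hk'] at hk
  simp at hk

variable [Group Γ]

/-- The product of labels along the first `k` steps of the walk from `i`. -/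
def walk (w : Wr Γ X) : ℕ → X → Γ
  | 0, _ => 1
  | k + 1, i => w.1 ((w.2 ^ k) i) * walk w k i

theorem walk_succ (w : Wr Γ X) (k : ℕ) (i : X) :
    walk w (k + 1) i = w.1 ((w.2 ^ k) i) * walk w k i := rfl

theorem walk_succ' (w : Wr Γ X) (k : ℕ) (i : X) :
    walk w (k + 1) i = walk w k (w.2 i) * w.1 i := by
  induction k with
  | zero => simp [walk]
  | succ k ih => rw [walk_succ, ih, walk_succ w k (w.2 i), pow_succ, Equiv.Perm.mul_apply, mul_assoc]

/-- The product of labels along the cycle through `i`. -/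
def cyc (w : Wr Γ X) (i : X) : Γ := walk w (Function.minimalPeriod w.2 i) i

theorem cycleProd_eq_cyc {n : ℕ} (g : Fin n → Γ) (s : Equiv.Perm (Fin n)) (i : Fin n) :
    cycleProd g s i = cyc (g, s) i := by
  have : ∀ k, ((List.range k).reverse.map fun k => g ((s ^ k) i)).prod = walk (g, s) k i := by
    intro k
    induction k with
    | zero => rfl
    | succ k ih => rw [List.range_succ, List.reverse_append, walk_succ, ← ih]; simp
  exact this _

/-- Starting one step later moves the first label of the product to the other end, which is a
conjugation. So class functions do not see the starting point in a cycle. -/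
theorem cyc_apply (w : Wr Γ X) (i : X) : cyc w (w.2 i) = w.1 i * cyc w i * (w.1 i)⁻¹ := by
  rw [eq_mul_inv_iff_mul_eq, cyc, minimalPeriod_perm, ← walk_succ', walk_succ, pow_minimalPeriod,
    cyc]

theorem cyc_sameCycle {γ : Γ → ℂ} (hγ : γ ∈ classFun Γ) (w : Wr Γ X) {i j : X}
    (h : w.2.SameCycle i j) : γ (cyc w i) = γ (cyc w j) := by
  have h1 : ∀ i, γ (cyc w (w.2 i)) = γ (cyc w i) := fun i => by rw [cyc_apply, hγ]
  have h2 : ∀ (k : ℕ) i, γ (cyc w ((w.2 ^ k) i)) = γ (cyc w i) := by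
    intro k
    induction k with
    | zero => intro i; rfl
    | succ k ih => intro i; rw [pow_succ', Equiv.Perm.mul_apply, h1, ih]
  obtain ⟨k, rfl⟩ := h
  obtain ⟨k, rfl | rfl⟩ := k.eq_nat_or_neg
  · rw [zpow_natCast, h2]
  · rw [← h2 k ((w.2 ^ (-(k : ℤ))) i), zpow_neg, zpow_natCast]
    simp

theorem cyc_map (e : X ≃ Y) (w : Wr Γ X) (i : X) : cyc (map e w) (e i) = cyc w i := by
  have hpow : ∀ k, ((map e w).2 ^ k) (e i) = e ((w.2 ^ k) i) := by
    intro k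
    induction k with
    | zero => rfl
    | succ k ih =>
      rw [pow_succ', Equiv.Perm.mul_apply, ih, pow_succ', Equiv.Perm.mul_apply]
      simp [map]
  have hwalk : ∀ k, walk (map e w) k (e i) = walk w k i := by
    intro k
    induction k with
    | zero => rfl
    | succ k ih => rw [walk_succ, walk_succ, ih, hpow]; simp [map]
  have hper : Function.minimalPeriod (map e w).2 (e i) = Function.minimalPeriod w.2 i := by
    refine Function.minimalPeriod_eq_minimalPeriod_iff.2 fun k => ?_
    unfold Function.IsPeriodicPt Function.IsFixedPt
    rw [← Equiv.Perm.coe_pow, ← Equiv.Perm.coe_pow, hpow, e.injective.eq_iff]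
  rw [cyc, hper, hwalk, cyc]

theorem cyc_sum_inl (a : Wr Γ X) (b : Wr Γ Y) (i : X) : cyc (sum a b) (Sum.inl i) = cyc a i := by
  have hpow : ∀ k, ((sum a b).2 ^ k) (Sum.inl i) = Sum.inl ((a.2 ^ k) i) := by
    intro k
    induction k with
    | zero => rfl
    | succ k ih => rw [pow_succ', Equiv.Perm.mul_apply, ih, pow_succ', Equiv.Perm.mul_apply]; rfl
  have hwalk : ∀ k, walk (sum a b) k (Sum.inl i) = walk a k i := by
    intro k
    induction k with
    | zero => rfl
    | succ k ih => rw [walk_succ, walk_succ, ih, hpow]; rfl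
  have hper : Function.minimalPeriod (sum a b).2 (Sum.inl i) = Function.minimalPeriod a.2 i := by
    refine Function.minimalPeriod_eq_minimalPeriod_iff.2 fun k => ?_
    unfold Function.IsPeriodicPt Function.IsFixedPt
    rw [← Equiv.Perm.coe_pow, ← Equiv.Perm.coe_pow, hpow, Sum.inl_injective.eq_iff]
  rw [cyc, hper, hwalk, cyc]

theorem cyc_sum_inr (a : Wr Γ X) (b : Wr Γ Y) (i : Y) : cyc (sum a b) (Sum.inr i) = cyc b i := by
  have : sum a b = map (Equiv.sumComm Y X) (sum b a) := by
    refine Prod.ext ?_ ?_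
    · funext j; cases j <;> rfl
    · ext j; cases j <;> rfl
  rw [this, show (Sum.inr i : X ⊕ Y) = Equiv.sumComm Y X (Sum.inl i) from rfl, cyc_map,
    cyc_sum_inl]

/-- The gauge factors of consecutive labels telescope along the walk. -/
theorem cyc_gauge (h : X → Γ) (w : Wr Γ X) (i : X) :
    cyc (gauge h w) i = h (w.2⁻¹ i) * cyc w i * (h (w.2⁻¹ i))⁻¹ := by
  have hwalk : ∀ k, walk (gauge h w) k i = h (w.2⁻¹ ((w.2 ^ k) i)) * walk w k i *
      (h (w.2⁻¹ i))⁻¹ := by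
    intro k
    induction k with
    | zero => simp [walk]
    | succ k ih =>
      rw [walk_succ, walk_succ, ih, pow_succ', Equiv.Perm.mul_apply]
      simp [gauge, mul_assoc]
  have := hwalk (Function.minimalPeriod w.2 i)
  rw [pow_minimalPeriod] at this
  exact this

/-- The inverse permutation runs through the cycle backwards. Its label at $j$ is the inverse of the
original label at $\sigma j$, which, together with the reversal, shifts the starting point by two.
-/
theorem cyc_inv_apply (w : Wr Γ X) (i : X) :
    cyc (inv w) i = (cyc w (w.2 (w.2 i)))⁻¹ := by
  have hwalk : ∀ k i, walk (inv w) k ((w.2 ^ k) i) = (walk w k (w.2 (w.2 i)))⁻¹ := by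
    intro k
    induction k with
    | zero => intro i; simp [walk]
    | succ k ih =>
      intro i
      rw [walk_succ, walk_succ', mul_inv_rev, ← ih, pow_succ, Equiv.Perm.mul_apply]
      congr 1
      simp [inv]
  have hper : Function.minimalPeriod (inv w).2 i = Function.minimalPeriod w.2 i := by
    refine Function.minimalPeriod_eq_minimalPeriod_iff.2 fun k => ?_
    unfold Function.IsPeriodicPt Function.IsFixedPt
    rw [← Equiv.Perm.coe_pow, ← Equiv.Perm.coe_pow]
    change (w.2⁻¹ ^ k) i = i ↔ _
    rw [inv_pow, Equiv.Perm.inv_eq_iff_eq, eq_comm]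
  have := hwalk (Function.minimalPeriod w.2 i) i
  rw [pow_minimalPeriod] at this
  rw [cyc, hper, this, cyc, minimalPeriod_perm, minimalPeriod_perm]

/-- The product of the values of `γ` at all cycle products. -/
def eta (γ : Γ → ℂ) (X : Type) (w : Wr Γ X) : ℂ :=
  ∏ᶠ c : Quotient (Equiv.Perm.SameCycle.setoid w.2), γ (cyc w c.out)

theorem out_sameCycle {σ : Equiv.Perm X} (i : X) :
    σ.SameCycle (Quotient.out (s := Equiv.Perm.SameCycle.setoid σ) ⟦i⟧) i :=
  Quotient.exact (Quotient.out_eq (s := Equiv.Perm.SameCycle.setoid σ) ⟦i⟧)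

/-- For a class function any system of representatives of the cycles may be used; later arguments
choose whichever is convenient. -/
theorem eta_eq {γ : Γ → ℂ} (hγ : γ ∈ classFun Γ) {X : Type} (w : Wr Γ X) {ι : Type*} [Fintype ι]
    (r : ι → X) (h1 : ∀ i j, w.2.SameCycle (r i) (r j) → i = j)
    (h2 : ∀ x, ∃ i, w.2.SameCycle (r i) x) : eta γ X w = ∏ i, γ (cyc w (r i)) := by
  rw [eta, ← finprod_eq_prod_of_fintype]
  symm
  refine finprod_eq_of_bijective
    (fun i => (⟦r i⟧ : Quotient (Equiv.Perm.SameCycle.setoid w.2))) ⟨?_, ?_⟩ ?_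
  · intro i j h
    exact h1 i j (Quotient.exact h)
  · intro c
    induction c using Quotient.inductionOn with
    | h x => obtain ⟨i, hi⟩ := h2 x; exact ⟨i, Quotient.sound hi⟩
  · intro i
    exact (cyc_sameCycle hγ w (out_sameCycle (r i))).symm

theorem eta_eq_out {γ : Γ → ℂ} {X : Type} (w : Wr Γ X)
    [Fintype (Quotient (Equiv.Perm.SameCycle.setoid w.2))] :
    eta γ X w = ∏ c : Quotient (Equiv.Perm.SameCycle.setoid w.2), γ (cyc w c.out) := by
  rw [eta, finprod_eq_prod_of_fintype]

theorem out_unique {σ : Equiv.Perm X} {c d : Quotient (Equiv.Perm.SameCycle.setoid σ)}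
    (h : σ.SameCycle c.out d.out) : c = d := by
  rw [← Quotient.out_eq c, ← Quotient.out_eq d]
  exact Quotient.sound h

theorem eta_map {γ : Γ → ℂ} (hγ : γ ∈ classFun Γ) {X Y : Type} [Finite X] (e : X ≃ Y)
    (w : Wr Γ X) : eta γ Y (map e w) = eta γ X w := by
  have := Fintype.ofFinite (Quotient (Equiv.Perm.SameCycle.setoid w.2))
  have hs : ∀ i j, (map e w).2.SameCycle (e i) (e j) ↔ w.2.SameCycle i j := by
    intro i j
    have : (map e w).2.SameCycle (e i) (e j) ↔ w.2.SameCycle (e.symm (e i)) (e.symm (e j)) := by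
      unfold Equiv.Perm.SameCycle
      refine exists_congr fun k => ?_
      have hk : (map e w).2 ^ k = e.permCongr (w.2 ^ k) := (map_zpow e.permCongrHom w.2 k).symm
      rw [hk]
      simp
    simpa using this
  rw [eta_eq hγ (map e w) (fun c : Quotient (Equiv.Perm.SameCycle.setoid w.2) => e c.out), eta_eq_out]
  · simp only [cyc_map]
  · intro c d h
    exact out_unique ((hs _ _).1 h)
  · intro y
    obtain ⟨x, rfl⟩ := e.surjective y
    exact ⟨⟦x⟧, (hs _ _).2 (out_sameCycle x)⟩

theorem eta_sum {γ : Γ → ℂ} (hγ : γ ∈ classFun Γ) {X Y : Type} [Finite X] [Finite Y]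
    (a : Wr Γ X) (b : Wr Γ Y) : eta γ (X ⊕ Y) (sum a b) = eta γ X a * eta γ Y b := by
  have := Fintype.ofFinite (Quotient (Equiv.Perm.SameCycle.setoid a.2))
  have := Fintype.ofFinite (Quotient (Equiv.Perm.SameCycle.setoid b.2))
  rw [eta_eq hγ (sum a b) (Sum.elim (fun c : Quotient (Equiv.Perm.SameCycle.setoid a.2) =>
    Sum.inl c.out) fun c : Quotient (Equiv.Perm.SameCycle.setoid b.2) => Sum.inr c.out),
    Fintype.prod_sum_type, eta_eq_out, eta_eq_out]
  · simp only [Sum.elim_inl, Sum.elim_inr, cyc_sum_inl, cyc_sum_inr]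
  · rintro (c | c) (d | d) h
    · rw [out_unique (sameCycle_sum_inl.1 h)]
    · exact absurd h not_sameCycle_sum
    · exact absurd h.symm not_sameCycle_sum
    · rw [out_unique (sameCycle_sum_inr.1 h)]
  · rintro (x | x)
    · exact ⟨Sum.inl ⟦x⟧, sameCycle_sum_inl.2 (out_sameCycle x)⟩
    · exact ⟨Sum.inr ⟦x⟧, sameCycle_sum_inr.2 (out_sameCycle x)⟩

theorem eta_gauge {γ : Γ → ℂ} (hγ : γ ∈ classFun Γ) {X : Type} (g : X → Γ) (w : Wr Γ X) :
    eta γ X (gauge g w) = eta γ X w := by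
  unfold eta
  refine finprod_congr fun c => ?_
  rw [cyc_gauge, hγ]
  rfl

theorem eta_mul {X : Type} [Finite X] (α β : Γ → ℂ) (w : Wr Γ X) :
    eta (α * β) X w = eta α X w * eta β X w := by
  have := Fintype.ofFinite (Quotient (Equiv.Perm.SameCycle.setoid w.2))
  rw [eta_eq_out, eta_eq_out, eta_eq_out, ← Finset.prod_mul_distrib]
  rfl

theorem eta_inv {γ : Γ → ℂ} (hγ : γ ∈ classFun Γ) {X : Type} [Finite X] (w : Wr Γ X) :
    eta γ X (inv w) = eta (fun x => γ x⁻¹) X w := by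
  have := Fintype.ofFinite (Quotient (Equiv.Perm.SameCycle.setoid w.2))
  have hγ' : (fun x => γ x⁻¹) ∈ classFun Γ := fun x y => by
    change γ (y * x * y⁻¹)⁻¹ = γ x⁻¹
    rw [← hγ x⁻¹ y]
    congr 1
    group
  rw [eta_eq hγ (inv w) (fun c : Quotient (Equiv.Perm.SameCycle.setoid w.2) => c.out), eta_eq_out]
  · refine Finset.prod_congr rfl fun c _ => ?_
    rw [cyc_inv_apply]
    refine (cyc_sameCycle hγ' w ?_).symm
    exact ⟨2, rfl⟩
  · intro c d h
    exact out_unique (Equiv.Perm.sameCycle_inv.1 h)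
  · intro x
    exact ⟨⟦x⟧, Equiv.Perm.sameCycle_inv.2 (out_sameCycle x)⟩

end Wr

/-- The least elements of the cycles form a system of representatives. -/
theorem wreathChar_eq_eta {Γ : Type*} [Group Γ] {γ : Γ → ℂ} (hγ : γ ∈ classFun Γ) {n : ℕ}
    (x : SpinWreath Γ n) : wreathChar γ x = Wr.eta γ (Fin n) (SpinWreath.proj x) := by
  classical
  set s := SpinSym.toPerm n x.right with hs
  rw [Wr.eta_eq hγ (SpinWreath.proj x)
    (fun i : {i : Fin n // ∀ k : ℕ, i ≤ (s ^ k) i} => (i : Fin n))]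
  · rw [wreathChar, ← Finset.prod_subtype_eq_prod_filter]
    simp only [Wr.cycleProd_eq_cyc]
    rw [Finset.subtype_univ]
    rfl
  · rintro ⟨i, hi⟩ ⟨j, hj⟩ h
    refine Subtype.ext (le_antisymm ?_ ?_)
    · obtain ⟨k, hk⟩ := Equiv.Perm.SameCycle.exists_nat_pow_eq h
      exact (hi k).trans_eq hk
    · obtain ⟨k, hk⟩ := Equiv.Perm.SameCycle.exists_nat_pow_eq h.symm
      exact (hj k).trans_eq hk
  · intro i
    obtain ⟨j, hj, hmin⟩ := (Finset.univ.filter fun j => s.SameCycle j i).exists_minimal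
      ⟨i, by simpa using Equiv.Perm.SameCycle.refl s i⟩
    rw [Finset.mem_filter] at hj
    refine ⟨⟨j, fun k => ?_⟩, hj.2⟩
    refine le_of_not_gt fun hlt => ?_
    exact absurd (hmin (by simpa using hj.2) hlt.le) (not_le_of_gt hlt)

/-! ### Inserting a point, and cycle sums as binomial coefficients -/

namespace Wr
variable {Γ : Type*} {X : Type} [DecidableEq X]

/-- Insertion of a new point with label `c`, either as a fixed point or before a point `x`. -/
def ins (c : Γ) (i : Option X) (w : Wr Γ X) : Wr Γ (Option X) :=
  (fun o => o.elim c w.1, Equiv.Perm.decomposeOption.symm (i, w.2))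

theorem sign_ins_none [Fintype X] (c : Γ) (w : Wr Γ X) :
    Equiv.Perm.sign (ins c none w).2 = Equiv.Perm.sign w.2 :=
  Equiv.Perm.decomposeOption_symm_sign w.2

theorem sign_ins_some [Fintype X] (c : Γ) (x : X) (w : Wr Γ X) :
    Equiv.Perm.sign (ins c (some x) w).2 = -Equiv.Perm.sign w.2 := by
  simp [ins]

theorem ins_none_some (c : Γ) (w : Wr Γ X) (y : X) : (ins c none w).2 (some y) = some (w.2 y) := by
  simp [ins]

theorem ins_none_none (c : Γ) (w : Wr Γ X) : (ins c none w).2 none = none := by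
  simp [ins]

theorem ins_some_none (c : Γ) (x : X) (w : Wr Γ X) : (ins c (some x) w).2 none = some x := by
  simp [ins]

theorem ins_some_some (c : Γ) {x : X} (w : Wr Γ X) {y : X} (h : w.2 y ≠ x) :
    (ins c (some x) w).2 (some y) = some (w.2 y) := by
  simp only [ins, Equiv.Perm.decomposeOption_symm_apply, Equiv.Perm.mul_apply,
    Equiv.optionCongr_apply, Option.map_some]
  exact Equiv.swap_apply_of_ne_of_ne (by simp) (by simpa using h)

theorem ins_some_pre (c : Γ) {x : X} (w : Wr Γ X) {y : X} (h : w.2 y = x) :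
    (ins c (some x) w).2 (some y) = none := by
  simp [ins, h]

variable [Group Γ]

/-- Every labelled permutation of `Option X` arises from one of `X` by insertion of `none`. -/
def insEquiv : Γ × Option X × Wr Γ X ≃ Wr Γ (Option X) where
  toFun p := ins p.1 p.2.1 p.2.2
  invFun w := (w.1 none, (Equiv.Perm.decomposeOption w.2).1,
    (fun x => w.1 (some x), (Equiv.Perm.decomposeOption w.2).2))
  left_inv := by
    rintro ⟨c, i, g, σ⟩
    simp only [ins, Equiv.apply_symm_apply]
    rfl
  right_inv := by
    rintro ⟨g, σ⟩
    refine Prod.ext ?_ ?_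
    · funext o; cases o <;> rfl
    · simp only [ins, Prod.mk.eta, Equiv.symm_apply_apply]

theorem ins_none_eq_map (c : Γ) (w : Wr Γ X) : ins c none w =
    map ((Equiv.sumComm Unit X).trans (Equiv.optionEquivSumPUnit X).symm)
      (sum ((fun _ => c, 1) : Wr Γ Unit) w) := by
  refine Prod.ext ?_ ?_
  · funext o; cases o <;> rfl
  · refine Equiv.ext fun o => ?_
    cases o with
    | none => rw [ins_none_none]; rfl
    | some y => rw [ins_none_some]; rfl

theorem eta_ins_none {φ : Γ → ℂ} (hφ : φ ∈ classFun Γ) [Finite X] (c : Γ) (w : Wr Γ X) :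
    eta φ (Option X) (ins c none w) = φ c * eta φ X w := by
  rw [ins_none_eq_map, eta_map hφ, eta_sum hφ, eta_eq hφ _ (fun i : Unit => i), Fintype.prod_unique]
  · congr 2
    have h1 : Function.minimalPeriod (1 : Equiv.Perm Unit) default = 1 := by
      rw [Function.minimalPeriod_eq_one_iff_isFixedPt]; rfl
    rw [cyc, h1, walk_succ, walk, mul_one]
  · intro i j _; rfl
  · intro x; exact ⟨x, Equiv.Perm.SameCycle.refl _ _⟩

/-- The labelling obtained by contracting the point inserted before `x`. -/
def twist (c : Γ) (x : X) (w : Wr Γ X) : Wr Γ X :=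
  (fun y => (if w.2 y = x then c else 1) * w.1 y, w.2)

/-- The new point and the changed label both sit just before `x`, so a walk notices neither of them
until it reaches `x`. -/
theorem walk_ins (c : Γ) (x : X) (w : Wr Γ X) (y : X) (k : ℕ)
    (h : ∀ j, 0 < j → j ≤ k → (w.2 ^ j) y ≠ x) :
    ((ins c (some x) w).2 ^ k) (some y) = some ((w.2 ^ k) y) ∧
      walk (ins c (some x) w) k (some y) = walk (twist c x w) k y := by
  induction k with
  | zero => exact ⟨rfl, rfl⟩
  | succ k ih =>
    obtain ⟨h1, h2⟩ := ih fun j hj hk => h j hj (by omega)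
    have h3 : w.2 ((w.2 ^ k) y) ≠ x := by
      have := h (k + 1) (by omega) le_rfl
      rwa [pow_succ', Equiv.Perm.mul_apply] at this
    refine ⟨?_, ?_⟩
    · rw [pow_succ', Equiv.Perm.mul_apply, h1, ins_some_some c w h3, pow_succ',
        Equiv.Perm.mul_apply]
    · rw [walk_succ, walk_succ, h1, h2]
      change w.1 _ * _ = (if w.2 ((w.2 ^ k) y) = x then c else 1) * w.1 _ * _
      rw [if_neg h3, one_mul]
      rfl

theorem cyc_ins_of_not (c : Γ) (x : X) (w : Wr Γ X) (y : X) (h : ¬w.2.SameCycle y x) :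
    cyc (ins c (some x) w) (some y) = cyc (twist c x w) y := by
  have h' : ∀ k j, 0 < j → j ≤ k → (w.2 ^ j) y ≠ x := fun k j _ _ he =>
    h ⟨j, by rw [zpow_natCast, he]⟩
  have hper : Function.minimalPeriod (ins c (some x) w).2 (some y) =
      Function.minimalPeriod (twist c x w).2 y := by
    refine Function.minimalPeriod_eq_minimalPeriod_iff.2 fun k => ?_
    unfold Function.IsPeriodicPt Function.IsFixedPt
    rw [← Equiv.Perm.coe_pow, ← Equiv.Perm.coe_pow, (walk_ins c x w y k (h' k)).1,
      (Option.some_injective X).eq_iff]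
    rfl
  rw [cyc, cyc, hper, (walk_ins c x w y _ (h' _)).2]

/-- The cycle through `x` becomes one step longer and passes the new point last, collecting `c`. In
`twist` the same factor `c` has been merged into the label of the predecessor of `x`. -/
theorem cyc_ins_self [Finite X] (c : Γ) (x : X) (w : Wr Γ X) :
    cyc (ins c (some x) w) (some x) = cyc (twist c x w) x := by
  set m := Function.minimalPeriod w.2 x with hm
  have hpos : 0 < m := Function.minimalPeriod_pos_of_mem_periodicPts
    (isOfFinOrder_of_finite w.2 |> fun h => ⟨orderOf w.2, h.orderOf_pos, by
      rw [Function.IsPeriodicPt, Function.IsFixedPt, ← Equiv.Perm.coe_pow, pow_orderOf_eq_one]; rfl⟩)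
  obtain ⟨k, hk⟩ : ∃ k, m = k + 1 := ⟨m - 1, by omega⟩
  have hne : ∀ j, 0 < j → j ≤ k → (w.2 ^ j) x ≠ x := by
    intro j hj hjk he
    refine Function.not_isPeriodicPt_of_pos_of_lt_minimalPeriod hj.ne'
      (show j < Function.minimalPeriod w.2 x by omega) ?_
    rwa [Function.IsPeriodicPt, Function.IsFixedPt, ← Equiv.Perm.coe_pow]
  have hx : (w.2 ^ (k + 1)) x = x := by rw [← hk]; exact pow_minimalPeriod w x
  have hx' : w.2 ((w.2 ^ k) x) = x := by rwa [pow_succ', Equiv.Perm.mul_apply] at hx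
  obtain ⟨h1, h2⟩ := walk_ins c x w x k hne
  have h3 : ((ins c (some x) w).2 ^ (k + 1)) (some x) = none := by
    rw [pow_succ', Equiv.Perm.mul_apply, h1, ins_some_pre c w hx']
  have h4 : ((ins c (some x) w).2 ^ (k + 2)) (some x) = some x := by
    rw [pow_succ', Equiv.Perm.mul_apply, h3, ins_some_none]
  have hper : Function.minimalPeriod (ins c (some x) w).2 (some x) = k + 2 := by
    have hp : Function.IsPeriodicPt (ins c (some x) w).2 (k + 2) (some x) := by
      rwa [Function.IsPeriodicPt, Function.IsFixedPt, ← Equiv.Perm.coe_pow]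
    refine le_antisymm (hp.minimalPeriod_le (by omega)) ?_
    by_contra! hlt
    have hp2 := Function.isPeriodicPt_minimalPeriod (ins c (some x) w).2 (some x)
    have hpos2 := hp.minimalPeriod_pos (by omega)
    set j := Function.minimalPeriod (ins c (some x) w).2 (some x)
    rw [Function.IsPeriodicPt, Function.IsFixedPt, ← Equiv.Perm.coe_pow] at hp2
    rcases Nat.lt_or_ge k j with hj | hj
    · rw [show j = k + 1 by omega, h3] at hp2
      exact absurd hp2 (by simp)
    · rw [(walk_ins c x w x j fun i hi hij => hne i hi (by omega)).1] at hp2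
      exact hne j hpos2 hj (Option.some_injective X hp2)
  rw [cyc, hper, walk_succ, walk_succ, h3, h1, h2, cyc]
  change _ = walk (twist c x w) m x
  rw [hk, walk_succ]
  change c * (w.1 _ * _) = (if w.2 ((w.2 ^ k) x) = x then c else 1) * w.1 _ * _
  rw [if_pos hx', mul_assoc]
  rfl

theorem sameCycle_ins [Finite X] (c : Γ) (x : X) (w : Wr Γ X) {y y' : X} :
    (ins c (some x) w).2.SameCycle (some y) (some y') ↔ w.2.SameCycle y y' := by
  have hstep : ∀ y, (ins c (some x) w).2.SameCycle (some y) (some (w.2 y)) := by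
    intro y
    by_cases h : w.2 y = x
    · refine ⟨2, ?_⟩
      rw [zpow_ofNat, sq, Equiv.Perm.mul_apply, ins_some_pre c w h, ins_some_none, h]
    · exact ⟨1, by rw [zpow_one, ins_some_some c w h]⟩
  -- `q` identifies the new point with `x` and is constant along the enlarged permutation, so
  -- insertion does not join different cycles.
  let q : Option X → Quotient (Equiv.Perm.SameCycle.setoid w.2) :=
    fun o => o.elim ⟦x⟧ fun y => ⟦y⟧
  have hq : ∀ o, q ((ins c (some x) w).2 o) = q o := by
    rintro (_ | y)
    · rw [ins_some_none]; rfl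
    · by_cases h : w.2 y = x
      · rw [ins_some_pre c w h]
        exact Quotient.sound ⟨-1, by rw [zpow_neg_one, Equiv.Perm.inv_eq_iff_eq, h]⟩
      · rw [ins_some_some c w h]
        exact Quotient.sound ⟨-1, by rw [zpow_neg_one, Equiv.Perm.inv_eq_iff_eq]⟩
  have hqpow : ∀ (k : ℕ) o, q (((ins c (some x) w).2 ^ k) o) = q o := by
    intro k
    induction k with
    | zero => intro o; rfl
    | succ k ih => intro o; rw [pow_succ', Equiv.Perm.mul_apply, hq, ih]
  constructor
  · intro h
    obtain ⟨k, hk⟩ := h.exists_nat_pow_eq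
    have := hqpow k (some y)
    rw [hk] at this
    exact (Quotient.exact this).symm
  · intro h
    obtain ⟨k, rfl⟩ := h.exists_nat_pow_eq
    induction k with
    | zero => exact Equiv.Perm.SameCycle.refl _ _
    | succ k ih =>
      rw [pow_succ', Equiv.Perm.mul_apply]
      exact (ih ⟨k, by rw [zpow_natCast]⟩).trans (hstep _)

theorem eta_ins_some {φ : Γ → ℂ} (hφ : φ ∈ classFun Γ) [Finite X] (c : Γ) (x : X) (w : Wr Γ X) :
    eta φ (Option X) (ins c (some x) w) = eta φ X (twist c x w) := by
  classical
  have := Fintype.ofFinite (Quotient (Equiv.Perm.SameCycle.setoid w.2))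
  -- The cycle of `x` is represented by `x` itself, the only point at which its two cycle products
  -- have been compared.
  let r : Quotient (Equiv.Perm.SameCycle.setoid w.2) → X := fun d => if d = ⟦x⟧ then x else d.out
  have hr : ∀ d, ⟦r d⟧ = d := by
    intro d
    simp only [r]
    split_ifs with h
    · exact h.symm
    · exact Quotient.out_eq d
  rw [eta_eq hφ (ins c (some x) w) (fun d => some (r d)), eta_eq hφ (twist c x w) r]
  · refine Finset.prod_congr rfl fun d _ => ?_
    congr 1
    by_cases h : d = ⟦x⟧
    · have hx : r d = x := if_pos h
      rw [hx, cyc_ins_self]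
    · refine cyc_ins_of_not c x w _ fun h' => h ?_
      rw [← hr d]
      exact Quotient.sound h'
  · intro d d' h
    rw [← hr d, ← hr d']
    exact Quotient.sound h
  · intro y
    exact ⟨⟦y⟧, Quotient.exact (hr _)⟩
  · intro d d' h
    rw [← hr d, ← hr d']
    exact Quotient.sound ((sameCycle_ins c x w).1 h)
  · rintro (_ | y)
    · refine ⟨⟦x⟧, ?_⟩
      refine ((sameCycle_ins c x w).2 (Quotient.exact (hr ⟦x⟧))).trans ?_
      exact ⟨-1, by rw [zpow_neg_one, Equiv.Perm.inv_eq_iff_eq, ins_some_none]⟩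
    · exact ⟨⟦y⟧, (sameCycle_ins c x w).2 (Quotient.exact (hr ⟦y⟧))⟩

/-- The sum of `χ (sign w) η_φ(w)` over all labelled permutations. -/
def zsum [Fintype Γ] (χ : ℤˣ → ℂ) (φ : Γ → ℂ) (X : Type) [Fintype X] [DecidableEq X] : ℂ :=
  ∑ w : Wr Γ X, χ (Equiv.Perm.sign w.2) * eta φ X w

theorem zsum_congr [Fintype Γ] (χ : ℤˣ → ℂ) {φ : Γ → ℂ} (hφ : φ ∈ classFun Γ) {Y : Type}
    [Fintype X] [Fintype Y] [DecidableEq Y] (e : X ≃ Y) : zsum χ φ X = zsum χ φ Y := by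
  refine Fintype.sum_equiv (mapEquiv e) _ _ fun w => ?_
  change _ = χ (Equiv.Perm.sign (e.permCongr w.2)) * eta φ Y (map e w)
  rw [eta_map hφ, Equiv.Perm.sign_permCongr]

/-- Left multiplication of the label of the predecessor of `x`. -/
def twistEquiv (c : Γ) (x : X) : Wr Γ X ≃ Wr Γ X where
  toFun := twist c x
  invFun := twist c⁻¹ x
  left_inv w := by
    refine Prod.ext ?_ rfl
    funext y
    change (if w.2 y = x then c⁻¹ else 1) * ((if w.2 y = x then c else 1) * w.1 y) = w.1 y
    split_ifs <;> simp
  right_inv w := by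
    refine Prod.ext ?_ rfl
    funext y
    change (if w.2 y = x then c else 1) * ((if w.2 y = x then c⁻¹ else 1) * w.1 y) = w.1 y
    split_ifs <;> simp

/-- A new point is either fixed, contributing its own factor $\varphi(c)$, or inserted before one of
the points of `X`. The latter flips the sign of the permutation and leaves the number of cycles
unchanged; the label `c` disappears after the change of variables `twistEquiv`. -/
theorem zsum_option [Fintype Γ] (χ : ℤˣ →* ℂ) {φ : Γ → ℂ} (hφ : φ ∈ classFun Γ) [Fintype X] :
    zsum χ φ (Option X) =
      (∑ c, φ c + χ (-1) * (Fintype.card Γ * Fintype.card X)) * zsum χ φ X := by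
  rw [zsum, ← Equiv.sum_comp insEquiv, Fintype.sum_prod_type]
  have h : ∀ c : Γ, ∑ p : Option X × Wr Γ X, (χ (Equiv.Perm.sign (insEquiv (c, p)).2) *
      eta φ (Option X) (insEquiv (c, p))) =
      (φ c + χ (-1) * Fintype.card X) * zsum χ φ X := by
    intro c
    rw [Fintype.sum_prod_type, Fintype.sum_option, add_mul]
    congr 1
    · rw [zsum, Finset.mul_sum]
      refine Finset.sum_congr rfl fun w _ => ?_
      change χ (Equiv.Perm.sign (ins c none w).2) * eta φ _ (ins c none w) = _
      rw [sign_ins_none, eta_ins_none hφ]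
      ring
    · rw [Finset.sum_congr rfl (g := fun _ => χ (-1) * zsum χ φ X), Finset.sum_const,
        nsmul_eq_mul, Finset.card_univ]
      · ring
      · intro x _
        rw [zsum, ← Equiv.sum_comp (twistEquiv c x)
          (fun w => χ (Equiv.Perm.sign w.2) * eta φ X w), Finset.mul_sum]
        refine Finset.sum_congr rfl fun w _ => ?_
        change χ (Equiv.Perm.sign (ins c (some x) w).2) * eta φ _ (ins c (some x) w) =
          χ (-1) * (χ (Equiv.Perm.sign w.2) * eta φ X (twist c x w))
        rw [sign_ins_some, eta_ins_some hφ, ← mul_assoc, ← map_mul, neg_one_mul]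
  simp only [h]
  rw [← Finset.sum_mul, Finset.sum_add_distrib, Finset.sum_const, nsmul_eq_mul, Finset.card_univ]
  ring

theorem succ_mul_choose (b : ℂ) (n : ℕ) :
    ((n : ℂ) + 1) * Ring.choose b (n + 1) = (b - n) * Ring.choose b n := by
  have h := Ring.descPochhammer_eq_factorial_smul_choose b (n + 1)
  have h' := Ring.descPochhammer_eq_factorial_smul_choose b n
  rw [descPochhammer_succ_right, Polynomial.smeval_mul, h'] at h
  simp only [Polynomial.smeval_sub, Polynomial.smeval_X, pow_one, Polynomial.smeval_natCast,
    pow_zero, nsmul_eq_mul, Nat.factorial_succ, mul_one] at h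
  have hn : (n.factorial : ℂ) ≠ 0 := by exact_mod_cast n.factorial_ne_zero
  apply mul_left_cancel₀ hn
  push_cast at h
  linear_combination -h

/-- The cycle sums are binomial coefficients. -/
theorem zsum_eq [Fintype Γ] (χ : ℤˣ →* ℂ) {φ : Γ → ℂ} (hφ : φ ∈ classFun Γ) {a : ℂ}
    (ha : ∑ c, φ c = Fintype.card Γ * a) [Fintype X] :
    zsum χ φ X = (Fintype.card Γ : ℂ) ^ Fintype.card X * (Fintype.card X).factorial *
      ((-χ (-1)) ^ Fintype.card X * Ring.choose (-χ (-1) * a) (Fintype.card X)) := by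
  -- Put $c=\chi(-1)=\pm1$. Adding a point to `n` points multiplies the sum by $|\Gamma|(a+cn)$,
  -- which equals $|\Gamma|(-c)(-ca-n)$ because $c^2=1$; this is the recursion of
  -- $(-c)^n\binom{-ca}n$.
  have hc : χ (-1) * χ (-1) = 1 := by rw [← map_mul]; simp
  have key : ∀ n, zsum χ φ (Fin n) = (Fintype.card Γ : ℂ) ^ n * n.factorial *
      ((-χ (-1)) ^ n * Ring.choose (-χ (-1) * a) n) := by
    intro n
    induction n with
    | zero =>
      rw [zsum, Fintype.sum_subsingleton _ ((fun i => i.elim0, 1) : Wr Γ (Fin 0)),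
        eta_eq hφ _ (fun i : Fin 0 => i)]
      · simp
      · intro i; exact i.elim0
      · intro i; exact i.elim0
    | succ n ih =>
      rw [zsum_congr χ hφ (finSuccEquiv n), zsum_option χ hφ, ih, ha, Fintype.card_fin,
        Nat.factorial_succ]
      push_cast
      have h := succ_mul_choose (-χ (-1) * a) n
      generalize χ (-1) = c at *
      rw [show (Fintype.card Γ : ℂ) ^ (n + 1) * ((n + 1) * n.factorial) *
        ((-c) ^ (n + 1) * Ring.choose (-c * a) (n + 1)) =
        (Fintype.card Γ : ℂ) ^ (n + 1) * n.factorial * (-c) ^ (n + 1) *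
          ((n + 1) * Ring.choose (-c * a) (n + 1)) by ring, h]
      linear_combination (-(Fintype.card Γ : ℂ) ^ (n + 1) * n.factorial * (-c) ^ n * a *
        Ring.choose (-c * a) n) * hc
  rw [zsum_congr χ hφ (Fintype.equivFin X), key]

end Wr

/-! ### Pfaffian recursion -/

section Pfaffian

variable {ι κ A A' : Type*} [AddCommGroup A] [Module ℂ A] [AddCommGroup A'] [Module ℂ A']

/-- The alternating sum of `g (L s) • F (L without L s)` over the positions `s` of `L`. -/
def contraction (g : ι → ℂ) : List ι → (List ι → A) → A
  | [], _ => 0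
  | j :: L, F => g j • F L - contraction g L fun L' => F (j :: L')

theorem map_contraction (φ : A →ₗ[ℂ] A') (g : ι → ℂ) (L : List ι) (F : List ι → A) :
    φ (contraction g L F) = contraction g L fun L' => φ (F L') := by
  induction L generalizing F with
  | nil => simp [contraction]
  | cons j L ih => simp [contraction, ih]

theorem contraction_congr {g : ι → ℂ} {L : List ι} {F F' : List ι → A}
    (h : ∀ L', L'.Sublist L → L'.length + 1 = L.length → F L' = F' L') :
    contraction g L F = contraction g L F' := by
  induction L generalizing F F' with
  | nil => rfl
  | cons j L ih =>
    rw [contraction, contraction, h L (List.sublist_cons_self j L) (by simp),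
      ih fun L' hL' hl => h _ (hL'.cons_cons j) (by simp [← hl])]

theorem contraction_map (g : κ → ℂ) (f : ι → κ) (L : List ι) (F : List κ → A) :
    contraction g (L.map f) F = contraction (fun i => g (f i)) L fun L' => F (L'.map f) := by
  induction L generalizing F with
  | nil => rfl
  | cons j L ih => simp [contraction, ih]

theorem contraction_eq_zero {g : ι → ℂ} {L : List ι} (h : ∀ j ∈ L, g j = 0) (F : List ι → A) :
    contraction g L F = 0 := by
  induction L generalizing F with
  | nil => rfl
  | cons j L ih =>
    rw [contraction, h j (by simp), zero_smul, ih fun i hi => h i (by simp [hi]), sub_zero]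

theorem contraction_append {g : ι → ℂ} (L₁ : List ι) {L₂ : List ι} (h : ∀ j ∈ L₂, g j = 0)
    (F : List ι → A) :
    contraction g (L₁ ++ L₂) F = contraction g L₁ fun L => F (L ++ L₂) := by
  induction L₁ generalizing F with
  | nil => exact contraction_eq_zero h F
  | cons j L ih => simp [contraction, ih]

/-- A function on words satisfying the recursion of a Pfaffian with matrix `G / 2`. -/
structure IsPfaffian (G : ι → ι → ℂ) (F : List ι → ℂ) : Prop where
  nil : F [] = 1
  cons : ∀ i L, F (i :: L) = 1 / 2 * contraction (G i) L F

namespace IsPfaffian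

/-- The recursion determines the function from its matrix, by induction on the length of the word.
-/
theorem map_eq {G : ι → ι → ℂ} {F : List ι → ℂ} (hF : IsPfaffian G F) {G' : κ → κ → ℂ}
    {F' : List κ → ℂ} (hF' : IsPfaffian G' F') {f : ι → κ} (h : ∀ i j, G' (f i) (f j) = G i j)
    (L : List ι) : F' (L.map f) = F L := by
  induction hn : L.length using Nat.strong_induction_on generalizing L with
  | _ n ih =>
    cases L with
    | nil => rw [List.map_nil, hF.nil, hF'.nil]
    | cons i L =>
      rw [List.map_cons, hF.cons, hF'.cons, contraction_map]
      simp only [h]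
      congr 1
      refine contraction_congr fun L' _ hl => ih L'.length ?_ L' rfl
      rw [List.length_cons] at hn
      omega

/-- No contraction pairs a letter of the first word with one of the second, so the recursion never
touches the second word until the first is used up. -/
theorem append {G : ι → ι → ℂ} {F : List ι → ℂ} (hF : IsPfaffian G F) (L₁ L₂ : List ι)
    (h : ∀ i ∈ L₁, ∀ j ∈ L₂, G i j = 0) : F (L₁ ++ L₂) = F L₁ * F L₂ := by
  induction hn : L₁.length using Nat.strong_induction_on generalizing L₁ with
  | _ n ih =>
    cases L₁ with
    | nil => rw [List.nil_append, hF.nil, one_mul]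
    | cons i L =>
      rw [List.cons_append, hF.cons, hF.cons, contraction_append L (h i (by simp)), mul_assoc]
      congr 1
      have := map_contraction (LinearMap.mulRight ℂ (F L₂)) (G i) L F
      rw [LinearMap.mulRight_apply] at this
      rw [this]
      refine contraction_congr fun L' hs hl => ih L'.length ?_ L' ?_ rfl
      · rw [List.length_cons] at hn
        omega
      · exact fun i hi => h i (List.mem_cons_of_mem _ (hs.subset hi))

end IsPfaffian

/-- `M i` is carried through the word by anticommutation. Passing each letter leaves one contraction
term, and arriving on the right costs the sign $(-1)^{\text{length}}$; the trace of this identity is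
the Pfaffian recursion. -/
theorem mul_word_eq {R : Type*} [Ring R] [Algebra ℂ R] {M : ι → R} {G : ι → ι → ℂ}
    (hM : ∀ i j, M i * M j + M j * M i = G i j • (1 : R)) (i : ι) (L : List ι) :
    M i * (L.map M).prod = contraction (G i) L (fun L' => (L'.map M).prod) +
      (-1 : ℂ) ^ L.length • ((L.map M).prod * M i) := by
  induction L with
  | nil => simp [contraction]
  | cons j L ih =>
    have h1 : M i * M j = G i j • (1 : R) - M j * M i := eq_sub_of_add_eq (hM i j)
    have h2 := map_contraction (LinearMap.mulLeft ℂ (M j)) (G i) L fun L' => (L'.map M).prod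
    simp only [LinearMap.mulLeft_apply] at h2
    simp only [contraction, List.map_cons, List.prod_cons, List.length_cons]
    rw [← mul_assoc, h1, sub_mul, mul_assoc, ih, mul_add, h2, smul_mul_assoc, one_mul, pow_succ,
      mul_neg_one, neg_smul, mul_smul_comm, mul_assoc]
    abel

end Pfaffian

/-! ### The basic spin character -/

/-- The values of the anticommutators of the operators `basicGen`. -/
def gram (i j : ℕ) : ℂ := if i = j then -2 else if i = j + 1 ∨ j = i + 1 then 1 else 0

theorem basicGen_add {k i : ℕ} (hi : (i + 1) / 2 < k) :
    basicGen k i * basicGen k (i + 1) + basicGen k (i + 1) * basicGen k i = 1 := by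
  have h := basicGen_anticomm (show i / 2 < k by omega) hi
  have c : (Real.sqrt ((i + 2) / (2 * (i + 1))) *
      Real.sqrt ((i + 1 : ℕ) / (2 * ((i + 1 : ℕ) + 1))) : ℂ) = 1 / 2 := by
    rw [← Complex.ofReal_mul, ← Real.sqrt_mul (by positivity),
      show ((i : ℝ) + 2) / (2 * (i + 1)) * (((i + 1 : ℕ) : ℝ) / (2 * ((i + 1 : ℕ) + 1))) =
        (1 / 2) ^ 2 by push_cast; field_simp; ring,
      Real.sqrt_sq (by norm_num)]
    norm_num
  rw [if_neg (by omega), if_pos (by omega), if_neg (by omega), c] at h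
  rw [h]
  rcases Nat.eq_zero_or_pos i with rfl | hpos
  · simp
  · rw [if_neg (by omega)]; simp

theorem basicGen_gram {k i j : ℕ} (hi : i / 2 < k) (hj : j / 2 < k) :
    basicGen k i * basicGen k j + basicGen k j * basicGen k i = gram i j • 1 := by
  unfold gram
  by_cases h0 : i = j
  · subst h0
    rw [if_pos rfl, basicGen_sq hi, neg_smul, two_smul]; abel
  rw [if_neg h0]
  by_cases h1 : i = j + 1
  · subst h1
    rw [if_pos (Or.inl rfl), add_comm, basicGen_add hi, one_smul]
  by_cases h2 : j = i + 1
  · subst h2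
    rw [if_pos (Or.inr rfl), basicGen_add hj, one_smul]
  rw [if_neg (by tauto), zero_smul]
  rcases lt_or_gt_of_ne h0 with h | h
  · rw [basicGen_far hj (by omega)]; abel
  · rw [basicGen_far hi (by omega)]; abel

namespace SpinSym

/-- The product of the generators listed in `L`. -/
def word {n : ℕ} (L : List (Fin (n - 1))) : SpinSym n := (L.map t).prod

theorem word_append {n : ℕ} (L L' : List (Fin (n - 1))) : word (L ++ L') = word L * word L' := by
  simp [word]

theorem parity_word {n : ℕ} (L : List (Fin (n - 1))) :
    parity n (word L) = (-1) ^ L.length := by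
  induction L with
  | nil => simp [word]
  | cons i L ih =>
    rw [word, List.map_cons, List.prod_cons, map_mul, parity_t, ← word, ih, List.length_cons,
      pow_succ, mul_comm]

theorem basicSpin_word {n : ℕ} (L : List (Fin (n - 1))) :
    (basicSpin n (word L)).val = (L.map fun i : Fin (n - 1) => basicGen (n / 2) i).prod := by
  induction L with
  | nil => simp [word]
  | cons i L ih =>
    have ht : basicSpin n (t i) = basicUnit n i := lift_t _ i
    rw [word, List.map_cons, List.prod_cons, map_mul, Units.val_mul, ht, ← word, ih]
    rfl

theorem basicSpin_z (n : ℕ) : basicSpin n (z n) = -1 := lift_z _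

/-- Since $t_i^{-1}=zt_i$ and $z$ is central, inverses can be avoided at the price of one factor
$z$. -/
theorem exists_word {n : ℕ} (x : SpinSym n) : ∃ L, x = word L ∨ x = z n * word L := by
  have hmul : ∀ x y : SpinSym n, (∃ L, x = word L ∨ x = z n * word L) →
      (∃ L, y = word L ∨ y = z n * word L) → ∃ L, x * y = word L ∨ x * y = z n * word L := by
    rintro _ _ ⟨L, rfl | rfl⟩ ⟨L', rfl | rfl⟩ <;> refine ⟨L ++ L', ?_⟩ <;> rw [word_append]
    · exact Or.inl rfl
    · right; rw [← mul_assoc, ← z_comm, mul_assoc]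
    · right; rw [mul_assoc]
    · left; rw [mul_assoc, ← mul_assoc (word L), ← z_comm, ← mul_assoc, ← mul_assoc, z_mul_z,
        one_mul]
  have ht : ∀ i : Fin (n - 1), ∃ L, (t i)⁻¹ = word L ∨ (t i)⁻¹ = z n * word L := by
    intro i
    refine ⟨[i], Or.inr ?_⟩
    rw [inv_eq_iff_mul_eq_one]
    simp only [word, List.map_cons, List.map_nil, List.prod_cons, List.prod_nil, mul_one]
    rw [← mul_assoc, ← z_comm, mul_assoc, ← sq (t i), (relations n).t_sq, z_mul_z]
  have hx : x ∈ Subgroup.closure (insert (z n) (Set.range (t (n := n)))) :=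
    closure_induction _ (Subgroup.subset_closure (Set.mem_insert _ _))
      (fun i => Subgroup.subset_closure (Set.mem_insert_of_mem _ (Set.mem_range_self i))) x
  induction hx using Subgroup.closure_induction_right with
  | one => exact ⟨[], Or.inl rfl⟩
  | mul_right x _ y hy ih =>
    refine hmul x y ih ?_
    rcases hy with rfl | ⟨i, rfl⟩
    · exact ⟨[], Or.inr (by simp [word])⟩
    · exact ⟨[i], Or.inl (by simp [word])⟩
  | mul_inv_cancel x _ y hy ih =>
    refine hmul x _ ih ?_
    rcases hy with rfl | ⟨i, rfl⟩
    · exact ⟨[], Or.inr (by rw [inv_eq_of_mul_eq_one_left (z_mul_z n)]; simp [word])⟩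
    · exact ht i

/-- The character of the basic spin representation divided by the dimension. -/
def normTrace (n : ℕ) (x : SpinSym n) : ℂ := (2 ^ (n / 2) : ℂ)⁻¹ * basicChar n x

theorem basicChar_z_mul {n : ℕ} (x : SpinSym n) : basicChar n (z n * x) = -basicChar n x := by
  simp [basicChar, basicSpin_z]

theorem normTrace_z_mul {n : ℕ} (x : SpinSym n) : normTrace n (z n * x) = -normTrace n x := by
  rw [normTrace, basicChar_z_mul, mul_neg, normTrace]

theorem basicChar_conj {n : ℕ} (x y : SpinSym n) : basicChar n (y * x * y⁻¹) = basicChar n x := by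
  simp only [basicChar, map_mul, map_inv, Units.val_mul]
  rw [Matrix.trace_mul_comm, ← mul_assoc, Units.inv_mul, one_mul]

/-- For a word `L` of odd length, cyclicity of the trace turns the last term of `mul_word_eq` into
minus the left side, whence the factor $1/2$. For even length all traces involved belong to odd
elements and vanish. -/
theorem isPfaffian_normTrace (n : ℕ) :
    IsPfaffian (fun i j : Fin (n - 1) => gram i j) fun L => normTrace n (word L) where
  nil := by
    have : word [] = (1 : SpinSym n) := rfl
    simp only [normTrace, this, basicChar, map_one, Units.val_one, Matrix.trace_one]
    simp
  cons i L := by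
    have hG : ∀ i j : Fin (n - 1), basicGen (n / 2) i * basicGen (n / 2) j +
        basicGen (n / 2) j * basicGen (n / 2) i = gram i j • 1 :=
      fun i j => basicGen_gram (by omega) (by omega)
    have h := mul_word_eq (M := fun i : Fin (n - 1) => basicGen (n / 2) i) hG i L
    rcases Nat.even_or_odd L.length with he | ho
    · have hodd : ∀ L : List (Fin (n - 1)), Odd L.length → normTrace n (word L) = 0 := by
        intro L hL
        rw [normTrace, basicChar_odd (by rw [parity_word, hL.neg_one_pow]), mul_zero]
      rw [hodd _ (by simpa using he.add_one)]
      rw [contraction_congr (F' := fun _ => 0)]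
      · have := map_contraction (0 : ℂ →ₗ[ℂ] ℂ) (fun j : Fin (n - 1) => gram i j) L fun _ => 0
        simp only [LinearMap.zero_apply] at this
        rw [← this, mul_zero]
      · intro L' _ hl
        refine hodd L' ?_
        rw [← hl] at he
        exact Nat.not_even_iff_odd.1 fun h => (Nat.even_add_one.1 he) h
    · rw [ho.neg_one_pow, neg_one_smul] at h
      have h2 := congrArg Matrix.trace h
      rw [Matrix.trace_add, Matrix.trace_neg, Matrix.trace_mul_comm _ (basicGen (n / 2) i)] at h2
      have h3 := map_contraction (Matrix.traceLinearMap (Fin (n / 2) → Fin 2) ℂ ℂ)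
        (fun j : Fin (n - 1) => gram i j) L
        fun L' => (L'.map fun i : Fin (n - 1) => basicGen (n / 2) i).prod
      simp only [Matrix.traceLinearMap_apply] at h3
      rw [h3] at h2
      have h4 : basicChar n (word (i :: L)) = 1 / 2 * contraction (fun j : Fin (n - 1) => gram i j) L
          fun L' => basicChar n (word L') := by
        simp only [basicChar, basicSpin_word, List.map_cons, List.prod_cons]
        linear_combination h2 / 2
      have h5 := map_contraction (LinearMap.mulLeft ℂ ((2 ^ (n / 2) : ℂ)⁻¹))
        (fun j : Fin (n - 1) => gram i j) L fun L' => basicChar n (word L')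
      simp only [LinearMap.mulLeft_apply] at h5
      simp only [normTrace]
      rw [h4, ← h5]
      ring

theorem blockHom_word {k m : ℕ} (o : ℕ) (h : o + k ≤ m) (L : List (Fin (k - 1))) :
    blockHom o h (word L) =
      word (L.map fun i : Fin (k - 1) => (⟨o + i, by omega⟩ : Fin (m - 1))) := by
  induction L with
  | nil => simp [word]
  | cons i L ih =>
    simp only [word, List.map_cons, List.prod_cons, map_mul, blockHom_t] at ih ⊢
    rw [ih]

theorem gram_add (o i j : ℕ) : gram (o + i) (o + j) = gram i j := by
  simp only [gram, add_assoc, add_right_inj]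

/-- The generator linking the two blocks does not occur, so letters of different blocks have indices
at least two apart and their `gram` entry is $0$. The normalization matters: the dimensions
$2^{\lfloor n/2\rfloor}$ are not multiplicative when $n$ and $k$ are both odd. -/
theorem normTrace_blockMul {n k m : ℕ} (h : n + k = m) (a : SpinSym n) (b : SpinSym k) :
    normTrace m (blockHom 0 (by omega) a * blockHom n h.le b) = normTrace n a * normTrace k b := by
  have key : ∀ (L : List (Fin (n - 1))) (L' : List (Fin (k - 1))),
      normTrace m (blockHom 0 (by omega) (word L) * blockHom n h.le (word L')) =
        normTrace n (word L) * normTrace k (word L') := by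
    intro L L'
    rw [blockHom_word, blockHom_word, ← word_append, (isPfaffian_normTrace m).append]
    · rw [(isPfaffian_normTrace n).map_eq (isPfaffian_normTrace m) fun i j => gram_add 0 i j,
        (isPfaffian_normTrace k).map_eq (isPfaffian_normTrace m) fun i j => gram_add n i j]
    · intro i hi j hj
      obtain ⟨i, -, rfl⟩ := List.mem_map.1 hi
      obtain ⟨j, -, rfl⟩ := List.mem_map.1 hj
      have := i.2
      rw [gram, if_neg (by simp only; omega), if_neg (by simp only; omega)]
  obtain ⟨L, rfl | rfl⟩ := exists_word a <;> obtain ⟨L', rfl | rfl⟩ := exists_word b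
  · exact key L L'
  · rw [map_mul, blockHom_z, normTrace_z_mul, ← mul_assoc, ← z_comm, mul_assoc, normTrace_z_mul, key, mul_neg]
  · rw [map_mul, blockHom_z, normTrace_z_mul, mul_assoc, normTrace_z_mul, key, neg_mul]
  · rw [map_mul, map_mul, blockHom_z, blockHom_z, normTrace_z_mul, normTrace_z_mul,
      ← mul_assoc, mul_assoc (z m), ← z_comm, ← mul_assoc, z_mul_z, one_mul, key, neg_mul_neg]

end SpinSym

/-! ### Multiplicative functions and signed sums over invariant subsets -/

section Species

variable {Γ : Type*}

/-- A function on labelled permutations is multiplicative with respect to disjoint unions. -/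
def IsMultiplicative (u : ∀ X : Type, Wr Γ X → ℂ) : Prop :=
  ∀ (X Y : Type) [Finite X] [Finite Y] (a : Wr Γ X) (b : Wr Γ Y),
    u (X ⊕ Y) (Wr.sum a b) = u X a * u Y b

theorem convTerm_sum_eq {u f : ∀ X : Type, Wr Γ X → ℂ} (hu : Natural u)
    (hf : Natural f) {X Y : Type} (p : X ⊕ Y → Prop) (a : Wr Γ X)
    (b : Wr Γ Y) [Decidable (Wr.Pres (fun x => p (Sum.inl x)) a ∧ Wr.Pres (fun y => p (Sum.inr y)) b)] :
    convTerm u f p (Wr.sum a b) =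
      if Wr.Pres (fun x => p (Sum.inl x)) a ∧ Wr.Pres (fun y => p (Sum.inr y)) b then
        u _ (Wr.sum (Wr.res (fun x => p (Sum.inl x)) a) (Wr.res (fun y => p (Sum.inr y)) b)) *
          f _ (Wr.sum (Wr.res (fun x => ¬p (Sum.inl x)) a) (Wr.res (fun y => ¬p (Sum.inr y)) b))
      else 0 := by
  unfold convTerm
  by_cases h : Wr.Pres p (Wr.sum a b)
  · rw [if_pos h, if_pos (Wr.pres_sum.1 h), Wr.res_sum h, Wr.res_sum (Wr.pres_not.2 h), hu, hf]
  · rw [if_neg h, if_neg fun h' => h (Wr.pres_sum.2 h')]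

-- Subsets of a disjoint union are pairs of subsets, and invariance is tested on each part.
open Classical in
theorem conv_sum_eq {u f : ∀ X : Type, Wr Γ X → ℂ} (hu : Natural u)
    (hf : Natural f) {X Y : Type} [Fintype X] [Fintype Y] (a : Wr Γ X) (b : Wr Γ Y) :
    conv u f (X ⊕ Y) (Wr.sum a b) = ∑ S : Finset X, ∑ T : Finset Y,
      if Wr.Pres (· ∈ S) a ∧ Wr.Pres (· ∈ T) b then
        u _ (Wr.sum (Wr.res (· ∈ S) a) (Wr.res (· ∈ T) b)) *
          f _ (Wr.sum (Wr.res (fun x => x ∉ S) a) (Wr.res (fun x => x ∉ T) b))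
      else 0 := by
  unfold conv
  rw [← Fintype.sum_prod_type' (f := fun S T => if Wr.Pres (· ∈ S) a ∧ Wr.Pres (· ∈ T) b then
        u _ (Wr.sum (Wr.res (· ∈ S) a) (Wr.res (· ∈ T) b)) *
          f _ (Wr.sum (Wr.res (fun x => x ∉ S) a) (Wr.res (fun x => x ∉ T) b)) else 0)]
  refine (Fintype.sum_equiv Finset.sumEquiv.symm.toEquiv _ _ fun ⟨S, T⟩ => ?_).symm
  have h : ((· ∈ Finset.sumEquiv.symm.toEquiv (S, T)) : X ⊕ Y → Prop) =
      Sum.elim (· ∈ S) (· ∈ T) := by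
    funext x
    cases x <;> simp [Finset.sumEquiv]
  rw [h, convTerm_sum_eq hu hf]
  rfl

theorem conv_multiplicative {u f : ∀ X : Type, Wr Γ X → ℂ} (hu : Natural u)
    (hm : IsMultiplicative u) (hf : Natural f) (hfm : IsMultiplicative f) {X Y : Type} [Fintype X]
    [Fintype Y] (a : Wr Γ X) (b : Wr Γ Y) :
    conv u f (X ⊕ Y) (Wr.sum a b) = conv u f X a * conv u f Y b := by
  classical
  rw [conv_sum_eq hu hf]
  unfold conv convTerm
  rw [Finset.sum_mul_sum]
  refine Finset.sum_congr rfl fun S _ => Finset.sum_congr rfl fun T _ => ?_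
  rw [hfm, hm]
  by_cases h1 : Wr.Pres (· ∈ S) a <;> by_cases h2 : Wr.Pres (· ∈ T) b <;> simp [h1, h2]
  ring

theorem conv_eq_mul_of_pres {u f : ∀ X : Type, Wr Γ X → ℂ} (hu : Natural u)
    (hm : IsMultiplicative u) (hf : Natural f) (hfm : IsMultiplicative f) {X : Type} [Fintype X]
    {p : X → Prop} [Fintype {x // p x}] [Fintype {x // ¬p x}] {w : Wr Γ X} (h : Wr.Pres p w) :
    conv u f X w = conv u f _ (Wr.res p w) * conv u f _ (Wr.res (fun x => ¬p x) w) := by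
  conv_lhs => rw [← Wr.join_res h]
  rw [Wr.join, conv_map hu hf, conv_multiplicative hu hm hf hfm]

open Classical in
/-- The sign of the underlying permutation of a labelled permutation of a finite set. -/
def signChar (X : Type) (w : Wr Γ X) : ℂ :=
  if _ : Finite X then
    letI := Fintype.ofFinite X
    ((Equiv.Perm.sign w.2 : ℤˣ) : ℤ)
  -- The default on infinite sets keeps the function natural; multiplicativity is asked of finite
  -- sets only.
  else 1

theorem signChar_eq {X : Type} [Fintype X] [DecidableEq X] (w : Wr Γ X) :
    signChar X w = ((Equiv.Perm.sign w.2 : ℤˣ) : ℤ) := by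
  rw [signChar, dif_pos (Finite.of_fintype X)]
  congr!

theorem natural_signChar : Natural (signChar (Γ := Γ)) := by
  classical
  intro X Y e w
  by_cases h : Finite X
  · have := Fintype.ofFinite X
    have := Fintype.ofEquiv X e
    rw [signChar_eq, signChar_eq]
    simp [Wr.map]
  · rw [signChar, signChar, dif_neg h, dif_neg fun h' : Finite Y => h (Finite.of_equiv Y e.symm)]

theorem multiplicative_signChar : IsMultiplicative (signChar (Γ := Γ)) := by
  classical
  intro X Y _ _ a b
  have := Fintype.ofFinite X
  have := Fintype.ofFinite Y
  rw [signChar_eq, signChar_eq, signChar_eq]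
  simp [Wr.sum, Equiv.Perm.sign_sumCongr]

theorem signChar_res_mul {X : Type} [Finite X] {p : X → Prop} {w : Wr Γ X} (h : Wr.Pres p w) :
    signChar _ (Wr.res p w) * signChar _ (Wr.res (fun x => ¬p x) w) = signChar X w := by
  conv_rhs => rw [← Wr.join_res h]
  rw [Wr.join, natural_signChar, multiplicative_signChar]

/-- The sum of the signs of the restrictions to all invariant subsets. -/
def signSum (X : Type) [Fintype X] (w : Wr Γ X) : ℂ := conv signChar (fun _ _ => 1) X w

theorem natural_one : Natural (Γ := Γ) fun _ _ => (1 : ℂ) := fun _ _ _ _ => rfl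

theorem multiplicative_one : IsMultiplicative (Γ := Γ) fun _ _ => (1 : ℂ) :=
  fun _ _ _ _ _ _ => (mul_one 1).symm

theorem signSum_map {X Y : Type} [Fintype X] [Fintype Y] (e : X ≃ Y) (w : Wr Γ X) :
    signSum Y (Wr.map e w) = signSum X w := conv_map natural_signChar natural_one e w

theorem signSum_eq_mul {X : Type} [Fintype X] {p : X → Prop} [Fintype {x // p x}]
    [Fintype {x // ¬p x}] {w : Wr Γ X} (h : Wr.Pres p w) :
    signSum X w = signSum _ (Wr.res p w) * signSum _ (Wr.res (fun x => ¬p x) w) :=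
  conv_eq_mul_of_pres natural_signChar multiplicative_signChar natural_one multiplicative_one h

/-- The signs of the restrictions to `S` and to its complement multiply to $-1$, so complementation
negates the sum. -/
theorem signSum_of_sign {X : Type} [Fintype X] {w : Wr Γ X} (h : signChar X w = -1) :
    signSum X w = 0 := by
  classical
  have : signSum X w = -signSum X w := by
    conv_lhs => rw [signSum, conv, 
      ← Equiv.sum_comp (Function.Involutive.toPerm compl (compl_involutive (α := Finset X)))]
    rw [signSum, conv, ← Finset.sum_neg_distrib]
    refine Finset.sum_congr rfl fun S _ => ?_
    have hS : ((· ∈ Function.Involutive.toPerm compl (compl_involutive (α := Finset X)) S) : X → Prop) = fun x => ¬ x ∈ S := by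
      funext x; simp
    unfold convTerm
    rw [hS]
    by_cases hp : Wr.Pres (· ∈ S) w
    · rw [if_pos hp, if_pos (Wr.pres_not.2 hp)]
      have h1 := signChar_res_mul hp
      rw [h] at h1
      have h2 : signChar _ (Wr.res (· ∈ S) w) * signChar _ (Wr.res (· ∈ S) w) = 1 := by
        rw [signChar_eq]
        rcases Int.units_eq_one_or (Equiv.Perm.sign (Wr.res (· ∈ S) w).2) with h | h <;>
          rw [h] <;> simp
      linear_combination signChar _ (Wr.res (· ∈ S) w) * h1 -
        signChar _ (Wr.res (fun x => ¬x ∈ S) w) * h2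
    · rw [if_neg hp, if_neg (fun h => hp (Wr.pres_not.1 h)), neg_zero]
  linear_combination this / 2

/-- Some invariant subset carries an odd permutation; the sum factors over it and its complement,
and that factor vanishes. -/
theorem signSum_of_not_oddOrder {X : Type} [Fintype X] {w : Wr Γ X} (h : ¬OddOrder w.2) :
    signSum X w = 0 := by
  classical
  obtain ⟨S, hS, hs⟩ := exists_pres_sign h
  have hp : Wr.Pres (· ∈ S) w := hS
  rw [signSum_eq_mul hp, signSum_of_sign (w := Wr.res (· ∈ S) w), zero_mul]
  rw [signChar_eq, Wr.res_snd hp, hs]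
  simp

/-- If there are no non-trivial invariant subsets, then only the trivial ones contribute. -/
theorem signSum_of_transitive {X : Type} [Fintype X] [Nonempty X] {w : Wr Γ X}
    (h : ∀ S : Finset X, Wr.Pres (· ∈ S) w → S = ∅ ∨ S = Finset.univ) (hs : signChar X w = 1) :
    signSum X w = 2 := by
  classical
  have h0 : Wr.Pres (· ∈ (∅ : Finset X)) w := fun x => by simp
  have h1 : Wr.Pres (· ∈ (Finset.univ : Finset X)) w := fun x => by simp
  have hne : (∅ : Finset X) ≠ Finset.univ := Finset.univ_nonempty.ne_empty.symm
  have hr : signChar _ (Wr.res (· ∈ (∅ : Finset X)) w) = 1 := by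
    rw [signChar_eq, Subsingleton.elim (Wr.res (· ∈ (∅ : Finset X)) w).2 1]
    simp
  have hr' : signChar _ (Wr.res (fun x => ¬x ∈ (Finset.univ : Finset X)) w) = 1 := by
    have : IsEmpty {x // ¬x ∈ (Finset.univ : Finset X)} := ⟨fun x => x.2 (Finset.mem_univ _)⟩
    rw [signChar_eq, Subsingleton.elim (Wr.res (fun x => ¬x ∈ (Finset.univ : Finset X)) w).2 1]
    simp
  have h2 := signChar_res_mul h1
  rw [hr', mul_one, hs] at h2
  rw [signSum, conv, ← Finset.sum_subset (Finset.subset_univ {∅, Finset.univ}),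
    Finset.sum_pair hne, convTerm, convTerm, if_pos h0, if_pos h1, hr, h2]
  · norm_num
  · intro S _ hS
    rw [convTerm, if_neg]
    intro hp
    rcases h S hp with rfl | rfl <;> simp at hS

theorem signSum_of_isEmpty {X : Type} [Fintype X] [IsEmpty X] (w : Wr Γ X) : signSum X w = 1 := by
  classical
  have h0 : Wr.Pres (· ∈ (∅ : Finset X)) w := fun x => by simp
  rw [signSum, conv, Fintype.sum_unique]
  have : (default : Finset X) = ∅ := rfl
  rw [this, convTerm, if_pos h0, signChar_eq,
    Subsingleton.elim (Wr.res (· ∈ (∅ : Finset X)) w).2 1]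
  simp

end Species

/-! ### The square of the basic spin character -/

namespace SpinSym

/-- In a word of consecutive letters the first is orthogonal to all but the second, with which its
entry is $1$. So each step removes two letters and gives $1/2$. -/
theorem pfaffian_range {N : ℕ} {F : List (Fin N) → ℂ}
    (hF : IsPfaffian (fun i j : Fin N => gram i j) F) (r s : ℕ) (L : List (Fin N))
    (hL : L.map Fin.val = List.range' s (2 * r)) : F L = (1 / 2) ^ r := by
  induction r generalizing s L with
  | zero =>
    have : L = [] := by simpa using hL
    rw [this, hF.nil, pow_zero]
  | succ r ih =>
    rw [mul_add, mul_one, List.range'_succ, List.range'_succ] at hL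
    obtain ⟨i, L, rfl⟩ : ∃ i L', L = i :: L' := List.exists_cons_of_ne_nil (by rintro rfl; simp at hL)
    obtain ⟨j, L, rfl⟩ : ∃ i L', L = i :: L' := List.exists_cons_of_ne_nil (by rintro rfl; simp at hL)
    simp only [List.map_cons, List.cons.injEq] at hL
    obtain ⟨hi, hj, hL⟩ := hL
    rw [hF.cons, contraction, contraction_eq_zero, ih _ L hL, gram, if_neg (by omega),
      if_pos (by omega), one_smul, sub_zero, pow_succ, mul_comm]
    intro k hk
    have : (k : ℕ) ∈ List.range' (s + 1 + 1) (2 * r) := by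
      rw [← hL]; exact List.mem_map_of_mem hk
    rw [List.mem_range'_1] at this
    rw [gram, if_neg (by omega), if_neg (by omega)]

theorem toPerm_word_finRange (n : ℕ) :
    toPerm n (word (List.finRange (n - 1))) = (List.finRange n).formPerm := by
  rw [word, map_list_prod, List.map_map, List.formPerm]
  congr 1
  refine List.ext_getElem (by simp) fun i h1 h2 => ?_
  simp [toPerm_t, adjSwap]

/-- A transitive permutation is conjugate to the standard full cycle. -/
theorem exists_conj_word {n : ℕ} (hn : 0 < n) {σ : Equiv.Perm (Fin n)}
    (h : ∀ S : Finset (Fin n), (∀ x, σ x ∈ S ↔ x ∈ S) → S = ∅ ∨ S = Finset.univ) :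
    IsConj σ (toPerm n (word (List.finRange (n - 1)))) := by
  classical
  obtain rfl | hn2 : n = 1 ∨ 2 ≤ n := by omega
  · rw [Subsingleton.elim σ (toPerm 1 _)]
  have hsame : ∀ x y, σ.SameCycle x y := by
    intro x y
    have := (h (Finset.univ.filter fun y => σ.SameCycle x y) fun y => by simp).resolve_left
      (Finset.ne_empty_of_mem (a := x) (by simp [Equiv.Perm.SameCycle.refl]))
    have hy := Finset.mem_univ y
    rw [← this] at hy
    simpa using hy
  have hfix : ∀ x, σ x ≠ x := by
    intro x hx
    have : Nontrivial (Fin n) := Fin.nontrivial_iff_two_le.2 hn2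
    obtain ⟨y, hy⟩ := exists_ne x
    obtain ⟨k, hk⟩ := hsame x y
    rw [Equiv.Perm.zpow_apply_eq_self_of_apply_eq_self hx] at hk
    exact hy hk.symm
  have hσ : σ.IsCycle := ⟨⟨0, hn⟩, hfix _, fun y _ => hsame _ y⟩
  have hl : 2 ≤ (List.finRange n).length := by simpa using hn2
  rw [toPerm_word_finRange, hσ.isConj_iff (List.isCycle_formPerm (List.nodup_finRange n) hl),
    List.support_formPerm_of_nodup _ (List.nodup_finRange n)]
  · congr 1
    ext x
    simp [hfix]
  · intro x hx
    rw [hx] at hl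
    simp at hl

/-- Squaring removes the ambiguity of the lift, so the square may be computed on any convenient one.
-/
theorem normTrace_sq_of_toPerm_eq {n : ℕ} {x y : SpinSym n} (h : toPerm n x = toPerm n y) :
    normTrace n x ^ 2 = normTrace n y ^ 2 := by
  rcases eq_or_of_toPerm_eq h with rfl | rfl
  · rfl
  · rw [normTrace_z_mul, neg_sq]

theorem normTrace_conj {n : ℕ} (x y : SpinSym n) : normTrace n (y * x * y⁻¹) = normTrace n x := by
  rw [normTrace, basicChar_conj, normTrace]

/-- The square of the basic spin character at a lift of a permutation of odd order. -/
theorem normTrace_sq {n : ℕ} (x : SpinSym n) (hx : OddOrder (toPerm n x)) :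
    2 ^ n * normTrace n x ^ 2 = signSum (Fin n) ((1, toPerm n x) : Wr Unit (Fin n)) := by
  classical
  induction n using Nat.strong_induction_on with
  | _ n ih =>
  set w : Wr Unit (Fin n) := (1, toPerm n x) with hw
  rcases Nat.eq_zero_or_pos n with rfl | hn
  · have : normTrace 0 (word []) = 1 := (isPfaffian_normTrace 0).nil
    rw [signSum_of_isEmpty, normTrace_sq_of_toPerm_eq (y := word []) (Subsingleton.elim _ _), this]
    norm_num
  -- Both sides are multiplicative over invariant subsets, which leaves the transitive case: the
  -- full cycle.
  by_cases ht : ∀ S : Finset (Fin n), Wr.Pres (· ∈ S) w → S = ∅ ∨ S = Finset.univ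
  · have : Nonempty (Fin n) := ⟨⟨0, hn⟩⟩
    obtain ⟨g, hg⟩ := isConj_iff.1 (exists_conj_word hn ht)
    have hs : Equiv.Perm.sign (toPerm n x) = 1 := (hx.map Equiv.Perm.sign).eq_one
    rw [signSum_of_transitive ht (by rw [signChar_eq, hw, hs]; simp)]
    obtain ⟨y, rfl⟩ := toPerm_surjective n g
    rw [← normTrace_conj x y, normTrace_sq_of_toPerm_eq (y := word (List.finRange (n - 1)))
      (by rw [map_mul, map_mul, map_inv, hg])]
    have hp := parity_word (n := n) (List.finRange (n - 1))
    rw [parity, MonoidHom.comp_apply, ← hg] at hp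
    rw [map_mul, map_mul, map_inv, hs, mul_one, mul_inv_cancel, List.length_finRange] at hp
    -- An odd order permutation is even, so a full cycle of this kind has odd length $n=2r+1$. Its
    -- normalized trace is $\pm2^{-r}$, and $2^n\cdot2^{-2r}=2$ matches the two trivial invariant
    -- subsets.
    have he : Even (n - 1) := by
      by_contra ho
      rw [(Nat.not_even_iff_odd.1 ho).neg_one_pow] at hp
      exact absurd hp (by decide)
    obtain ⟨r, hr⟩ := he
    obtain rfl : n = 2 * r + 1 := by omega
    have := pfaffian_range (isPfaffian_normTrace (2 * r + 1)) r 0 (List.finRange (2 * r + 1 - 1))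
      (by simp [List.range_eq_range'])
    rw [this, ← pow_mul, mul_comm r 2, pow_succ, mul_right_comm, ← mul_pow]
    norm_num
  · push Not at ht
    obtain ⟨S, hS, h0, h1⟩ := ht
    obtain ⟨k, l, h, e₁, e₂, y, a, b, hab, ha, hb⟩ :=
      SpinWreath.exists_conj_blockMul (⟨1, x⟩ : SpinWreath Unit n) (· ∈ S) hS
    have hxw : SpinWreath.proj (⟨1, x⟩ : SpinWreath Unit n) = w := rfl
    rw [hxw] at ha hb
    have hk : S.card = k := by simpa using Fintype.card_congr e₁
    have hk0 : 0 < k := by rw [← hk]; exact Finset.card_pos.2 h0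
    have hk1 : k < n := by
      rw [← hk]
      simpa using (Finset.card_lt_iff_ne_univ S).2 h1
    have hr := congrArg SemidirectProduct.right hab
    simp only [SemidirectProduct.mul_right, SemidirectProduct.inv_right] at hr
    have hr' : y.right * x * y.right⁻¹ =
      blockHom 0 (by omega) a.right * blockHom k h.le b.right := hr
    have ha' : ((1, toPerm k a.right) : Wr Unit (Fin k)) = Wr.map e₁ (Wr.res (· ∈ S) w) := ha
    have hb' : ((1, toPerm l b.right) : Wr Unit (Fin l)) = Wr.map e₂ (Wr.res (fun x => ¬x ∈ S) w) :=
      hb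
    have hodd := (Wr.oddOrder_res hS).1 hx
    rw [signSum_eq_mul hS, ← signSum_map e₁, ← signSum_map e₂, ← ha', ← hb',
      ← ih k hk1 a.right, ← ih l (by omega) b.right, ← normTrace_conj x y.right, hr',
      normTrace_blockMul h, ← h, pow_add]
    · ring
    · have := (Wr.oddOrder_map e₂).2 hodd.2
      rwa [← hb'] at this
    · have := (Wr.oddOrder_map e₁).2 hodd.1
      rwa [← ha'] at this

end SpinSym

/-! ### Normalized spin characters on labelled permutations, and their pairings -/

theorem virtualChar_le_classFun {Γ : Type*} [Group Γ] {γ : Γ → ℂ} (h : γ ∈ virtualChar Γ) :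
    γ ∈ classFun Γ := by
  induction h using AddSubgroup.closure_induction with
  | mem γ hγ =>
    obtain ⟨d, ρ, -, rfl⟩ := hγ
    exact fun x y => ρ.char_conj x y
  | zero => exact Submodule.zero_mem _
  | add f g _ _ hf hg => exact Submodule.add_mem _ hf hg
  | neg f _ hf => exact Submodule.neg_mem _ hf

section

variable {Γ : Type*} [Group Γ]

theorem mul_mem_classFun {α β : Γ → ℂ} (hα : α ∈ classFun Γ) (hβ : β ∈ classFun Γ) :
    α * β ∈ classFun Γ := fun x y => by rw [Pi.mul_apply, Pi.mul_apply, hα, hβ]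

theorem comp_inv_mem_classFun {α : Γ → ℂ} (hα : α ∈ classFun Γ) :
    (fun x => α x⁻¹) ∈ classFun Γ := fun x y => by
  change α (y * x * y⁻¹)⁻¹ = α x⁻¹
  rw [← hα x⁻¹ y]
  congr 1
  group

/-- This is the purpose of the factor $2^{\bar n/2}$: together with the dimension $2^{\lfloor
n/2\rfloor}$ it makes $\sqrt2^{\,n}$, which is multiplicative in $n$. -/
theorem sqrt_two_pow (n : ℕ) (x : SpinSym n) :
    (Real.sqrt 2 : ℂ) ^ (n % 2) * basicChar n x = (Real.sqrt 2 : ℂ) ^ n * SpinSym.normTrace n x := by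
  have h2 : (Real.sqrt 2 : ℂ) ^ 2 = 2 := by
    rw [← Complex.ofReal_pow, Real.sq_sqrt (by norm_num)]; norm_num
  have h : (Real.sqrt 2 : ℂ) ^ n = (Real.sqrt 2 : ℂ) ^ (n % 2) * 2 ^ (n / 2) := by
    conv_lhs => rw [← Nat.mod_add_div n 2]
    rw [pow_add, pow_mul, h2]
  rw [h, SpinSym.normTrace]
  have : (2 : ℂ) ^ (n / 2) ≠ 0 := pow_ne_zero _ two_ne_zero
  field_simp

theorem normSpinChar_eq {γ : Γ → ℂ} (hγ : γ ∈ classFun Γ) {n : ℕ} (x : SpinWreath Γ n) :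
    normSpinChar γ n x = (Real.sqrt 2 : ℂ) ^ n * SpinSym.normTrace n x.right *
      Wr.eta γ (Fin n) (SpinWreath.proj x) := by
  rw [normSpinChar, spinChar, wreathChar_eq_eta hγ, ← sqrt_two_pow]
  ring

theorem normSpinChar_mem {γ : Γ → ℂ} (hγ : γ ∈ classFun Γ) (n : ℕ) :
    normSpinChar γ n ∈ superClass Γ n := by
  refine ⟨fun x y => ?_, fun x => ?_, fun x => normSpinChar_odd γ n⟩
  · rw [normSpinChar_eq hγ, normSpinChar_eq hγ, SpinWreath.proj_conj, Wr.eta_gauge hγ,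
      Wr.eta_map hγ]
    simp only [SemidirectProduct.mul_right, SemidirectProduct.inv_right, SpinSym.normTrace_conj]
  · rw [normSpinChar_eq hγ, normSpinChar_eq hγ, SpinWreath.proj_z_mul]
    simp only [SemidirectProduct.mul_right, SpinWreath.z, SemidirectProduct.right_inr,
      SpinSym.normTrace_z_mul]
    ring

/-- The weight is absorbed into the character, so the pairing weighted by $\xi$ becomes an
unweighted one with $\xi\gamma$ in place of $\gamma$. -/
theorem wreathChar_mul_normSpinChar {ξ γ : Γ → ℂ} (hξ : ξ ∈ classFun Γ) (hγ : γ ∈ classFun Γ)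
    {n : ℕ} (x : SpinWreath Γ n) :
    wreathChar ξ x * normSpinChar γ n x = normSpinChar (ξ * γ) n x := by
  rw [normSpinChar_eq hγ, normSpinChar_eq (mul_mem_classFun hξ hγ), wreathChar_eq_eta hξ,
    Wr.eta_mul]
  ring

/-- The values of the normalized spin characters on labelled permutations of all finite sets. -/
def spinFun (γ : Γ → ℂ) (X : Type) (w : Wr Γ X) : ℂ :=
  spread (desc (normSpinChar γ (Nat.card X))) X w

theorem spread_desc_normSpinChar (γ : Γ → ℂ) (n : ℕ) (X : Type) (w : Wr Γ X) :
    spread (desc (normSpinChar γ n)) X w = if Nat.card X = n then spinFun γ X w else 0 := by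
  split_ifs with h
  · subst h; rfl
  · exact spread_of_card_ne _ _ h

theorem spinFun_fin {γ : Γ → ℂ} (hγ : γ ∈ classFun Γ) {n : ℕ} (w : Wr Γ (Fin n)) :
    spinFun γ (Fin n) w = desc (normSpinChar γ n) w := by
  rw [← spread_self (desc_map (normSpinChar_mem hγ n)), spread_desc_normSpinChar,
    if_pos (Nat.card_fin n)]

theorem natural_spinFun {γ : Γ → ℂ} (hγ : γ ∈ classFun Γ) : Natural (spinFun γ) := by
  intro X Y e w
  unfold spinFun
  rw [← Nat.card_congr e]
  exact natural_spread_desc (normSpinChar_mem hγ _) X Y e w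

theorem spinFun_of_odd {γ : Γ → ℂ} (hγ : γ ∈ classFun Γ) {n : ℕ} {w : Wr Γ (Fin n)}
    (hw : OddOrder w.2) : spinFun γ (Fin n) w = (Real.sqrt 2 : ℂ) ^ n *
      SpinSym.normTrace n (SpinSym.can w.2) * Wr.eta γ (Fin n) w := by
  rw [spinFun_fin hγ, desc_of_odd _ hw, normSpinChar_eq hγ, SpinWreath.proj_can hw]
  rfl

theorem spinFun_of_not (γ : Γ → ℂ) {X : Type} {w : Wr Γ X} (hw : ¬OddOrder w.2) :
    spinFun γ X w = 0 := spread_desc_of_not _ hw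

/-- At canonical lifts the function is a product of $\sqrt2^{\,n}$, the normalized trace and `eta`,
each multiplicative; canonical lifts themselves are compatible with blocks. -/
theorem multiplicative_spinFun {γ : Γ → ℂ} (hγ : γ ∈ classFun Γ) :
    IsMultiplicative (spinFun γ) := by
  have key : ∀ (n k : ℕ) (a : Wr Γ (Fin n)) (b : Wr Γ (Fin k)),
      spinFun γ (Fin n ⊕ Fin k) (Wr.sum a b) = spinFun γ _ a * spinFun γ _ b := by
    intro n k a b
    by_cases hab : OddOrder (Wr.sum a b).2
    · obtain ⟨ha, hb⟩ := Wr.oddOrder_sum.1 hab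
      have hc : SpinSym.can (Wr.map (SpinSym.blockEquiv (rfl : n + k = n + k)) (Wr.sum a b)).2 =
          SpinSym.blockHom 0 (by omega) (SpinSym.can a.2) *
            SpinSym.blockHom n le_rfl (SpinSym.can b.2) := (SpinSym.can_block rfl ha hb).symm
      rw [← natural_spinFun hγ _ _ (SpinSym.blockEquiv rfl),
        spinFun_of_odd hγ ((Wr.oddOrder_map _).2 hab), spinFun_of_odd hγ ha, spinFun_of_odd hγ hb,
        Wr.eta_map hγ, Wr.eta_sum hγ, hc, SpinSym.normTrace_blockMul rfl, pow_add]
      ring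
    · rw [spinFun_of_not γ hab]
      by_cases ha : OddOrder a.2
      · rw [spinFun_of_not γ (w := b) fun hb => hab (Wr.oddOrder_sum.2 ⟨ha, hb⟩), mul_zero]
      · rw [spinFun_of_not γ ha, zero_mul]
  intro X Y _ _ a b
  rw [← natural_spinFun hγ _ _ (Finite.equivFin X), ← natural_spinFun hγ _ _ (Finite.equivFin Y),
    ← natural_spinFun hγ _ _ (Equiv.sumCongr (Finite.equivFin X) (Finite.equivFin Y)), ← Wr.map_sum,
    key]

theorem isConj_inv {X : Type*} [Finite X] (σ : Equiv.Perm X) : IsConj σ σ⁻¹ := by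
  classical
  have := Fintype.ofFinite X
  rw [Equiv.Perm.isConj_iff_cycleType_eq, Equiv.Perm.cycleType_inv]

/-- A permutation is conjugate to its inverse, and conjugation respects the canonical lifts. -/
theorem normTrace_can_inv {n : ℕ} {σ : Equiv.Perm (Fin n)} (hσ : OddOrder σ) :
    SpinSym.normTrace n (SpinSym.can σ⁻¹) = SpinSym.normTrace n (SpinSym.can σ) := by
  obtain ⟨g, hg⟩ := isConj_iff.1 (isConj_inv σ)
  obtain ⟨y, rfl⟩ := SpinSym.toPerm_surjective n g
  rw [← hg, ← SpinSym.can_conj hσ, SpinSym.normTrace_conj]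

/-- The two spin factors combine to $2^n$ times a squared normalized trace, which is `signSum`. From
here on no lifts occur. Both sides vanish on permutations not of odd order. -/
theorem spinFun_mul_spinFun_inv {α β : Γ → ℂ} (hα : α ∈ classFun Γ) (hβ : β ∈ classFun Γ) {n : ℕ}
    (w : Wr Γ (Fin n)) : spinFun α (Fin n) w * spinFun β (Fin n) (Wr.inv w) =
      signSum (Fin n) w * Wr.eta (fun x => α x * β x⁻¹) (Fin n) w := by
  by_cases hw : OddOrder w.2
  · have hw' : OddOrder (Wr.inv w).2 := hw.inv
    have h1 := SpinSym.normTrace_sq (SpinSym.can w.2) (by rwa [SpinSym.toPerm_can hw])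
    rw [SpinSym.toPerm_can hw] at h1
    have h2 : signSum (Fin n) ((1, w.2) : Wr Unit (Fin n)) = signSum (Fin n) w := rfl
    have h3 : Wr.eta (fun x => α x * β x⁻¹) (Fin n) w =
        Wr.eta α (Fin n) w * Wr.eta (fun x => β x⁻¹) (Fin n) w := Wr.eta_mul α _ w
    have h4 : (Real.sqrt 2 : ℂ) ^ n * (Real.sqrt 2 : ℂ) ^ n = 2 ^ n := by
      rw [← mul_pow, ← Complex.ofReal_mul, Real.mul_self_sqrt (by norm_num)]; norm_num
    rw [spinFun_of_odd hα hw, spinFun_of_odd hβ hw', Wr.eta_inv hβ, h3, ← h2, ← h1, ← h4]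
    change _ * (_ * SpinSym.normTrace n (SpinSym.can w.2⁻¹) * _) = _
    rw [normTrace_can_inv hw]
    ring
  · rw [spinFun_of_not α hw, zero_mul, signSum_of_not_oddOrder hw, zero_mul]

variable [Fintype Γ]

/-- For a fixed subset the labelled permutations preserving it are pairs, and `eta` is
multiplicative: a signed cycle sum inside times an unsigned one outside. -/
theorem sum_convTerm_mul_eta {φ : Γ → ℂ} (hφ : φ ∈ classFun Γ) {X : Type} [Fintype X]
    [DecidableEq X] (p : X → Prop) [DecidablePred p] [i₁ : Fintype {x // p x}]
    [i₂ : Fintype {x // ¬p x}] :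
    ∑ w : Wr Γ X, convTerm signChar (fun _ _ => 1) p w * Wr.eta φ X w =
      Wr.zsum (fun u => ((u : ℤ) : ℂ)) φ {x // p x} * Wr.zsum (fun _ => 1) φ {x // ¬p x} := by
  classical
  obtain rfl : i₁ = Subtype.fintype p := Subsingleton.elim _ _
  obtain rfl : i₂ = Subtype.fintype fun x => ¬p x := Subsingleton.elim _ _
  have h := Wr.sum_pres p fun (a : Wr Γ {x // p x}) (b : Wr Γ {x // ¬p x}) =>
      (((Equiv.Perm.sign a.2 : ℤˣ) : ℤ) : ℂ) * Wr.eta φ _ a * (1 * Wr.eta φ _ b)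
  rw [Wr.zsum, Wr.zsum, Finset.sum_mul_sum, ← h]
  refine Finset.sum_congr rfl fun w _ => ?_
  unfold convTerm
  by_cases hp : Wr.Pres p w
  · rw [if_pos hp, if_pos hp, signChar_eq]
    have hw : Wr.eta φ X w = Wr.eta φ _ (Wr.res p w) * Wr.eta φ _ (Wr.res (fun x => ¬p x) w) := by
      conv_lhs => rw [← Wr.join_res hp]
      rw [Wr.join, Wr.eta_map hφ, Wr.eta_sum hφ]
    rw [hw]
    ring
  · rw [if_neg hp, if_neg hp, zero_mul]

theorem zsum_sign {φ : Γ → ℂ} (hφ : φ ∈ classFun Γ) {a : ℂ}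
    (ha : ∑ c, φ c = Fintype.card Γ * a) {X : Type} [Fintype X] [DecidableEq X]
    {n : ℕ} (hX : Fintype.card X = n) : Wr.zsum (fun u => ((u : ℤ) : ℂ)) φ X =
      (Nat.card Γ : ℂ) ^ n * n.factorial * Ring.choose a n := by
  subst hX
  have h := Wr.zsum_eq ((Int.castRingHom ℂ).toMonoidHom.comp (Units.coeHom ℤ)) hφ ha (X := X)
  have h1 : ((Int.castRingHom ℂ).toMonoidHom.comp (Units.coeHom ℤ)) (-1) = -1 := by simp
  rw [h1, neg_neg, one_pow, one_mul, one_mul, ← Nat.card_eq_fintype_card (α := Γ)] at h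
  exact h

theorem zsum_one {φ : Γ → ℂ} (hφ : φ ∈ classFun Γ) {a : ℂ}
    (ha : ∑ c, φ c = Fintype.card Γ * a) {X : Type} [Fintype X] [DecidableEq X]
    {n : ℕ} (hX : Fintype.card X = n) : Wr.zsum (fun _ => 1) φ X =
      (Nat.card Γ : ℂ) ^ n * n.factorial * ((-1) ^ n * Ring.choose (-a) n) := by
  subst hX
  have h := Wr.zsum_eq 1 hφ ha (X := X)
  rw [MonoidHom.one_apply, neg_one_mul, ← Nat.card_eq_fintype_card (α := Γ)] at h
  exact h

/-- The pairing of the normalized spin characters of degree `n`. -/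
theorem sum_spinFun_mul_spinFun_inv {α β : Γ → ℂ} (hα : α ∈ classFun Γ) (hβ : β ∈ classFun Γ)
    {a : ℂ} (ha : ∑ x, α x * β x⁻¹ = Fintype.card Γ * a) (n : ℕ) :
    ∑ w : Wr Γ (Fin n), spinFun α (Fin n) w * spinFun β (Fin n) (Wr.inv w) =
      n.factorial * (Nat.card Γ : ℂ) ^ n * ((-1) ^ n * PowerSeries.coeff n (expansion a)) := by
  obtain ⟨φ, hφ'⟩ : ∃ φ : Γ → ℂ, φ = fun x => α x * β x⁻¹ := ⟨_, rfl⟩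
  have hφ : φ ∈ classFun Γ := hφ' ▸ mul_mem_classFun hα (comp_inv_mem_classFun hβ)
  have ha' : ∑ x, φ x = Fintype.card Γ * a := by rw [hφ', ha]
  -- The contribution of a subset depends only on its size; the sum over sizes is a convolution of
  -- $\binom ai$ with $(-1)^{n-i}\binom{-a}{n-i}$.
  let g : ℕ → ℂ := fun i => (Nat.card Γ : ℂ) ^ n * (i.factorial * (n - i).factorial) *
    (Ring.choose a i * ((-1) ^ (n - i) * Ring.choose (-a) (n - i)))
  have hz : ∀ S : Finset (Fin n), ∑ w : Wr Γ (Fin n),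
      convTerm signChar (fun _ _ => 1) (· ∈ S) w * Wr.eta φ (Fin n) w = g S.card := by
    intro S
    have hS : S.card ≤ n := by simpa using S.card_le_univ
    have : (Nat.card Γ : ℂ) ^ n = (Nat.card Γ : ℂ) ^ S.card * (Nat.card Γ : ℂ) ^ (n - S.card) := by
      rw [← pow_add, Nat.add_sub_cancel' hS]
    rw [sum_convTerm_mul_eta hφ, zsum_sign hφ ha' (n := S.card) (by simp),
      zsum_one hφ ha' (n := n - S.card) (by simp [Fintype.card_subtype_compl])]
    simp only [g, this]
    ring
  simp only [spinFun_mul_spinFun_inv hα hβ, ← hφ', signSum, conv, Finset.sum_mul]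
  rw [Finset.sum_comm, Finset.sum_congr rfl fun S _ => hz S,
    ← Finset.powerset_univ, Finset.sum_powerset_apply_card g, expansion, PowerSeries.coeff_mul,
    Finset.Nat.sum_antidiagonal_eq_sum_range_succ_mk, Finset.mul_sum, Finset.mul_sum,
    Finset.card_univ, Fintype.card_fin]
  refine Finset.sum_congr rfl fun i hi => ?_
  have hi' : i ≤ n := by simpa [Nat.lt_succ_iff] using hi
  rw [PowerSeries.coeff_rescale, PowerSeries.binomialSeries_coeff, PowerSeries.binomialSeries_coeff,
    nsmul_eq_mul]
  have h1 : ((n.choose i : ℂ) * (i.factorial * (n - i).factorial)) = n.factorial := by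
    rw [← Nat.choose_mul_factorial_mul_factorial hi']; push_cast; ring
  -- The convolution is a coefficient of $(1+u)^a(1-u)^{-a}$, the series `expansion a` at $-u$; this
  -- is the factor $(-1)^n$.
  have h2 : ((-1 : ℂ) ^ n) * (-1) ^ i = (-1) ^ (n - i) := by
    conv_lhs => rw [← Nat.sub_add_cancel hi', pow_add, mul_assoc, ← pow_add, ← two_mul]
    simp
  simp only [g]
  rw [← h1, ← h2]
  simp
  ring

end

/-! ### Contraction of a product -/

section Species

variable {Γ : Type*} [Group Γ] [Fintype Γ]

theorem contr_congr {u f : ∀ X : Type, Wr Γ X → ℂ} (hu : Natural u) (hf : Natural f)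
    {Z Z' Y : Type} [Fintype Z] [DecidableEq Z] [Fintype Z'] [DecidableEq Z'] (e : Z ≃ Z')
    (w : Wr Γ Y) : contr u f Z Y w = contr u f Z' Y w := by
  refine Fintype.sum_equiv (Wr.mapEquiv e) _ _ fun v => ?_
  change _ = u Z' (Wr.map e v) * f (Z' ⊕ Y) (Wr.sum (Wr.inv (Wr.map e v)) w)
  rw [hu, Wr.inv_map, ← hf _ _ (Equiv.sumCongr e (Equiv.refl Y)), ← Wr.map_sum, Wr.map_refl]

theorem contr_map {u f : ∀ X : Type, Wr Γ X → ℂ} (hf : Natural f)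
    {Z Y Y' : Type} [Fintype Z] [DecidableEq Z] (e : Y ≃ Y')
    (w : Wr Γ Y) : contr u f Z Y' (Wr.map e w) = contr u f Z Y w := by
  refine Finset.sum_congr rfl fun v _ => ?_
  rw [← hf (Z ⊕ Y) _ (Equiv.sumCongr (Equiv.refl Z) e), ← Wr.map_sum, Wr.map_refl]

/-- The normalized spin character of degree `n` as a function on labelled permutations of all
finite sets. -/
def gradedSpinFun (γ : Γ → ℂ) (n : ℕ) : ∀ X : Type, Wr Γ X → ℂ :=
  spread (desc (normSpinChar γ n))

theorem gradedSpinFun_eq (γ : Γ → ℂ) (n : ℕ) {X : Type} (w : Wr Γ X) :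
    gradedSpinFun γ n X w = if Nat.card X = n then spinFun γ X w else 0 :=
  spread_desc_normSpinChar γ n X w

theorem natural_gradedSpinFun {γ : Γ → ℂ} (hγ : γ ∈ classFun Γ) (n : ℕ) :
    Natural (gradedSpinFun γ n) := natural_spread_desc (normSpinChar_mem hγ n)

/-- Multiplicativity, with the degree not used up by `X` left for `Y`; the guard prevents truncated
subtraction from producing a spurious degree $0$. -/
theorem gradedSpinFun_sum {γ : Γ → ℂ} (hγ : γ ∈ classFun Γ) (n : ℕ) {X Y : Type} [Finite X]
    [Finite Y] (a : Wr Γ X) (b : Wr Γ Y) : gradedSpinFun γ n (X ⊕ Y) (Wr.sum a b) =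
      if Nat.card X ≤ n then spinFun γ X a * gradedSpinFun γ (n - Nat.card X) Y b else 0 := by
  rw [gradedSpinFun_eq, gradedSpinFun_eq, multiplicative_spinFun hγ, Nat.card_sum]
  by_cases h : Nat.card X ≤ n
  · by_cases h' : Nat.card X + Nat.card Y = n
    · rw [if_pos h', if_pos h, if_pos (by omega)]
    · rw [if_neg h', if_pos h, if_neg (by omega), mul_zero]
  · rw [if_neg (by omega), if_neg h]

/-- The pairing of two functions on labelled permutations of a set. -/
def pairing (u v : ∀ X : Type, Wr Γ X → ℂ) (Z : Type) [Fintype Z] [DecidableEq Z] : ℂ :=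
  ∑ a : Wr Γ Z, u Z a * v Z (Wr.inv a)

theorem pairing_congr {u v : ∀ X : Type, Wr Γ X → ℂ} (hu : Natural u) (hv : Natural v)
    {Z Z' : Type} [Fintype Z] [DecidableEq Z] [Fintype Z'] [DecidableEq Z'] (e : Z ≃ Z') :
    pairing u v Z = pairing u v Z' := by
  refine Fintype.sum_equiv (Wr.mapEquiv e) _ _ fun a => ?_
  change _ = u Z' (Wr.map e a) * v Z' (Wr.inv (Wr.map e a))
  rw [hu, Wr.inv_map, hv]

theorem sum_pres_eq {X : Type} [Fintype X] [DecidableEq X] (p : X → Prop) [DecidablePred p]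
    [i₁ : Fintype {x // p x}] [i₂ : Fintype {x // ¬p x}] [∀ w : Wr Γ X, Decidable (Wr.Pres p w)]
    (G : Wr Γ {x // p x} → Wr Γ {x // ¬p x} → ℂ) :
    ∑ w : Wr Γ X, (if Wr.Pres p w then G (Wr.res p w) (Wr.res (fun x => ¬p x) w) else 0) =
      ∑ a : Wr Γ {x // p x}, ∑ b : Wr Γ {x // ¬p x}, G a b := by
  obtain rfl : i₁ = Subtype.fintype p := Subsingleton.elim _ _
  obtain rfl : i₂ = Subtype.fintype fun x => ¬p x := Subsingleton.elim _ _
  exact Wr.sum_pres p G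

/-- Contraction of a product: both the contracted set and its complement are decomposed. -/
theorem contr_conv {α β : Γ → ℂ} (hα : α ∈ classFun Γ) (hβ : β ∈ classFun Γ)
    {F G : ∀ X : Type, Wr Γ X → ℂ} (hF : Natural F) (k : ℕ)
    (hG : ∀ (X : Type) [Fintype X] (w : Wr Γ X), G X w = conv (gradedSpinFun β k) F X w)
    (Z Y : Type) [Fintype Z] [DecidableEq Z] [Fintype Y] (w : Wr Γ Y) :
    contr (spinFun α) G Z Y w = ∑ S : Finset Z, if S.card ≤ k then
      pairing (spinFun α) (spinFun β) {x // x ∈ S} *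
        conv (gradedSpinFun β (k - S.card)) (contr (spinFun α) F {x // ¬x ∈ S}) Y w else 0 := by
  classical
  unfold contr
  -- An invariant subset of $Z\sqcup Y$ is a pair $(S,T)$. Fixing $S\subset Z$ and $T\subset Y$ and
  -- summing over labelled permutations of `Z` first isolates the contribution of `S`.
  simp only [hG, conv_sum_eq (natural_gradedSpinFun hβ k) hF, Finset.mul_sum]
  rw [Finset.sum_comm]
  refine Finset.sum_congr rfl fun S _ => ?_
  rw [Finset.sum_comm]
  have hT : ∀ T : Finset Y, ∑ v : Wr Γ Z, spinFun α Z v *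
      (if Wr.Pres (· ∈ S) (Wr.inv v) ∧ Wr.Pres (· ∈ T) w then
        gradedSpinFun β k _ (Wr.sum (Wr.res (· ∈ S) (Wr.inv v)) (Wr.res (· ∈ T) w)) *
          F _ (Wr.sum (Wr.res (fun x => x ∉ S) (Wr.inv v)) (Wr.res (fun x => x ∉ T) w))
      else 0) =
      if S.card ≤ k then pairing (spinFun α) (spinFun β) {x // x ∈ S} *
        convTerm (gradedSpinFun β (k - S.card)) (contr (spinFun α) F {x // ¬x ∈ S}) (· ∈ T) w
      else 0 := by
    intro T
    by_cases hp : Wr.Pres (· ∈ T) w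
    swap
    · simp [hp, convTerm]
    -- The `α`-character factors over `S` and its complement. The part on `S` meets only the
    -- `β`-character and becomes a pairing; the part on the complement meets only `F` and becomes a
    -- contraction.
    have h1 : ∀ v : Wr Γ Z, spinFun α Z v *
        (if Wr.Pres (· ∈ S) (Wr.inv v) ∧ Wr.Pres (· ∈ T) w then
          gradedSpinFun β k _ (Wr.sum (Wr.res (· ∈ S) (Wr.inv v)) (Wr.res (· ∈ T) w)) *
            F _ (Wr.sum (Wr.res (fun x => x ∉ S) (Wr.inv v)) (Wr.res (fun x => x ∉ T) w))
        else 0) = if Wr.Pres (· ∈ S) v then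
          (fun (a : Wr Γ {x // x ∈ S}) (b : Wr Γ {x // ¬x ∈ S}) => spinFun α _ a * spinFun α _ b *
            (gradedSpinFun β k _ (Wr.sum (Wr.inv a) (Wr.res (· ∈ T) w)) *
              F _ (Wr.sum (Wr.inv b) (Wr.res (fun x => x ∉ T) w))))
            (Wr.res (· ∈ S) v) (Wr.res (fun x => ¬x ∈ S) v) else 0 := by
      intro v
      by_cases hv : Wr.Pres (· ∈ S) v
      · rw [if_pos ⟨Wr.pres_inv.2 hv, hp⟩, if_pos hv, Wr.res_inv hv,
          Wr.res_inv (Wr.pres_not.2 hv)]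
        have : spinFun α Z v = spinFun α _ (Wr.res (· ∈ S) v) *
            spinFun α _ (Wr.res (fun x => ¬x ∈ S) v) := by
          conv_lhs => rw [← Wr.join_res hv]
          rw [Wr.join, natural_spinFun hα, multiplicative_spinFun hα]
        rw [this]
      · rw [if_neg hv, if_neg (fun h => hv (Wr.pres_inv.1 h.1)), mul_zero]
    rw [Finset.sum_congr rfl fun v _ => h1 v]
    refine (sum_pres_eq (· ∈ S) fun (a : Wr Γ {x // x ∈ S}) (b : Wr Γ {x // ¬x ∈ S}) =>
      spinFun α _ a * spinFun α _ b * (gradedSpinFun β k _ (Wr.sum (Wr.inv a) (Wr.res (· ∈ T) w)) *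
        F _ (Wr.sum (Wr.inv b) (Wr.res (fun x => x ∉ T) w)))).trans ?_
    simp only [gradedSpinFun_sum hβ]
    have hc : Nat.card {x // x ∈ S} = S.card := by simp
    rw [hc]
    split_ifs with hk
    · rw [convTerm, if_pos hp, pairing, contr, Finset.mul_sum, Finset.sum_mul_sum]
      refine Finset.sum_congr rfl fun a _ => Finset.sum_congr rfl fun b _ => ?_
      ring
    · simp
  rw [Finset.sum_congr rfl fun T _ => hT T]
  split_ifs
  · rw [conv, Finset.mul_sum]
    rfl
  · simp

/-- By naturality the summand depends only on $|S|$, and there are $\binom nj$ subsets of size $j$.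
-/
theorem contr_conv_fin {α β : Γ → ℂ} (hα : α ∈ classFun Γ) (hβ : β ∈ classFun Γ)
    {F G : ∀ X : Type, Wr Γ X → ℂ} (hF : Natural F) (k : ℕ)
    (hG : ∀ (X : Type) [Fintype X] (w : Wr Γ X), G X w = conv (gradedSpinFun β k) F X w)
    (n : ℕ) (Y : Type) [Fintype Y] (w : Wr Γ Y) :
    contr (spinFun α) G (Fin n) Y w = ∑ j ∈ Finset.range (n + 1), if j ≤ k then
      n.choose j * pairing (spinFun α) (spinFun β) (Fin j) *
        conv (gradedSpinFun β (k - j)) (contr (spinFun α) F (Fin (n - j))) Y w else 0 := by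
  rw [contr_conv hα hβ hF k hG]
  let g : ℕ → ℂ := fun j => if j ≤ k then pairing (spinFun α) (spinFun β) (Fin j) *
    conv (gradedSpinFun β (k - j)) (contr (spinFun α) F (Fin (n - j))) Y w else 0
  have hS : ∀ S : Finset (Fin n), (if S.card ≤ k then
      pairing (spinFun α) (spinFun β) {x // x ∈ S} *
        conv (gradedSpinFun β (k - S.card)) (contr (spinFun α) F {x // ¬x ∈ S}) Y w else 0) =
      g S.card := by
    intro S
    simp only [g]
    have e₁ : {x // x ∈ S} ≃ Fin S.card := Fintype.equivFinOfCardEq (by simp)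
    have e₂ : {x // ¬x ∈ S} ≃ Fin (n - S.card) :=
      Fintype.equivFinOfCardEq (by simp [Fintype.card_subtype_compl])
    rw [pairing_congr (natural_spinFun hα) (natural_spinFun hβ) e₁]
    have : contr (spinFun α) F {x // ¬x ∈ S} = contr (spinFun α) F (Fin (n - S.card)) := by
      funext Y w
      exact contr_congr (natural_spinFun hα) hF e₂ w
    rw [this]
  rw [Finset.sum_congr rfl fun S _ => hS S, ← Finset.powerset_univ,
    Finset.sum_powerset_apply_card g, Finset.card_univ, Fintype.card_fin]
  refine Finset.sum_congr rfl fun j _ => ?_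
  simp only [g, nsmul_eq_mul, mul_ite, mul_zero, mul_assoc]

end Species

/-! ### The operators in terms of labelled permutations -/

section Operators

variable {Γ : Type*} [Group Γ]

theorem desc_add {n : ℕ} (f g : SpinWreath Γ n → ℂ) : desc (f + g) = desc f + desc g := by
  funext w
  by_cases h : OddOrder w.2
  · simp [desc_of_odd _ h]
  · simp [desc_of_not _ h]

theorem desc_smul {n : ℕ} (c : ℂ) (f : SpinWreath Γ n → ℂ) : desc (c • f) = c • desc f := by
  funext w
  by_cases h : OddOrder w.2
  · simp [desc_of_odd _ h]
  · simp [desc_of_not _ h]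

theorem spread_add {n : ℕ} (F G : Wr Γ (Fin n) → ℂ) : spread (F + G) = spread F + spread G := by
  funext X w
  simp only [spread, Pi.add_apply]
  split_ifs <;> simp

theorem spread_smul {n : ℕ} (c : ℂ) (F : Wr Γ (Fin n) → ℂ) : spread (c • F) = c • spread F := by
  funext X w
  simp only [spread, Pi.smul_apply]
  split_ifs <;> simp

/-- The function on labelled permutations of all finite sets determined by a vector. -/
def labelFun : SpinSpace Γ →ₗ[ℂ] ∀ X : Type, Wr Γ X → ℂ where
  toFun v X w := spread (desc (v (Nat.card X) : SpinWreath Γ (Nat.card X) → ℂ)) X w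
  map_add' v v' := by
    funext X w
    rw [DirectSum.add_apply, Submodule.coe_add, desc_add, spread_add]
    rfl
  map_smul' c v := by
    funext X w
    rw [DirectSum.smul_apply, Submodule.coe_smul, desc_smul, spread_smul]
    rfl

theorem labelFun_lof {n : ℕ} (f : superClass Γ n) :
    labelFun (DirectSum.lof ℂ ℕ (fun n => superClass Γ n) n f) =
      spread (desc (f : SpinWreath Γ n → ℂ)) := by
  funext X w
  by_cases h : Nat.card X = n
  · subst h
    simp [labelFun]
  · rw [spread_of_card_ne _ _ h]
    have h0 : DirectSum.lof ℂ ℕ (fun n => superClass Γ n) n f (Nat.card X) = 0 :=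
      DirectSum.of_eq_of_ne _ _ _ h
    change spread (desc ((DirectSum.lof ℂ ℕ (fun n => superClass Γ n) n f (Nat.card X) :
      superClass Γ (Nat.card X)) : SpinWreath Γ (Nat.card X) → ℂ)) X w = 0
    rw [h0, Submodule.coe_zero, ← zero_smul ℂ (0 : SpinWreath Γ (Nat.card X) → ℂ), desc_smul,
      spread_smul, zero_smul]
    rfl

theorem natural_labelFun (v : SpinSpace Γ) : Natural (labelFun v) := by
  intro X Y e w
  change spread (desc (v (Nat.card Y) : SpinWreath Γ (Nat.card Y) → ℂ)) Y _ = spread _ X w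
  rw [← Nat.card_congr e]
  exact natural_spread_desc (v (Nat.card X)).2 X Y e w

/-- Reduces identities of operators on the spin space to identities of functions on labelled
permutations of `Fin n`. -/
theorem eq_of_labelFun_eq {v v' : SpinSpace Γ}
    (h : ∀ n (w : Wr Γ (Fin n)), labelFun v (Fin n) w = labelFun v' (Fin n) w) : v = v' := by
  refine DFinsupp.ext fun n => Subtype.ext (desc_injective (v n).2 (v' n).2 (funext fun w => ?_))
  have h1 : ∀ v : SpinSpace Γ, labelFun v (Fin n) w = desc (v n : SpinWreath Γ n → ℂ) w := by
    intro v
    rw [← spread_self (desc_map (v n).2)]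
    have : ∀ k, k = n → spread (desc (v k).1) (Fin n) w = spread (desc (v n).1) (Fin n) w := by
      rintro _ rfl; rfl
    exact this _ (Nat.card_fin n)
  rw [← h1, ← h1, h]

variable [Fintype Γ]

/-- In the right degree this is induction as a sum over invariant subsets; in any other degree no
decomposition has parts of sizes $n$ and $k$, so both sides are $0$. -/
theorem labelFun_creation {γ : Γ → ℂ} (hγ : γ ∈ classFun Γ) (n : ℕ) (v : SpinSpace Γ) {X : Type}
    [Fintype X] (w : Wr Γ X) :
    labelFun (creation γ n v) X w = conv (gradedSpinFun γ n) (labelFun v) X w := by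
  induction v using DirectSum.induction_on with
  | zero => simp [conv, convTerm]
  | add v v' h h' =>
    rw [map_add, map_add, map_add, Pi.add_apply, Pi.add_apply, h, h', conv, conv, conv,
      ← Finset.sum_add_distrib]
    refine Finset.sum_congr rfl fun S _ => ?_
    simp only [convTerm, Pi.add_apply]
    split_ifs <;> simp [mul_add]
  | of k f =>
    change labelFun (creation γ n (DirectSum.lof ℂ ℕ (fun n => superClass Γ n) k f)) X w =
      conv (gradedSpinFun γ n) (labelFun (DirectSum.lof ℂ ℕ (fun n => superClass Γ n) k f)) X w
    rw [creation, DirectSum.toModule_lof, LinearMap.comp_apply, labelFun_lof, labelFun_lof]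
    change spread (desc (inducedProd rfl (normSpinChar γ n) (f : SpinWreath Γ k → ℂ))) X w = _
    have hmem := inducedProd_mem (rfl : n + k = n + k) (u := normSpinChar γ n)
      (fun _ hx => normSpinChar_odd γ n hx) f.2
    by_cases h : Nat.card X = n + k
    · have e : X ≃ Fin (n + k) := Finite.equivFinOfCardEq h
      rw [spread_eq (desc_map hmem) e, desc_inducedProd rfl (normSpinChar_mem hγ n) f.2]
      exact conv_map (natural_gradedSpinFun hγ n) (natural_spread_desc f.2) e w
    · rw [spread_of_card_ne _ _ h, conv, Finset.sum_eq_zero]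
      intro S _
      unfold convTerm
      split_ifs
      · classical
        by_cases hS : S.card = n
        · rw [spread_of_card_ne (n := k), mul_zero]
          rw [Nat.card_eq_fintype_card, Fintype.card_subtype_compl, Fintype.card_coe]
          rw [Nat.card_eq_fintype_card] at h
          have := S.card_le_univ
          omega
        · rw [gradedSpinFun_eq, if_neg (by simpa using hS), zero_mul]
      · rfl

/-- Restricting the sum to even elements changes nothing, since the spin character vanishes on odd
ones. -/
theorem weightedForm_eq {ξ γ : Γ → ℂ} (hξ : ξ ∈ classFun Γ) (hγ : γ ∈ classFun Γ) {n : ℕ}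
    (v : SpinWreath Γ n → ℂ) : weightedForm ξ (normSpinChar γ n) v =
      (Nat.card (SpinWreath Γ n) : ℂ)⁻¹ * ∑ x, normSpinChar (ξ * γ) n x * v x⁻¹ := by
  classical
  rw [weightedForm, Finset.sum_filter]
  congr 1
  refine Finset.sum_congr rfl fun x _ => ?_
  split_ifs with hx
  · rw [wreathChar_mul_normSpinChar hξ hγ]
  · rw [normSpinChar_odd _ _ ((Int.units_eq_one_or _).resolve_left hx), zero_mul]

/-- The group order is $2\,n!\,|\Gamma|^n$, and its factor $2$ is cancelled by the two lifts of each
labelled permutation. -/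
theorem desc_annihilationMap {ξ γ : Γ → ℂ} (hξ : ξ ∈ classFun Γ) (hγ : γ ∈ classFun Γ)
    {n k m : ℕ} (h : n + k = m) (f : superClass Γ m) (w : Wr Γ (Fin k)) :
    desc (annihilationMap ξ γ h f : SpinWreath Γ k → ℂ) w =
      (n.factorial * (Nat.card Γ : ℂ) ^ n)⁻¹ *
        contr (spinFun (ξ * γ)) (spread (desc (f : SpinWreath Γ m → ℂ))) (Fin n) (Fin k) w := by
  have hξγ := mul_mem_classFun hξ hγ
  have hc : contr (spinFun (ξ * γ)) (spread (desc (f : SpinWreath Γ m → ℂ))) (Fin n) (Fin k) w =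
      contr (spread (desc (normSpinChar (ξ * γ) n))) (spread (desc (f : SpinWreath Γ m → ℂ)))
        (Fin n) (Fin k) w := by
    refine Finset.sum_congr rfl fun v _ => ?_
    rw [spinFun_fin hξγ, spread_self (desc_map (normSpinChar_mem hξγ n))]
  rw [hc]
  by_cases hw : OddOrder w.2
  · rw [desc_of_odd _ hw]
    change weightedForm ξ (normSpinChar γ n) (fun x =>
      (f : SpinWreath Γ m → ℂ) (blockMul h (x, SpinWreath.can w))) = _
    rw [weightedForm_eq hξ hγ, sum_mul_blockMul_can h (normSpinChar_mem hξγ n) f.2 hw,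
      SpinWreath.card_eq, mul_inv, ← mul_assoc, mul_assoc _ _ (2 : ℂ), mul_comm _ (2 : ℂ),
      ← mul_assoc, inv_mul_cancel₀ two_ne_zero, one_mul]
  · rw [desc_of_not _ hw, contr_eq_zero _ _ hw, mul_zero]

theorem labelFun_annihilation {ξ γ : Γ → ℂ} (hξ : ξ ∈ classFun Γ) (hγ : γ ∈ classFun Γ) (n : ℕ)
    (v : SpinSpace Γ) {Y : Type} [Finite Y] (w : Wr Γ Y) :
    labelFun (annihilation ξ γ n v) Y w = (n.factorial * (Nat.card Γ : ℂ) ^ n)⁻¹ *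
      contr (spinFun (ξ * γ)) (labelFun v) (Fin n) Y w := by
  induction v using DirectSum.induction_on with
  | zero => simp [contr]
  | add v v' h h' =>
    rw [map_add, map_add, map_add, Pi.add_apply, Pi.add_apply, h, h', ← mul_add, contr, contr,
      contr, ← Finset.sum_add_distrib]
    simp only [Pi.add_apply, mul_add]
  | of m f =>
    change labelFun (annihilation ξ γ n (DirectSum.lof ℂ ℕ (fun n => superClass Γ n) m f)) Y w =
      _ * contr _ (labelFun (DirectSum.lof ℂ ℕ (fun n => superClass Γ n) m f)) (Fin n) Y w
    rw [labelFun_lof, annihilation, DirectSum.toModule_lof]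
    by_cases h : n + Nat.card Y = m
    · have hn : n ≤ m := by omega
      rw [dif_pos hn, LinearMap.comp_apply, labelFun_lof]
      have e : Y ≃ Fin (m - n) := Finite.equivFinOfCardEq (by omega)
      rw [spread_eq (desc_map (annihilationMap ξ γ (Nat.add_sub_cancel' hn) f).2) e,
        desc_annihilationMap hξ hγ, contr_map (natural_spread_desc f.2)]
    · have h0 : contr (spinFun (ξ * γ)) (spread (desc (f : SpinWreath Γ m → ℂ))) (Fin n) Y w = 0 := by
        refine Finset.sum_eq_zero fun v _ => ?_
        rw [spread_of_card_ne, mul_zero]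
        rwa [Nat.card_sum, Nat.card_fin]
      rw [h0, mul_zero]
      split_ifs with hn
      · rw [LinearMap.comp_apply, labelFun_lof, spread_of_card_ne]
        omega
      · simp

/-- The commutation of annihilation and creation operators. -/
theorem annihilation_creation {ξ α β : Γ → ℂ} (hξ : ξ ∈ classFun Γ) (hα : α ∈ classFun Γ)
    (hβ : β ∈ classFun Γ) (n k : ℕ) (v : SpinSpace Γ) :
    annihilation ξ α n (creation β k v) = ∑ j ∈ Finset.range (n + 1), if j ≤ k then
      ((-1) ^ j * PowerSeries.coeff j (expansion (form ξ α β))) •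
        creation β (k - j) (annihilation ξ α (n - j) v) else 0 := by
  refine eq_of_labelFun_eq fun m w => ?_
  have hΓ : (Nat.card Γ : ℂ) ≠ 0 := by exact_mod_cast Nat.card_pos.ne'
  have ha : ∑ x, (ξ * α) x * β x⁻¹ = Fintype.card Γ * form ξ α β := by
    rw [form, Nat.card_eq_fintype_card, ← mul_assoc, mul_inv_cancel₀, one_mul]
    · rfl
    · rwa [← Nat.card_eq_fintype_card]
  rw [labelFun_annihilation hξ hα, contr_conv_fin (mul_mem_classFun hξ hα) hβ (natural_labelFun v) k
    (fun X _ w => labelFun_creation hβ k v w), map_sum, Finset.sum_apply, Finset.sum_apply,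
    Finset.mul_sum]
  refine Finset.sum_congr rfl fun j hj => ?_
  have hj' : j ≤ n := by simpa [Nat.lt_succ_iff] using hj
  split_ifs with hk
  swap
  · simp
  rw [map_smul, Pi.smul_apply, Pi.smul_apply, labelFun_creation hβ, smul_eq_mul]
  have hconv : conv (gradedSpinFun β (k - j)) (labelFun (annihilation ξ α (n - j) v)) (Fin m) w =
      ((n - j).factorial * (Nat.card Γ : ℂ) ^ (n - j))⁻¹ *
        conv (gradedSpinFun β (k - j)) (contr (spinFun (ξ * α)) (labelFun v) (Fin (n - j)))
          (Fin m) w := by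
    rw [conv, conv, Finset.mul_sum]
    refine Finset.sum_congr rfl fun S _ => ?_
    unfold convTerm
    rw [labelFun_annihilation hξ hα]
    split_ifs
    · ring
    · simp
  rw [hconv, pairing, sum_spinFun_mul_spinFun_inv (mul_mem_classFun hξ hα) hβ ha]
  -- The normalization $n!\,|\Gamma|^n$ splits as $\binom nj$ times those for $j$ and $n-j$. The
  -- first cancels the count of subsets, the second the pairing's prefactor, the third that of the
  -- remaining annihilation.
  have h1 : ((n.choose j : ℂ) * (j.factorial * (n - j).factorial)) = n.factorial := by
    rw [← Nat.choose_mul_factorial_mul_factorial hj']; push_cast; ring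
  have h2 : (Nat.card Γ : ℂ) ^ n = (Nat.card Γ : ℂ) ^ j * (Nat.card Γ : ℂ) ^ (n - j) := by
    rw [← pow_add, Nat.add_sub_cancel' hj']
  have h3 : (n.choose j : ℂ) ≠ 0 := by exact_mod_cast (Nat.choose_pos hj').ne'
  have h4 : (j.factorial : ℂ) ≠ 0 := by exact_mod_cast j.factorial_ne_zero
  have h5 : ((n - j).factorial : ℂ) ≠ 0 := by exact_mod_cast (n - j).factorial_ne_zero
  rw [← h1, h2]
  field_simp

end Operators

/-! ### Coefficients of products of vertex operators -/

section Operators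

open Filter

variable {Γ : Type*} [Group Γ] [Fintype Γ]

theorem annihilation_lof_of_lt (ξ γ : Γ → ℂ) {l m : ℕ} (h : m < l) (f : superClass Γ m) :
    annihilation ξ γ l (DirectSum.lof ℂ ℕ (fun n => superClass Γ n) m f) = 0 := by
  rw [annihilation, DirectSum.toModule_lof, dif_neg (by omega), LinearMap.zero_apply]

/-- A vector has bounded degree, so one truncation bound works for all `p` at once; sums over
different components can then be compared at a common bound. -/
theorem vertexPart_eventually (ξ γ : Γ → ℂ) (v : SpinSpace Γ) : ∀ᶠ L in atTop, ∀ p : ℤ,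
    vertexPart ξ γ p v = ∑ l ∈ Finset.range L, if p ≤ l then
      (-1 : ℂ) ^ l • creation γ (l - p).toNat (annihilation ξ γ l v) else 0 := by
  induction v using DirectSum.induction_on with
  | zero => simp
  | add v v' h h' =>
    filter_upwards [h, h'] with L h h' p
    rw [map_add, h, h', ← Finset.sum_add_distrib]
    refine Finset.sum_congr rfl fun l _ => ?_
    split_ifs <;> simp
  | of m f =>
    filter_upwards [eventually_ge_atTop (m + 1)] with L hL p
    change vertexPart ξ γ p (DirectSum.lof ℂ ℕ (fun n => superClass Γ n) m f) = _
    rw [vertexPart, DirectSum.toModule_lof, LinearMap.sum_apply]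
    rw [← Finset.sum_subset (Finset.range_mono hL)]
    · refine Finset.sum_congr rfl fun l _ => ?_
      split_ifs <;> rfl
    · intro l _ hl
      have := annihilation_lof_of_lt ξ γ (l := l) (m := m) (by simpa using hl) f
      change (if p ≤ l then (-1 : ℂ) ^ l • creation γ (l - p).toNat (annihilation ξ γ l
        (DirectSum.lof ℂ ℕ (fun n => superClass Γ n) m f)) else 0) = 0
      rw [this]
      simp

theorem annihilation_annihilation_lof (ξ α β : Γ → ℂ) {l l' m : ℕ} (h : m < l)
    (f : superClass Γ m) : annihilation ξ α l (annihilation ξ β l'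
      (DirectSum.lof ℂ ℕ (fun n => superClass Γ n) m f)) = 0 := by
  by_cases hl : l' ≤ m
  · rw [annihilation, annihilation, DirectSum.toModule_lof, dif_pos hl, LinearMap.comp_apply,
      DirectSum.toModule_lof, dif_neg (by omega), LinearMap.zero_apply]
  · rw [annihilation_lof_of_lt ξ β (by omega), map_zero]

theorem normalPart_eventually (ξ α β : Γ → ℂ) (v : SpinSpace Γ) : ∀ᶠ L in atTop, ∀ p q : ℤ,
    normalPart ξ α β p q v = ∑ l ∈ Finset.range L, ∑ l' ∈ Finset.range L,
      if p ≤ l ∧ q ≤ l' then (-1 : ℂ) ^ (l + l') • creation α (l - p).toNat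
        (creation β (l' - q).toNat (annihilation ξ α l (annihilation ξ β l' v))) else 0 := by
  induction v using DirectSum.induction_on with
  | zero => simp
  | add v v' h h' =>
    filter_upwards [h, h'] with L h h' p q
    rw [map_add, h, h', ← Finset.sum_add_distrib]
    refine Finset.sum_congr rfl fun l _ => ?_
    rw [← Finset.sum_add_distrib]
    refine Finset.sum_congr rfl fun l' _ => ?_
    split_ifs <;> simp
  | of m f =>
    filter_upwards [eventually_ge_atTop (m + 1)] with L hL p q
    change normalPart ξ α β p q (DirectSum.lof ℂ ℕ (fun n => superClass Γ n) m f) =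
      ∑ l ∈ Finset.range L, ∑ l' ∈ Finset.range L,
      if p ≤ l ∧ q ≤ l' then (-1 : ℂ) ^ (l + l') • creation α (l - p).toNat
        (creation β (l' - q).toNat (annihilation ξ α l (annihilation ξ β l'
          (DirectSum.lof ℂ ℕ (fun n => superClass Γ n) m f)))) else 0
    rw [normalPart, DirectSum.toModule_lof, LinearMap.sum_apply]
    rw [← Finset.sum_subset (Finset.range_mono hL)]
    · refine Finset.sum_congr rfl fun l _ => ?_
      rw [LinearMap.sum_apply, ← Finset.sum_subset (Finset.range_mono hL)]
      · refine Finset.sum_congr rfl fun l' _ => ?_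
        split_ifs <;> rfl
      · intro l' _ hl'
        rw [annihilation_lof_of_lt ξ β (l := l') (m := m) (by simpa using hl') f]
        simp
    · intro l _ hl
      refine Finset.sum_eq_zero fun l' _ => ?_
      rw [annihilation_annihilation_lof ξ α β (l := l) (m := m) (by simpa using hl) f]
      simp

/-- The inner annihilation never raises the degree, so the bound can be taken uniform in `l`. -/
theorem annihilation_annihilation_eventually (ξ α β : Γ → ℂ) (v : SpinSpace Γ) :
    ∀ᶠ N in atTop, ∀ n ≥ N, ∀ l, annihilation ξ α n (annihilation ξ β l v) = 0 := by
  induction v using DirectSum.induction_on with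
  | zero => simp
  | add v v' h h' =>
    filter_upwards [h, h'] with N h h' n hn l
    rw [map_add, map_add, h n hn, h' n hn, add_zero]
  | of m f =>
    filter_upwards [eventually_ge_atTop (m + 1)] with N hN n hn l
    exact annihilation_annihilation_lof ξ α β (by omega) f

/-- The substitution $l=j+n$; `L` is large enough for the triangle to contain the whole rectangle
outside of which `g` vanishes. -/
theorem sum_range_antidiagonal {M : Type*} [AddCommMonoid M] {J N L : ℕ} (hL : J + N ≤ L)
    (g : ℕ → ℕ → M) (h1 : ∀ j n, J ≤ j → g j n = 0) (h2 : ∀ j n, N ≤ n → g j n = 0) :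
    ∑ l ∈ Finset.range L, ∑ j ∈ Finset.range (l + 1), g j (l - j) =
      ∑ j ∈ Finset.range J, ∑ n ∈ Finset.range N, g j n := by
  rw [← Finset.sum_product', ← Finset.sum_fiberwise_of_maps_to (t := Finset.range L)
    (g := fun x : ℕ × ℕ => x.1 + x.2)]
  · refine Finset.sum_congr rfl fun l _ => ?_
    rw [← Finset.Nat.sum_antidiagonal_eq_sum_range_succ g]
    refine (Finset.sum_subset ?_ ?_).symm
    · intro x hx
      rw [Finset.mem_filter] at hx
      exact Finset.HasAntidiagonal.mem_antidiagonal.2 hx.2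
    · intro x hx hx'
      rw [Finset.HasAntidiagonal.mem_antidiagonal] at hx
      rw [Finset.mem_filter, Finset.mem_product, Finset.mem_range, Finset.mem_range] at hx'
      by_cases hj : J ≤ x.1
      · exact h1 _ _ hj
      · exact h2 _ _ (by by_contra hn; exact hx' ⟨⟨by omega, by omega⟩, hx⟩)
  · intro x hx
    rw [Finset.mem_product, Finset.mem_range, Finset.mem_range] at hx
    rw [Finset.mem_range]
    omega

/-- The operator product expansion on the space of spin super class functions. -/
theorem vertexPart_vertexPart {ξ α β : Γ → ℂ} (hξ : ξ ∈ classFun Γ) (hα : α ∈ classFun Γ)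
    (hβ : β ∈ classFun Γ) (p q : ℤ) (v : SpinSpace Γ) :
    {j : ℕ | normalPart ξ α β (p - j) (q + j) v ≠ 0}.Finite ∧
      vertexPart ξ α p (vertexPart ξ β q v) =
        ∑ᶠ j : ℕ, PowerSeries.coeff j (expansion (form ξ α β)) •
          normalPart ξ α β (p - j) (q + j) v := by
  -- A single `N` truncates both the inner vertex operator and the normal ordered products, and
  -- kills annihilation of order at least `N` after any other annihilation.
  obtain ⟨N, hN1, hN2, hN3⟩ := ((vertexPart_eventually ξ β v).and
    ((normalPart_eventually ξ α β v).and (annihilation_annihilation_eventually ξ α β v))).exists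
  set c : ℕ → ℂ := fun j => PowerSeries.coeff j (expansion (form ξ α β)) with hc
  -- For $j\ge J$ one has $q+j\ge N>l'$, so no term of the normal ordered product satisfies its
  -- index condition.
  set J := (N - q).toNat with hJ
  obtain ⟨L, hL, hL'⟩ := ((vertexPart_eventually ξ α (vertexPart ξ β q v)).and
    (eventually_ge_atTop (J + N))).exists
  have hzero : ∀ j : ℕ, J ≤ j → normalPart ξ α β (p - j) (q + j) v = 0 := by
    intro j hj
    rw [hN2]
    refine Finset.sum_eq_zero fun n _ => Finset.sum_eq_zero fun l hl => ?_
    rw [Finset.mem_range] at hl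
    rw [if_neg (by omega)]
  have hfin : {j : ℕ | normalPart ξ α β (p - j) (q + j) v ≠ 0} ⊆ Set.Iio J := by
    intro j hj
    by_contra h
    exact hj (hzero j (by simpa using h))
  refine ⟨(Set.finite_Iio J).subset hfin, ?_⟩
  rw [finsum_eq_sum_of_support_subset (s := Finset.range J)]
  swap
  · intro j hj
    rw [Finset.coe_range]
    refine hfin fun h => hj ?_
    change c j • normalPart ξ α β (p - j) (q + j) v = 0
    rw [h, smul_zero]
  -- The common summand of both sides: `l'` is the order of the `β`-annihilation, `n` that of the
  -- `α`-annihilation, and `j` the degree contracted between the operators.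
  let g : ℕ → ℕ → ℕ → SpinSpace Γ := fun l' j n =>
    if p - j ≤ n ∧ q + j ≤ l' then (c j * (-1 : ℂ) ^ (n + l')) • creation α (n - (p - j)).toNat
      (creation β (l' - (q + j)).toNat (annihilation ξ α n (annihilation ξ β l' v))) else 0
  have hR : ∀ j, c j • normalPart ξ α β (p - j) (q + j) v =
      ∑ n ∈ Finset.range N, ∑ l' ∈ Finset.range N, g l' j n := by
    intro j
    rw [hN2, Finset.smul_sum]
    refine Finset.sum_congr rfl fun n _ => ?_
    rw [Finset.smul_sum]
    refine Finset.sum_congr rfl fun l' _ => ?_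
    simp only [g, smul_ite, smul_zero, smul_smul]
  -- Commuting the `α`-annihilation of order `l` past the `β`-creation leaves order $n=l-j$ in the
  -- term with index `j`.
  have hLt : ∀ l l' : ℕ, (if p ≤ l then (-1 : ℂ) ^ l • creation α (l - p).toNat (annihilation ξ α l
      (if q ≤ l' then (-1 : ℂ) ^ l' •
        creation β (l' - q).toNat (annihilation ξ β l' v) else 0)) else 0) =
      ∑ j ∈ Finset.range (l + 1), g l' j (l - j) := by
    intro l l'
    by_cases hp : p ≤ l
    swap
    · rw [if_neg hp, Finset.sum_eq_zero]
      intro j hj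
      rw [Finset.mem_range] at hj
      simp only [g]
      rw [if_neg (by omega)]
    by_cases hq : q ≤ l'
    swap
    · rw [if_neg hq, map_zero, map_zero, smul_zero, ite_self, Finset.sum_eq_zero]
      intro j hj
      simp only [g]
      rw [if_neg (by omega)]
    rw [if_pos hp, if_pos hq, map_smul, annihilation_creation hξ hα hβ, map_smul, map_sum,
      smul_smul, Finset.smul_sum]
    refine Finset.sum_congr rfl fun j hj => ?_
    rw [Finset.mem_range] at hj
    simp only [g]
    by_cases hjl : j ≤ ((l' : ℤ) - q).toNat
    · rw [if_pos hjl, if_pos (by omega), map_smul, smul_smul]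
      have e1 : ((l' : ℤ) - q).toNat - j = ((l' : ℤ) - (q + j)).toNat := by omega
      have e2 : ((l : ℤ) - p).toNat = (((l - j : ℕ) : ℤ) - (p - j)).toNat := by omega
      -- The sign from $H_-(\alpha,-z)$ absorbs the alternating sign of the commutation relation and
      -- leaves the sign belonging to order $l-j$.
      have e3 : (-1 : ℂ) ^ l * (-1) ^ j = (-1) ^ (l - j) := by
        conv_lhs => rw [← Nat.sub_add_cancel (show j ≤ l by omega), pow_add, mul_assoc, ← pow_add,
          ← two_mul]
        simp
      rw [e1, e2]
      congr 1
      rw [pow_add, ← e3]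
      ring
    · rw [if_neg hjl, if_neg (by omega), map_zero, smul_zero]
  rw [hL, hN1, Finset.sum_congr rfl fun j _ => hR j]
  have h1 : ∑ j ∈ Finset.range J, ∑ n ∈ Finset.range N, ∑ l' ∈ Finset.range N, g l' j n =
      ∑ l' ∈ Finset.range N, ∑ j ∈ Finset.range J, ∑ n ∈ Finset.range N, g l' j n := by
    rw [Finset.sum_comm]
    rw [Finset.sum_congr rfl fun n _ => Finset.sum_comm, Finset.sum_comm]
    exact Finset.sum_congr rfl fun l' _ => Finset.sum_comm
  rw [h1]
  have h2 : ∀ l' ∈ Finset.range N, ∑ j ∈ Finset.range J, ∑ n ∈ Finset.range N, g l' j n =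
      ∑ l ∈ Finset.range L, ∑ j ∈ Finset.range (l + 1), g l' j (l - j) := by
    intro l' hl'
    rw [Finset.mem_range] at hl'
    refine (sum_range_antidiagonal hL' (g l') (fun j n hj => ?_) fun j n hn => ?_).symm
    · simp only [g]
      rw [if_neg (by omega)]
    · simp only [g, hN3 n hn l', map_zero, smul_zero, ite_self]
  rw [Finset.sum_congr rfl h2, Finset.sum_comm]
  refine Finset.sum_congr rfl fun l _ => ?_
  rw [← Finset.sum_congr rfl fun l' _ => hLt l l']
  split_ifs with hp
  · rw [map_sum, map_sum, Finset.smul_sum]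
  · simp

end Operators

/-! ### The lattice factor and the tensor product -/

section Tensor

/-- Local finiteness passes from `v` to a pure tensor $v\otimes w$, hence to finite sums of pure
tensors, where the finite sums over `j` may be added. -/
theorem map_eq_finsum {V W : Type*} [AddCommMonoid V] [Module ℂ V] [AddCommMonoid W] [Module ℂ W]
    {P : V →ₗ[ℂ] V} {N : ℕ → V →ₗ[ℂ] V} {c : ℕ → ℂ}
    (h : ∀ v, {j | N j v ≠ 0}.Finite ∧ P v = ∑ᶠ j, c j • N j v) {R R' : W →ₗ[ℂ] W} {ε : ℂ}
    (hR : R = ε • R') (x : V ⊗[ℂ] W) :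
    {j | TensorProduct.map (N j) R' x ≠ 0}.Finite ∧
      TensorProduct.map P R x = ε • ∑ᶠ j, c j • TensorProduct.map (N j) R' x := by
  induction x using TensorProduct.induction_on with
  | zero => simp
  | tmul v w =>
    obtain ⟨h1, h2⟩ := h v
    have hs : ∀ j, TensorProduct.map (N j) R' (v ⊗ₜ w) ≠ 0 → N j v ≠ 0 := by
      intro j hj h0
      rw [TensorProduct.map_tmul, h0, TensorProduct.zero_tmul] at hj
      exact hj rfl
    refine ⟨h1.subset hs, ?_⟩
    have hs' : Function.support (fun j => c j • N j v) ⊆ h1.toFinset := by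
      intro j hj
      rw [Set.Finite.coe_toFinset]
      intro h0
      exact hj (by simp only [h0, smul_zero])
    have hs'' : Function.support (fun j => c j • TensorProduct.map (N j) R' (v ⊗ₜ[ℂ] w)) ⊆
        h1.toFinset := by
      intro j hj
      rw [Set.Finite.coe_toFinset]
      refine hs j fun h0 => hj ?_
      simp only [h0, smul_zero]
    rw [TensorProduct.map_tmul, h2, finsum_eq_sum_of_support_subset _ hs',
      finsum_eq_sum_of_support_subset _ hs'', hR, LinearMap.smul_apply, TensorProduct.tmul_smul,
      TensorProduct.sum_tmul]
    simp only [TensorProduct.map_tmul, TensorProduct.smul_tmul']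
  | add x y hx hy =>
    obtain ⟨h1, h2⟩ := hx
    obtain ⟨h3, h4⟩ := hy
    refine ⟨(h1.union h3).subset fun j hj => ?_, ?_⟩
    · by_contra h0
      simp only [Set.mem_union, Set.mem_ofPred_eq, not_or, not_not] at h0
      exact hj (by rw [map_add, h0.1, h0.2, add_zero])
    · have hs : ∀ x, {j | TensorProduct.map (N j) R' x ≠ 0}.Finite →
          (Function.support fun j => c j • TensorProduct.map (N j) R' x).Finite :=
        fun x hx => hx.subset fun j hj h0 => hj (by simp only [h0, smul_zero])
      rw [map_add, h2, h4, ← smul_add, ← finsum_add_distrib (hs x h1) (hs y h3)]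
      simp only [map_add, smul_add]

/-- Both products of lifts lie over the same element, so by exactness they differ by some $u=\pm1$,
which acts as a scalar. At $e^{[0]}$, where all chosen lifts act without sign, the left side gives
$\epsilon(\alpha,\beta)e^{[\alpha+\beta]}$ and the right side $u\,e^{[\alpha+\beta]}$. -/
theorem twisted_mul {Γ : Type*} [Group Γ] [Fintype Γ] {Φ : AddSubgroup (virtualChar Γ)}
    {E : Type*} [Group E] {S : GroupExtension ℤˣ E (Multiplicative (ModN (virtualChar Γ) 2))}
    {e : ModN (virtualChar Γ) 2 → E}
    {ρ : Representation ℂ E (AddMonoidAlgebra ℂ (virtualChar Γ ⧸ Φ))}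
    {ε : virtualChar Γ → virtualChar Γ → ℤˣ} (h : IsTwistedModule Φ S e ρ ε)
    (α β : virtualChar Γ) :
    ρ (e (ModN.mkQ 2 α)) ∘ₗ ρ (e (ModN.mkQ 2 β)) =
      ((ε α β : ℤ) : ℂ) • ρ (e (ModN.mkQ 2 α + ModN.mkQ 2 β)) := by
  obtain ⟨u, hu⟩ : ∃ u : ℤˣ, S.inl u =
      e (ModN.mkQ 2 α) * e (ModN.mkQ 2 β) * (e (ModN.mkQ 2 α + ModN.mkQ 2 β))⁻¹ := by
    rw [← MonoidHom.mem_range, S.range_inl_eq_ker_rightHom, MonoidHom.mem_ker, map_mul, map_mul,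
      map_inv, h.lift, h.lift, h.lift, ofAdd_add, mul_inv_cancel]
  have hρ : ρ (S.inl u) = ((u : ℤ) : ℂ) • 1 := by
    rcases Int.units_eq_one_or u with rfl | rfl
    · simp
    · rw [h.neg_one, Units.val_neg, Units.val_one, Int.cast_neg, Int.cast_one]
      exact (neg_one_smul ℂ _).symm
  have hmul : ρ (e (ModN.mkQ 2 α)) ∘ₗ ρ (e (ModN.mkQ 2 β)) =
      ((u : ℤ) : ℂ) • ρ (e (ModN.mkQ 2 α + ModN.mkQ 2 β)) := by
    rw [← Module.End.mul_eq_comp, ← map_mul, ← eq_mul_inv_iff_mul_eq.1 hu, map_mul, hρ, smul_mul_assoc,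
      one_mul]
  have h0 := LinearMap.congr_fun hmul (AddMonoidAlgebra.single ((0 : virtualChar Γ) : virtualChar Γ ⧸ Φ) 1)
  have hα := h.action α β
  have hβ := h.action β 0
  have hαβ := h.action (α + β) 0
  rw [h.normalized, add_zero] at hβ hαβ
  rw [map_add] at hαβ
  rw [LinearMap.comp_apply, hβ, LinearMap.smul_apply, hαβ] at h0
  simp only [Units.val_one, Int.cast_one, one_smul] at h0
  rw [hα] at h0
  have hne : (AddMonoidAlgebra.single ((α + β : virtualChar Γ) : virtualChar Γ ⧸ Φ) 1 :
      AddMonoidAlgebra ℂ (virtualChar Γ ⧸ Φ)) ≠ 0 := by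
    simp
  rw [hmul, smul_left_injective ℂ hne h0]

theorem vertexOp_vertexOp {Γ : Type*} [Group Γ] [Fintype Γ] (ξ : virtualChar Γ)
    {Φ : AddSubgroup (virtualChar Γ)}
    {E : Type*} [Group E] {S : GroupExtension ℤˣ E (Multiplicative (ModN (virtualChar Γ) 2))}
    {e : ModN (virtualChar Γ) 2 → E}
    {ρ : Representation ℂ E (AddMonoidAlgebra ℂ (virtualChar Γ ⧸ Φ))}
    {ε : virtualChar Γ → virtualChar Γ → ℤˣ} (h : IsTwistedModule Φ S e ρ ε)
    (α β : virtualChar Γ) (p q : ℤ)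
    (v : SpinSpace Γ ⊗[ℂ] AddMonoidAlgebra ℂ (virtualChar Γ ⧸ Φ)) :
    {j : ℕ | normalOp ξ e ρ α β (p - j) (q + j) v ≠ 0}.Finite ∧
      vertexOp ξ e ρ α p (vertexOp ξ e ρ β q v) =
        ((ε α β : ℤ) : ℂ) • ∑ᶠ j : ℕ, PowerSeries.coeff j (expansion (form (Γ := Γ) ξ α β)) •
          normalOp ξ e ρ α β (p - j) (q + j) v := by
  have hv : ∀ v : SpinSpace Γ, {j : ℕ | normalPart (ξ : Γ → ℂ) α β (p - j) (q + j) v ≠ 0}.Finite ∧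
      (vertexPart (ξ : Γ → ℂ) α p ∘ₗ vertexPart (ξ : Γ → ℂ) β q) v =
        ∑ᶠ j : ℕ, PowerSeries.coeff j (expansion (form (Γ := Γ) ξ α β)) •
          normalPart (ξ : Γ → ℂ) α β (p - j) (q + j) v :=
    vertexPart_vertexPart (virtualChar_le_classFun ξ.2) (virtualChar_le_classFun α.2)
      (virtualChar_le_classFun β.2) p q
  have key := map_eq_finsum (N := fun j : ℕ => normalPart (ξ : Γ → ℂ) α β (p - j) (q + j))
    (c := fun j => PowerSeries.coeff j (expansion (form (Γ := Γ) ξ α β))) hv (twisted_mul h α β) v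
  rw [TensorProduct.map_comp] at key
  exact key

end Tensor
end
end TwistedVertex

theorem mainTheorem8 {Γ : Type*} [Group Γ] [Fintype Γ]
    (ξ : virtualChar Γ) (hξ : ∀ x : Γ, (ξ : Γ → ℂ) x⁻¹ = (ξ : Γ → ℂ) x) :
    (∀ α ∈ classFun Γ, ∀ β ∈ classFun Γ, ∀ (p q : ℤ) (v : SpinSpace Γ),
      {j : ℕ | normalPart ξ α β (p - j) (q + j) v ≠ 0}.Finite ∧
      vertexPart ξ α p (vertexPart ξ β q v) =
        ∑ᶠ j : ℕ, PowerSeries.coeff j (expansion (form ξ α β)) •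
          normalPart ξ α β (p - j) (q + j) v) ∧
    (∀ (Φ : AddSubgroup (virtualChar Γ)),
      Maximal (fun Ψ : AddSubgroup (virtualChar Γ) =>
        ∀ α ∈ Ψ, ∀ β ∈ Ψ, altForm ξ α β = 0) Φ →
      ∀ {E : Type*} [Group E]
        (S : GroupExtension ℤˣ E (Multiplicative (ModN (virtualChar Γ) 2))),
      IsSpinExtension ξ S →
      ∀ (e : ModN (virtualChar Γ) 2 → E)
        (ρ : Representation ℂ E (AddMonoidAlgebra ℂ (virtualChar Γ ⧸ Φ)))
        (ε : virtualChar Γ → virtualChar Γ → ℤˣ),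
      IsTwistedModule Φ S e ρ ε →
      ∀ (α β : virtualChar Γ) (p q : ℤ)
        (v : SpinSpace Γ ⊗[ℂ] AddMonoidAlgebra ℂ (virtualChar Γ ⧸ Φ)),
      {j : ℕ | normalOp ξ e ρ α β (p - j) (q + j) v ≠ 0}.Finite ∧
      vertexOp ξ e ρ α p (vertexOp ξ e ρ β q v) =
        ((ε α β : ℤ) : ℂ) • ∑ᶠ j : ℕ, PowerSeries.coeff j (expansion (form (Γ := Γ) ξ α β)) •
          normalOp ξ e ρ α β (p - j) (q + j) v) := by
  have hξ' := virtualChar_le_classFun ξ.2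
  refine ⟨fun α hα β hβ p q v => vertexPart_vertexPart hξ' hα hβ p q v, ?_⟩
  intro Φ _ E _ S _ e ρ ε h α β p q v
  exact vertexOp_vertexOp ξ h α β p q v
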